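/- Let $p\in(0,1)$, $\beta^*\in\mathbb R^d$, and let $(D_k,x_k,\epsilon_k)_{k\in\mathbb Z}$ be i.i.d. with $D_k,x_k,\epsilon_k$ mutually independent, where $D_k$ is a random diagonal $d\times d$ matrix with i.i.d. Bernoulli$(p)$ diagonal entries, $x_k\in\mathbb R^d$ is square integrable with $\min_i\mathbb E[x_{1,i}^2]>0$, and $\epsilon_k\in\mathbb R$ satisfies $\mathbb E[\epsilon_k]=0$, $\mathrm{Var}(\epsilon_k)=1$. Put $y_k=x_k^\top\beta^*+\epsilon_k$. For $\alpha>0$ let $$f_{k,\alpha}(u)=u+\alpha D_kx_k\,(y_k-x_k^\top D_ku),\qquad u\in\mathbb R^d .$$ For an initial vector $\breve\beta_0(\alpha)\in\mathbb R^d$ define the SGD dropout iterates $\breve\beta_k(\alpha)=f_{k,\alpha}(\breve\beta_{k-1}(\alpha))$, $k\ge1$, and their averages $\bar\beta^{\mathrm{sgd}}_n(\alpha)=\frac1n\sum_{k=1}^n\breve\beta_k(\alpha)$. For $q\ge2$ and a unit vector $v$ set $\mu_q(v)=(\mathbb E\|D_1x_1x_1^\top D_1v\|_2^q)^{1/q}\in[0,\infty]$,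 and for a square matrix $A$ set $A_p=pA+(1-p)\mathrm{Diag}(A)$. Say that $\alpha>0$ satisfies the SGD condition with exponent $q$ if $$\frac{\alpha(q-1)}2\ \sup_{\|v\|_2=1}\frac{(1+\alpha\mu_q(v))^{q-2}\mu_q(v)^2}{p\,v^\top\mathbb E[(x_1x_1^\top)_p]v}<1,$$ which in particular requires $\mu_q(v)<\infty$ for every unit vector $v$. Let $q\ge2$ and let $\alpha_1,\dots,\alpha_s>0$ satisfy the SGD condition with exponent $q$. Then the following hold. (1) The loss $\beta\mapsto\mathbb E[\frac12(y_1-x_1^\top D_1\beta)^2]$ has a unique minimizer $\breve\beta\in\mathbb R^d$. (2) For each $i\le s$ and $k\in\mathbb Z$ there is a random vector $\breve\beta_k^\circ(\alpha_i)$ such that, for every $u\in\mathbb R^d$, almost surely $f_{k,\alpha_i}\circ f_{k-1,\alpha_i}\circ\cdots\circ f_{k-m,\alpha_i}(u)\to\breve\beta_k^\circ(\alpha_i)$ as $m\to\infty$. These vectors are square integrable. (3) With $\mathrm{vec}(u_1,\dots,u_s)=(u_1^\top,\dots,u_s^\top)^\top\in\mathbb R^{ds}$, the series defining the joint long-run covariance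 matrix $$\breve\Sigma^{\mathrm{vec}}=\sum_{k=-\infty}^{\infty}\mathrm{Cov}\Big(\mathrm{vec}\big(\breve\beta_0^\circ(\alpha_1),\dots,\breve\beta_0^\circ(\alpha_s)\big),\mathrm{vec}\big(\breve\beta_k^\circ(\alpha_1),\dots,\breve\beta_k^\circ(\alpha_s)\big)\Big)$$ converges absolutely in every entry, and $\breve\Sigma^{\mathrm{vec}}$ is positive semidefinite. (4) For any deterministic initial vectors $\breve\beta_0(\alpha_1),\dots,\breve\beta_0(\alpha_s)\in\mathbb R^d$, as $n\to\infty$, $$\sqrt n\;\mathrm{vec}\big(\bar\beta^{\mathrm{sgd}}_n(\alpha_1)-\breve\beta,\dots,\bar\beta^{\mathrm{sgd}}_n(\alpha_s)-\breve\beta\big)\Rightarrow\mathcal N\big(0,\breve\Sigma^{\mathrm{vec}}\big).$$ -/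

import Mathlib

open MeasureTheory ProbabilityTheory Filter Topology
open scoped ENNReal Matrix RealInnerProductSpace

noncomputable section

namespace SGDDropout

/-- `ℝᵈ` with the Euclidean norm. -/
abbrev Vec (d : ℕ) : Type := EuclideanSpace ℝ (Fin d)

/-- The diagonal `0/1` dropout matrix `D` given by a mask (`true` means "retained"). -/
def dropMat {d : ℕ} (m : Fin d → Bool) : Matrix (Fin d) (Fin d) ℝ :=
  Matrix.diagonal fun i => if m i then 1 else 0

/-- The Gram matrix `x xᵀ` of a covariate vector. -/
def gram {d : ℕ} (x : Vec d) : Matrix (Fin d) (Fin d) ℝ :=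
  Matrix.of fun a b => x a * x b

/-- `A_p = p A + (1 - p) Diag(A)`. -/
def rescale {d : ℕ} (p : ℝ) (A : Matrix (Fin d) (Fin d) ℝ) : Matrix (Fin d) (Fin d) ℝ :=
  p • A + (1 - p) • Matrix.diagonal fun i => A i i

/-- The random input `ξ = (D, (y, x))` of one iteration. -/
structure Sample (d : ℕ) where
  mask : Fin d → Bool
  y : ℝ
  x : Vec d

/-- One SGD step with dropout: `u ↦ u + α D x (y - xᵀ D u)`. -/
def step {d : ℕ} (α : ℝ) (ξ : Sample d) (u : Vec d) : Vec d :=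
  u + (α * (ξ.y - ⟪ξ.x, Matrix.toEuclideanLin (dropMat ξ.mask) u⟫)) •
    Matrix.toEuclideanLin (dropMat ξ.mask) ξ.x

/-- The SGD dropout iterates `β₀ = u`, `β_k = f_{ξ_k}(β_{k-1})` for `k ≥ 1`. -/
def iter {d : ℕ} (α : ℝ) (ξ : ℤ → Sample d) (u : Vec d) : ℕ → Vec d
  | 0 => u
  | k + 1 => step α (ξ ((k : ℤ) + 1)) (iter α ξ u k)

/-- The Ruppert-Polyak average `n⁻¹ ∑_{k=1}^n β_k`. -/
def avg {d : ℕ} (α : ℝ) (ξ : ℤ → Sample d) (u : Vec d) (n : ℕ) : Vec d :=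
  (n : ℝ)⁻¹ • ∑ k ∈ Finset.Icc 1 n, iter α ξ u k

/-- The backward composition `f_{ξ_k} ∘ f_{ξ_{k-1}} ∘ ⋯ ∘ f_{ξ_{k-m}} (u)`. -/
def backward {d : ℕ} (α : ℝ) (ξ : ℤ → Sample d) (u : Vec d) : ℕ → ℤ → Vec d
  | 0, k => step α (ξ k) u
  | m + 1, k => step α (ξ k) (backward α ξ u m (k - 1))

/-- Stacking of `s` vectors of `ℝᵈ` into one vector with `s * d` coordinates; the coordinate
`(i, a)` is the `a`-th entry of the `i`-th vector. -/
def stack {s d : ℕ} (u : Fin s → Vec d) : EuclideanSpace ℝ (Fin s × Fin d) :=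
  WithLp.toLp 2 fun ia => u ia.1 ia.2

/-- The data of the linear regression model with dropout: for every `k ∈ ℤ` a dropout mask,
a covariate vector and a noise variable, where

* the triples are independent over `k`, and for each `k` the mask entries are i.i.d.
  Bernoulli(`p`), and the mask, the covariate and the noise are mutually independent;
* the covariates are identically distributed and square integrable with
  `E[(x_a)²] > 0` for every coordinate `a` (reduced form);
* the noises are identically distributed with mean `0` and variance `1`. -/
structure IsModel {Ω : Type*} [MeasurableSpace Ω] (P : Measure Ω) {d : ℕ} (p : ℝ)
    (mask : ℤ → Ω → Fin d → Bool) (x : ℤ → Ω → Vec d) (noise : ℤ → Ω → ℝ) : Prop where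
  p_pos : 0 < p
  p_lt_one : p < 1
  measurable_mask : ∀ k, Measurable (mask k)
  measurable_x : ∀ k, Measurable (x k)
  measurable_noise : ∀ k, Measurable (noise k)
  indep : iIndepFun (fun k ω => (mask k ω, x k ω, noise k ω)) P
  indep_mask_entries : ∀ k, iIndepFun (fun i ω => mask k ω i) P
  indep_mask : ∀ k, IndepFun (mask k) (fun ω => (x k ω, noise k ω)) P
  indep_noise : ∀ k, IndepFun (x k) (noise k) P
  prob_mask : ∀ k i, P {ω | mask k ω i = true} = ENNReal.ofReal p
  identDistrib_x : ∀ k, IdentDistrib (x k) (x 1) P P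
  identDistrib_noise : ∀ k, IdentDistrib (noise k) (noise 1) P P
  memLp_x : MemLp (x 1) 2 P
  reduced_form : ∀ a, 0 < ∫ ω, (x 1 ω a) ^ 2 ∂P
  memLp_noise : MemLp (noise 1) 2 P
  mean_noise : ∫ ω, noise 1 ω ∂P = 0
  variance_noise : Var[noise 1; P] = 1

/-- The observed input sequence, with `y_k = x_kᵀ β* + ε_k`. -/
def samples {Ω : Type*} {d : ℕ} (βstar : Vec d) (mask : ℤ → Ω → Fin d → Bool)
    (x : ℤ → Ω → Vec d) (noise : ℤ → Ω → ℝ) (ω : Ω) (k : ℤ) : Sample d where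
  mask := mask k ω
  y := ⟪x k ω, βstar⟫ + noise k ω
  x := x k ω

/-- The marginalized loss `E[(y - xᵀ D β)² / 2]`, expectation over data and dropout. -/
def risk {Ω : Type*} [MeasurableSpace Ω] (P : Measure Ω) {d : ℕ} (ξ : Ω → ℤ → Sample d)
    (β : Vec d) : ℝ :=
  ∫ ω, (1 / 2) * ((ξ ω 1).y -
    ⟪(ξ ω 1).x, Matrix.toEuclideanLin (dropMat (ξ ω 1).mask) β⟫) ^ 2 ∂P

/-- `b` is the unique minimizer of the marginalized loss. -/
def IsL2Minimizer {Ω : Type*} [MeasurableSpace Ω] (P : Measure Ω) {d : ℕ}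
    (ξ : Ω → ℤ → Sample d) (b : Vec d) : Prop :=
  ∀ β, β ≠ b → risk P ξ b < risk P ξ β

/-- `μ_q(v) = (E ‖D x xᵀ D v‖^q)^{1/q} ∈ [0, ∞]`. -/
def mu {Ω : Type*} [MeasurableSpace Ω] (P : Measure Ω) {d : ℕ} (ξ : Ω → ℤ → Sample d)
    (q : ℝ) (v : Vec d) : ℝ≥0∞ :=
  eLpNorm (fun ω => Matrix.toEuclideanLin
    (dropMat (ξ ω 1).mask * gram (ξ ω 1).x * dropMat (ξ ω 1).mask) v) (ENNReal.ofReal q) P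

/-- The matrix `E[(x xᵀ)_p]`. -/
def meanGramP {Ω : Type*} [MeasurableSpace Ω] (P : Measure Ω) {d : ℕ} (p : ℝ)
    (ξ : Ω → ℤ → Sample d) : Matrix (Fin d) (Fin d) ℝ :=
  Matrix.of fun a b => ∫ ω, rescale p (gram (ξ ω 1).x) a b ∂P

/-- The learning-rate condition: `α > 0` and
`(α (q - 1) / 2) sup_{‖v‖ = 1} (1 + α μ_q(v))^{q-2} μ_q(v)² / (p vᵀ E[(x xᵀ)_p] v) < 1`.
It is stated in `[0, ∞]`, so that it entails `μ_q(v) < ∞` for all unit vectors `v`. -/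
def RateCondition {Ω : Type*} [MeasurableSpace Ω] (P : Measure Ω) {d : ℕ} (p : ℝ)
    (ξ : Ω → ℤ → Sample d) (q α : ℝ) : Prop :=
  0 < α ∧
  ENNReal.ofReal (α * (q - 1) / 2) *
    (⨆ v : {v : Vec d // ‖v‖ = 1},
      (1 + ENNReal.ofReal α * mu P ξ q v.1) ^ (q - 2) * mu P ξ q v.1 ^ 2 /
        ENNReal.ofReal (p * ⟪v.1, Matrix.toEuclideanLin (meanGramP P p ξ) v.1⟫)) < 1

/-- `B` is the stationary dropout process `β°_k(α)`, `k ∈ ℤ`: for every starting point `u`, the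
backward iterates started at `u` converge to it almost surely. This determines each `B k` up to
a null set. -/
def IsStationaryProcess {Ω : Type*} [MeasurableSpace Ω] (P : Measure Ω) {d : ℕ}
    (ξ : Ω → ℤ → Sample d) (α : ℝ) (B : ℤ → Ω → Vec d) : Prop :=
  ∀ k u, ∀ᵐ ω ∂P, Tendsto (fun m => backward α (ξ ω) u m k) atTop (𝓝 (B k ω))

/-- `S = ∑_{k ∈ ℤ} Cov(Z 0, Z k)`, the series being absolutely convergent in every entry and
the vectors `Z k` being square integrable. -/
def IsLongRunCovariance {Ω : Type*} [MeasurableSpace Ω] (P : Measure Ω) {ι : Type*} [Fintype ι]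
    (Z : ℤ → Ω → EuclideanSpace ℝ ι) (S : Matrix ι ι ℝ) : Prop :=
  (∀ k, MemLp (Z k) 2 P) ∧
  ∀ a b, HasSum (fun k : ℤ => cov[fun ω => Z 0 ω a, fun ω => Z k ω b; P]) (S a b)

end SGDDropout

end

set_option linter.unusedSectionVars false

namespace SGDDropout

/-! ### Second moments, independence and characteristic functions -/

section General

variable {Ω : Type*} [MeasurableSpace Ω] {P : Measure Ω}

/-! Write `z = D x`. A step is `u ↦ (I - α z zᵀ) u + α y z`, an affine random map. The matrix `E[z
zᵀ]` is positive definite, because dropout adds `p (1 - p) Diag(E[x xᵀ])` to `p² E[x xᵀ]`. Hence the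
normal equation `E[(y - zᵀ b) z] = 0` has a solution `b`, and `b` is the unique minimizer of the
risk (`isL2Minimizer`). After centering at `b` the intercept `α (y - zᵀ b) z` has mean zero for
every learning rate at once, so the `s` chains can be stacked into a single affine chain driven by
the same inputs.

For every `q ≥ 2` the rate condition implies its version for `q = 2`, which says that `I - α z zᵀ`
contracts in mean square (`exists_integral_norm_slopeOp_le`). It also gives the fourth-order moments
that put the intercept in `L²`. Everything else holds for an abstract `AffineChain`: i.i.d. random
affine maps, contracting in `L²` at rate `ρ < 1`, with centered intercepts.

For such a chain the increments of the backward compositions decay like `ρ ^ m` in `L²`. They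
therefore converge almost surely, to a stationary solution `Z` that does not depend on the starting
point. With `M = E[A]`, one has `Z_{k+1} = M Z_k + ζ_{k+1}`, where `ζ` is a stationary martingale
difference. Since `‖M‖ < 1`, covariances at lag `n` are governed by `Mⁿ`. Summing the geometric
series identifies the long-run covariance in directions `s`, `t` with the covariance of `ζ` in the
directions `(1 - Mᵀ)⁻¹ s` and `(1 - Mᵀ)⁻¹ t` (`hasSum_integral_inner_stat`). This also makes it
positive semidefinite.

The same resolvent turns partial sums of the iterates into martingale sums, up to an error bounded
in `L¹` (`exists_integral_fwdSum_sub_martSum_le`). The martingale sums are compared with i.i.d.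
blocks: on each block of length `L` the chain is restarted at `0`. The restart error is again a sum
of orthogonal terms, whose second moments decay geometrically inside a block. Each block thus costs
a bounded amount whatever `L` is, and after normalization the error is `O(L^{-1/2})`
(`exists_integral_martSum_sub_blockSum_sq_le`). The classical central limit theorem for the blocks,
followed by `L → ∞`, gives convergence of the characteristic functions in every direction `t`, hence
the joint Gaussian limit. -/

theorem eLpNorm_two_sq {F : Type*} [ENorm F] (f : Ω → F) :
    eLpNorm f 2 P ^ 2 = ∫⁻ ω, ‖f ω‖ₑ ^ 2 ∂P := by
  rw [eLpNorm_eq_lintegral_rpow_enorm_toReal (by simp) (by simp), ← ENNReal.rpow_natCast,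
    ← ENNReal.rpow_mul]
  simp

theorem eLpNorm_two_le_iff {F : Type*} [ENorm F] {f : Ω → F} {C : ℝ≥0∞} :
    eLpNorm f 2 P ≤ C ↔ ∫⁻ ω, ‖f ω‖ₑ ^ 2 ∂P ≤ C ^ 2 := by
  rw [← eLpNorm_two_sq]
  exact (ENNReal.pow_le_pow_left_iff two_ne_zero).symm

theorem integral_sq_eq_toReal_eLpNorm {f : Ω → ℝ} (hf : AEStronglyMeasurable f P) :
    ∫ ω, f ω ^ 2 ∂P = (eLpNorm f 2 P).toReal ^ 2 := by
  rw [← ENNReal.toReal_pow, eLpNorm_two_sq,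
    integral_eq_lintegral_of_nonneg_ae (ae_of_all _ fun ω => sq_nonneg _) (hf.pow 2)]
  congr 1
  refine lintegral_congr fun ω => ?_
  rw [← sq_abs, ENNReal.ofReal_pow (abs_nonneg _), ← Real.norm_eq_abs, ofReal_norm]

theorem integral_sq_le_of_eLpNorm_le {f : Ω → ℝ} (hf : AEStronglyMeasurable f P) {C : ℝ}
    (hC : 0 ≤ C) (h : eLpNorm f 2 P ≤ ENNReal.ofReal C) : ∫ ω, f ω ^ 2 ∂P ≤ C ^ 2 := by
  rw [integral_sq_eq_toReal_eLpNorm hf]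
  exact pow_le_pow_left₀ ENNReal.toReal_nonneg (ENNReal.toReal_le_of_le_ofReal hC h) 2

theorem integral_abs_le_sqrt_integral_sq [IsProbabilityMeasure P] {f : Ω → ℝ}
    (hf : MemLp f 2 P) : ∫ ω, |f ω| ∂P ≤ √(∫ ω, f ω ^ 2 ∂P) := by
  refine Real.le_sqrt_of_sq_le ?_
  have h := variance_nonneg |f| P
  rw [variance_eq_sub hf.abs] at h
  simpa using h

theorem integral_abs_le_toReal_eLpNorm [IsProbabilityMeasure P] {F : Type*}
    [NormedAddCommGroup F] {f : Ω → F}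
    (hf : MemLp f 2 P) : ∫ ω, ‖f ω‖ ∂P ≤ (eLpNorm f 2 P).toReal := by
  rw [integral_norm_eq_lintegral_enorm hf.1, ← eLpNorm_one_eq_lintegral_enorm]
  exact ENNReal.toReal_mono hf.2.ne (eLpNorm_le_eLpNorm_of_exponent_le (by norm_num) hf.1)

/-- Freezing: under independence the joint law is a product, so Tonelli allows integrating over `ξ`
with `V` held fixed. This replaces conditioning on the past throughout. -/
theorem lintegral_comp_of_indepFun [IsProbabilityMeasure P] {X W : Type*} [MeasurableSpace X]
    [MeasurableSpace W] {ξ : Ω → X} {V : Ω → W} (hξ : Measurable ξ) (hV : Measurable V)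
    (h : IndepFun ξ V P) {Φ : X × W → ℝ≥0∞} (hΦ : Measurable Φ) :
    ∫⁻ ω, Φ (ξ ω, V ω) ∂P = ∫⁻ ω', ∫⁻ ω, Φ (ξ ω, V ω') ∂P ∂P := by
  have hm := h.map_prod_eq_prod_map_map hξ.aemeasurable hV.aemeasurable
  have := Measure.isProbabilityMeasure_map (μ := P) hξ.aemeasurable
  have := Measure.isProbabilityMeasure_map (μ := P) hV.aemeasurable
  rw [← lintegral_map hΦ (hξ.prodMk hV), hm, lintegral_prod_symm _ hΦ.aemeasurable,
    lintegral_map hΦ.lintegral_prod_left' hV]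
  refine lintegral_congr fun ω' => ?_
  rw [lintegral_map (by fun_prop) hξ]

/-- Fubini handles the integrable case. Otherwise the Bochner integral is zero by convention, so no
integrability assumption is needed. -/
theorem integral_comp_eq_zero_of_indepFun [IsProbabilityMeasure P] {X W : Type*}
    [MeasurableSpace X]
    [MeasurableSpace W] {ξ : Ω → X} {V : Ω → W} (hξ : Measurable ξ) (hV : Measurable V)
    (h : IndepFun ξ V P) {Φ : X × W → ℝ} (hΦ : Measurable Φ)
    (h0 : ∀ w, ∫ ω, Φ (ξ ω, w) ∂P = 0) :
    ∫ ω, Φ (ξ ω, V ω) ∂P = 0 := by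
  have hm := h.map_prod_eq_prod_map_map hξ.aemeasurable hV.aemeasurable
  have := Measure.isProbabilityMeasure_map (μ := P) hξ.aemeasurable
  have := Measure.isProbabilityMeasure_map (μ := P) hV.aemeasurable
  by_cases hi : Integrable Φ ((P.map ξ).prod (P.map V))
  · rw [← integral_map (φ := fun ω => (ξ ω, V ω)) (f := Φ) (by fun_prop)
      hΦ.aestronglyMeasurable, hm, integral_prod_symm _ hi]
    convert integral_zero W ℝ with w
    rw [integral_map (by fun_prop) (Measurable.aestronglyMeasurable (by fun_prop)), h0]
  · rw [integral_undef]
    intro hi'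
    refine hi ?_
    rw [← hm, integrable_map_measure hΦ.aestronglyMeasurable (by fun_prop)]
    exact hi'

/-- Lifts an `L²` bound valid for each deterministic argument to a random argument independent of
the input, by freezing the argument. -/
theorem eLpNorm_comp_le_of_indepFun [IsProbabilityMeasure P] {X W F G : Type*}
    [MeasurableSpace X] [MeasurableSpace W] [NormedAddCommGroup F] [MeasurableSpace F]
    [BorelSpace F] [ENorm G] {ξ : Ω → X} {V : Ω → W} (hξ : Measurable ξ) (hV : Measurable V)
    (h : IndepFun ξ V P) {Φ : X × W → F} (hΦ : Measurable Φ) {Ψ : W → G} {C : ℝ≥0∞}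
    (hC : C ≠ ∞) (hb : ∀ w, eLpNorm (fun ω => Φ (ξ ω, w)) 2 P ≤ C * ‖Ψ w‖ₑ) :
    eLpNorm (fun ω => Φ (ξ ω, V ω)) 2 P ≤ C * eLpNorm (fun ω => Ψ (V ω)) 2 P := by
  rw [eLpNorm_two_le_iff, lintegral_comp_of_indepFun hξ hV h (Φ := fun z => ‖Φ z‖ₑ ^ 2)
    (by fun_prop), mul_pow, eLpNorm_two_sq, ← lintegral_const_mul' _ _ (by finiteness)]
  refine lintegral_mono fun ω' => ?_
  have := hb (V ω')
  rw [eLpNorm_two_le_iff, mul_pow] at this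
  exact this

/-- Pythagoras for martingale differences; only orthogonality of each term to the preceding partial
sum is used. -/
theorem integral_sq_sum_range {d : ℕ → Ω → ℝ} (hd : ∀ k, MemLp (d k) 2 P)
    (h0 : ∀ n, ∫ ω, (∑ k ∈ Finset.range n, d k ω) * d n ω ∂P = 0) (n : ℕ) :
    ∫ ω, (∑ k ∈ Finset.range n, d k ω) ^ 2 ∂P = ∑ k ∈ Finset.range n, ∫ ω, d k ω ^ 2 ∂P := by
  induction n with
  | zero => simp
  | succ n ih =>
    have hS : MemLp (fun ω => ∑ k ∈ Finset.range n, d k ω) 2 P :=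
      memLp_finsetSum _ fun k _ => hd k
    have h1 := hS.integrable_sq
    have h2 : Integrable (fun ω => (∑ k ∈ Finset.range n, d k ω) * d n ω) P :=
      hS.integrable_mul (hd n)
    have h3 := (hd n).integrable_sq
    simp_rw [Finset.sum_range_succ _ n, add_sq, mul_assoc]
    rw [integral_add (f := fun ω => (∑ k ∈ Finset.range n, d k ω) ^ 2 +
        2 * ((∑ k ∈ Finset.range n, d k ω) * d n ω)) (h1.add (h2.const_mul 2)) h3, integral_add h1 (h2.const_mul 2),
      integral_const_mul, h0, ih]
    simp

theorem norm_exp_I_sub_exp_I_le (x y : ℝ) :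
    ‖Complex.exp (x * Complex.I) - Complex.exp (y * Complex.I)‖ ≤ |x - y| := by
  have : Complex.exp (x * Complex.I) - Complex.exp (y * Complex.I) =
      Complex.exp (y * Complex.I) * (Complex.exp (Complex.I * ((x - y : ℝ) : ℂ)) - 1) := by
    rw [mul_sub, ← Complex.exp_add, mul_one]
    congr 2
    push_cast
    ring
  rw [this, norm_mul, Complex.norm_exp_ofReal_mul_I, one_mul]
  exact Real.norm_exp_I_mul_ofReal_sub_one_le

/-- Since `x ↦ exp(ix)` is 1-Lipschitz, approximation in `L¹` is enough for comparing characteristic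
functions. -/
theorem norm_integral_exp_I_sub_le [IsProbabilityMeasure P] {X Y : Ω → ℝ}
    (hX : AEStronglyMeasurable X P) (hY : AEStronglyMeasurable Y P)
    (h : Integrable (fun ω => X ω - Y ω) P) :
    ‖∫ ω, Complex.exp (X ω * Complex.I) ∂P - ∫ ω, Complex.exp (Y ω * Complex.I) ∂P‖
      ≤ ∫ ω, |X ω - Y ω| ∂P := by
  have hi : ∀ Z : Ω → ℝ, AEStronglyMeasurable Z P →
      Integrable (fun ω => Complex.exp (Z ω * Complex.I)) P := by
    intro Z hZ
    refine Integrable.of_bound (C := 1) ?_ (ae_of_all _ fun ω => ?_)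
    · exact (Complex.continuous_exp.comp
        (Complex.continuous_ofReal.mul continuous_const)).comp_aestronglyMeasurable hZ
    · rw [Complex.norm_exp_ofReal_mul_I]
  rw [← integral_sub (hi X hX) (hi Y hY)]
  refine (norm_integral_le_integral_norm _).trans ?_
  refine integral_mono ((hi X hX).sub (hi Y hY)).norm h.abs fun ω => ?_
  exact norm_exp_I_sub_exp_I_le _ _

/-- A sequence in which every term is independent of the past is mutually independent. -/
theorem iIndepFun_of_indep_past [IsProbabilityMeasure P] {β : Type*} [mβ : MeasurableSpace β]
    {Y : ℕ → Ω → β} {𝓖 : ℕ → MeasurableSpace Ω} (hmono : Monotone 𝓖)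
    (hY : ∀ n, Measurable[𝓖 (n + 1)] (Y n))
    (hind : ∀ n, Indep (𝓖 n) (mβ.comap (Y n)) P) : iIndepFun Y P := by
  rw [iIndepFun_iff_measure_inter_preimage_eq_mul]
  intro S
  -- Splitting off the largest index `n` leaves an intersection that belongs to `𝓖 n`, hence is
  -- independent of `Y n`.
  induction S using Finset.induction_on_max with
  | empty => intro sets _; simp
  | insert n S hS ih =>
    intro sets hsets
    have hn : n ∉ S := fun h => lt_irrefl _ (hS n h)
    rw [Finset.set_biInter_insert, Finset.prod_insert hn, Set.inter_comm,
      (Indep_iff _ _ _).1 (hind n), ih fun i hi => hsets i (Finset.mem_insert_of_mem hi), mul_comm]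
    · refine @Finset.measurableSet_biInter _ _ (𝓖 n) _ S fun i hi => ?_
      exact hmono (Nat.succ_le_of_lt (hS i hi)) _
        (hY i (hsets i (Finset.mem_insert_of_mem hi)))
    · exact ⟨_, hsets n (Finset.mem_insert_self _ _), rfl⟩

/-- Interchange of limits by an `ε/3` argument. It will be used with `L` the block length, `n → ∞`
being taken before `L → ∞`. -/
theorem tendsto_of_tendsto_approx {α : Type*} [PseudoMetricSpace α] {x : ℕ → α}
    {y : ℕ → ℕ → α} {z : ℕ → α} {l : α} {κ : ℕ → ℝ}
    (hxy : ∀ᶠ L in atTop, ∀ᶠ n in atTop, dist (x n) (y L n) ≤ κ L)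
    (hy : ∀ᶠ L in atTop, Tendsto (y L) atTop (𝓝 (z L)))
    (hz : Tendsto z atTop (𝓝 l)) (hκ : Tendsto κ atTop (𝓝 0)) : Tendsto x atTop (𝓝 l) := by
  rw [Metric.tendsto_atTop']
  intro ε hε
  obtain ⟨L, h1, h2, h3, h4⟩ := (hxy.and (hy.and
    ((Metric.tendsto_nhds.1 hz (ε / 3) (by positivity)).and
      (hκ.eventually_lt_const (show 0 < ε / 3 by positivity))))).exists
  obtain ⟨N, hN⟩ := eventually_atTop.1 (h1.and (Metric.tendsto_nhds.1 h2 (ε / 3) (by positivity)))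
  refine ⟨N, fun n hn => ?_⟩
  obtain ⟨h5, h6⟩ := hN n hn.le
  calc dist (x n) l ≤ dist (x n) (y L n) + dist (y L n) (z L) + dist (z L) l :=
        dist_triangle4 _ _ _ _
    _ < ε := by linarith

theorem tendsto_integral_exp_I_inv_sqrt_mul_sum [IsProbabilityMeasure P] {Y : ℕ → Ω → ℝ}
    (hY : MemLp (Y 0) 2 P) (h0 : ∫ ω, Y 0 ω ∂P = 0) (hind : iIndepFun Y P)
    (hident : ∀ i, IdentDistrib (Y i) (Y 0) P P) (t : ℝ) :
    Tendsto (fun n : ℕ => ∫ ω, Complex.exp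
        ((t * ((√n)⁻¹ * ∑ k ∈ Finset.range n, Y k ω) : ℝ) * Complex.I) ∂P) atTop
      (𝓝 (Complex.exp ((-(t ^ 2 * ∫ ω, Y 0 ω ^ 2 ∂P) / 2 : ℝ)))) := by
  have hlaw : HasLaw (id : ℝ → ℝ) (gaussianReal 0 (Var[Y 0; P]).toNNReal)
      (gaussianReal 0 (Var[Y 0; P]).toNNReal) := ⟨by fun_prop, by simp⟩
  have hvar : Var[Y 0; P] = ∫ ω, Y 0 ω ^ 2 ∂P := by
    rw [variance_eq_sub hY, h0]; simp
  have h := tendstoInDistribution_inv_sqrt_mul_sum_sub hlaw hY hind hident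
  have h2 := ProbabilityMeasure.tendsto_iff_tendsto_charFun.1 h.tendsto t
  simp only [ProbabilityMeasure.coe_mk, Measure.map_id] at h2
  rw [charFun_gaussianReal] at h2
  convert h2 using 1
  · ext n
    rw [charFun_apply_real, integral_map (h.forall_aemeasurable n)
      (by fun_prop)]
    simp [h0]
  · rw [hvar, Real.coe_toNNReal _ (integral_nonneg fun ω => sq_nonneg _)]
    congr 2
    push_cast
    ring

end General

/-! ### Affine recursions with i.i.d. inputs -/

section Defs

variable {Ω X E : Type*} [NormedAddCommGroup E] [NormedSpace ℝ E]

/-- The composition `f_{y_k} ∘ ⋯ ∘ f_{y_{k-m+1}}` of affine maps `f_x(u) = A x u + c x`. -/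
def affineBack (A : X → E →L[ℝ] E) (c : X → E) (y : ℤ → X) (u : E) : ℕ → ℤ → E
  | 0, _ => u
  | m + 1, k => A (y k) (affineBack A c y u m (k - 1)) + c (y k)

/-- The limit of the backward compositions of affine maps. -/
noncomputable def affineStat (A : X → E →L[ℝ] E) (c : X → E) (y : ℤ → X) (k : ℤ) : E :=
  limUnder atTop fun m => affineBack A c y 0 m k

/-- The forward iterates of affine maps. -/
def affineFwd (A : X → E →L[ℝ] E) (c : X → E) (y : ℕ → X) (u : E) : ℕ → E
  | 0 => u
  | n + 1 => A (y n) (affineFwd A c y u n) + c (y n)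

/-- The information generated by `ξ j`, `j ∈ T`. -/
@[reducible] def info [mX : MeasurableSpace X] (ξ : ℤ → Ω → X) (T : Set ℤ) : MeasurableSpace Ω :=
  ⨆ j ∈ T, mX.comap (ξ j)

/-- A mean-square contracting affine iteration driven by i.i.d. inputs, with centered
intercepts. -/
structure AffineChain [MeasurableSpace Ω] (P : Measure Ω) [MeasurableSpace X] [MeasurableSpace E]
    (ξ : ℤ → Ω → X) (A : X → E →L[ℝ] E) (c : X → E) (ρ : ℝ≥0∞) : Prop where
  measurable_input : ∀ k, Measurable (ξ k)
  indep : iIndepFun ξ P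
  identDistrib : ∀ k, IdentDistrib (ξ k) (ξ 1) P P
  measurable_slope : ∀ v, Measurable fun x => A x v
  measurable_intercept : Measurable c
  rate_lt_one : ρ < 1
  contract : ∀ v, eLpNorm (fun ω => A (ξ 1 ω) v) 2 P ≤ ρ * ‖v‖ₑ
  memLp_intercept : MemLp (fun ω => c (ξ 1 ω)) 2 P
  mean_intercept : ∫ ω, c (ξ 1 ω) ∂P = 0

end Defs

/-! ### Independence of disjoint sets of inputs -/

section Info

variable {Ω X : Type*} [mΩ : MeasurableSpace Ω] {P : Measure Ω} [mX : MeasurableSpace X]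
  {ξ : ℤ → Ω → X}

theorem info_mono {S T : Set ℤ} (h : S ⊆ T) : info ξ S ≤ info ξ T :=
  biSup_mono h

theorem info_le (hξ : ∀ k, Measurable (ξ k)) (T : Set ℤ) : info ξ T ≤ mΩ :=
  iSup₂_le fun k _ => (hξ k).comap_le

theorem measurable_info {T : Set ℤ} {k : ℤ} (hk : k ∈ T) : Measurable[info ξ T] (ξ k) := by
  rw [measurable_iff_comap_le]
  exact le_iSup₂_of_le k hk le_rfl

theorem indep_info (hξ : ∀ k, Measurable (ξ k)) (h : iIndepFun ξ P) {S T : Set ℤ}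
    (hST : Disjoint S T) : Indep (info ξ S) (info ξ T) P :=
  indep_iSup_of_disjoint (fun k => (hξ k).comap_le) h.iIndep hST

theorem indepFun_of_info (hξ : ∀ k, Measurable (ξ k)) (h : iIndepFun ξ P) {S T : Set ℤ}
    (hST : Disjoint S T) {β γ : Type*} [MeasurableSpace β] [MeasurableSpace γ] {U : Ω → β}
    {V : Ω → γ} (hU : Measurable[info ξ S] U) (hV : Measurable[info ξ T] V) : IndepFun U V P := by
  rw [IndepFun_iff_Indep]
  exact indep_of_indep_of_le_left (indep_of_indep_of_le_right (indep_info hξ h hST) hV.comap_le)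
    hU.comap_le

theorem indepFun_input_of_past (hξ : ∀ k, Measurable (ξ k)) (h : iIndepFun ξ P) {k j : ℤ}
    (hj : k < j) {γ : Type*} [MeasurableSpace γ] {V : Ω → γ}
    (hV : Measurable[info ξ (Set.Iic k)] V) :
    IndepFun (ξ j) V P :=
  indepFun_of_info hξ h (S := {j}) (by simpa using hj) (measurable_info rfl) hV

end Info

/-- On a probability space `L²` norms dominate `L¹` norms, so the sum has finite expectation. -/
theorem ae_tsum_enorm_ne_top {Ω F : Type*} [MeasurableSpace Ω] {P : Measure Ω}
    [IsProbabilityMeasure P] [NormedAddCommGroup F] {g : ℕ → Ω → F}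
    (hg : ∀ m, AEStronglyMeasurable (g m) P) (hs : ∑' m, eLpNorm (g m) 2 P ≠ ∞) :
    ∀ᵐ ω ∂P, ∑' m, ‖g m ω‖ₑ ≠ ∞ := by
  have hm : AEMeasurable (fun ω => ∑' m, ‖g m ω‖ₑ) P :=
    AEMeasurable.tsum fun m => (hg m).enorm
  refine (ae_lt_top' hm ?_).mono fun ω h => h.ne
  rw [lintegral_tsum fun m => (hg m).enorm]
  refine ne_top_of_le_ne_top hs (ENNReal.tsum_le_tsum fun m => ?_)
  rw [← eLpNorm_one_eq_lintegral_enorm]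
  exact eLpNorm_le_eLpNorm_of_exponent_le (by norm_num) (hg m)

/-! ### Measurability of the affine iterates -/

namespace AffineChain

variable {Ω X E : Type*} [mΩ : MeasurableSpace Ω] {P : Measure Ω} [IsProbabilityMeasure P]
  [mX : MeasurableSpace X] [NormedAddCommGroup E] [InnerProductSpace ℝ E] [FiniteDimensional ℝ E]
  [SecondCountableTopology E] [CompleteSpace E] [MeasurableSpace E] [BorelSpace E]
  {ξ : ℤ → Ω → X} {A : X → E →L[ℝ] E} {c : X → E} {ρ : ℝ≥0∞}

theorem measurable_slope_uncurry (h : AffineChain P ξ A c ρ) :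
    Measurable fun z : X × E => A z.1 z.2 := by
  have := measurable_uncurry_of_continuous_of_measurable (u := fun (v : E) (x : X) => A x v)
    (fun x => (A x).continuous) h.measurable_slope
  exact this.comp measurable_swap

theorem measurable_step (h : AffineChain P ξ A c ρ) :
    Measurable fun z : X × E => A z.1 z.2 + c z.1 :=
  h.measurable_slope_uncurry.add (h.measurable_intercept.comp measurable_fst)

/-- The measurable space `Ω'` is left free so that it can be either `Ω` with the σ-algebra of the
past or the canonical sequence space. The first choice gives adaptedness; the second lets
functionals of the inputs be compared in law. -/
theorem measurable_affineBack (h : AffineChain P ξ A c ρ) {Ω' : Type*} [MeasurableSpace Ω']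
    {y : ℤ → Ω' → X} (u : E) (m : ℕ) (k : ℤ) (hy : ∀ j ≤ k, Measurable (y j)) :
    Measurable fun ω => affineBack A c (fun j => y j ω) u m k := by
  induction m generalizing k with
  | zero => exact measurable_const
  | succ m ih =>
    exact h.measurable_step.comp
      ((hy k le_rfl).prodMk (ih (k - 1) fun j hj => hy j (by omega)))

theorem measurable_affineStat (h : AffineChain P ξ A c ρ) {Ω' : Type*} [MeasurableSpace Ω']
    {y : ℤ → Ω' → X} (k : ℤ) (hy : ∀ j ≤ k, Measurable (y j)) :
    Measurable fun ω => affineStat A c (fun j => y j ω) k :=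
  (StronglyMeasurable.limUnder fun m =>
    (h.measurable_affineBack 0 m k hy).stronglyMeasurable).measurable

theorem measurable_affineFwd (h : AffineChain P ξ A c ρ) {Ω' : Type*} [MeasurableSpace Ω']
    {y : ℕ → Ω' → X} (u : E) (n : ℕ) (hy : ∀ j < n, Measurable (y j)) :
    Measurable fun ω => affineFwd A c (fun j => y j ω) u n := by
  induction n with
  | zero => exact measurable_const
  | succ n ih =>
    exact h.measurable_step.comp
      ((hy n n.lt_succ_self).prodMk (ih fun j hj => hy j (by omega)))

/-! ### Contraction -/

theorem identDistrib_comp (h : AffineChain P ξ A c ρ) {F : Type*} [MeasurableSpace F]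
    {Φ : X → F} (hΦ : Measurable Φ) (j : ℤ) :
    IdentDistrib (fun ω => Φ (ξ j ω)) (fun ω => Φ (ξ 1 ω)) P P :=
  (h.identDistrib j).comp hΦ

/-- The contraction is assumed for deterministic vectors only. It extends to vectors determined by
earlier inputs because the current input is independent of them. -/
theorem eLpNorm_slope_apply_le (h : AffineChain P ξ A c ρ) {k j : ℤ} (hj : k < j) {V : Ω → E}
    (hV : Measurable[info ξ (Set.Iic k)] V) :
    eLpNorm (fun ω => A (ξ j ω) (V ω)) 2 P ≤ ρ * eLpNorm V 2 P := by
  refine eLpNorm_comp_le_of_indepFun (h.measurable_input j)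
    (hV.mono (info_le h.measurable_input _) le_rfl)
    (indepFun_input_of_past h.measurable_input h.indep hj hV) h.measurable_slope_uncurry
    (Ψ := id) (h.rate_lt_one.trans ENNReal.one_lt_top).ne fun w => ?_
  rw [((h.identDistrib_comp (h.measurable_slope w) j)).eLpNorm_eq]
  exact h.contract w

theorem memLp_intercept' (h : AffineChain P ξ A c ρ) (j : ℤ) :
    MemLp (fun ω => c (ξ j ω)) 2 P :=
  (h.identDistrib_comp h.measurable_intercept j).memLp_iff.2 h.memLp_intercept

theorem memLp_slope (h : AffineChain P ξ A c ρ) {k j : ℤ} (hj : k < j) {V : Ω → E}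
    (hV : Measurable[info ξ (Set.Iic k)] V) (hV2 : MemLp V 2 P) :
    MemLp (fun ω => A (ξ j ω) (V ω)) 2 P := by
  refine ⟨(h.measurable_slope_uncurry.comp ((h.measurable_input j).prodMk
    (hV.mono (info_le h.measurable_input _) le_rfl))).aestronglyMeasurable, ?_⟩
  exact (h.eLpNorm_slope_apply_le hj hV).trans_lt
    (ENNReal.mul_lt_top (h.rate_lt_one.trans ENNReal.one_lt_top) hV2.2)

theorem measurable_past_back (h : AffineChain P ξ A c ρ) (u : E) (m : ℕ) (k : ℤ) :
    Measurable[info ξ (Set.Iic k)] fun ω => affineBack A c (fun j => ξ j ω) u m k :=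
  @measurable_affineBack _ _ _ _ _ _ _ _ _ _ _ _ _ _ _ _ _ _ h _ (info ξ (Set.Iic k)) ξ u m k
    fun _ hj => measurable_info hj

theorem measurable_past_stat (h : AffineChain P ξ A c ρ) (k : ℤ) :
    Measurable[info ξ (Set.Iic k)] fun ω => affineStat A c (fun j => ξ j ω) k :=
  @measurable_affineStat _ _ _ _ _ _ _ _ _ _ _ _ _ _ _ _ _ _ h _ (info ξ (Set.Iic k)) ξ k
    fun _ hj => measurable_info hj

theorem measurable_info_fwd (h : AffineChain P ξ A c ρ) (u : E) (n : ℕ) (k : ℤ) :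
    Measurable[info ξ (Set.Ioc k (k + n))] fun ω =>
      affineFwd A c (fun j => ξ (k + j + 1) ω) u n :=
  @measurable_affineFwd _ _ _ _ _ _ _ _ _ _ _ _ _ _ _ _ _ _ h _ (info ξ (Set.Ioc k (k + n)))
    (fun (j : ℕ) => ξ (k + j + 1)) u n fun _ hj => measurable_info (by constructor <;> omega)

theorem memLp_back (h : AffineChain P ξ A c ρ) (u : E) (m : ℕ) (k : ℤ) :
    MemLp (fun ω => affineBack A c (fun j => ξ j ω) u m k) 2 P := by
  induction m generalizing k with
  | zero => exact memLp_const u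
  | succ m ih =>
    exact (h.memLp_slope (by omega) (h.measurable_past_back u m (k - 1)) (ih _)).add
      (h.memLp_intercept' k)

theorem measurable_back (h : AffineChain P ξ A c ρ) (u : E) (m : ℕ) (k : ℤ) :
    Measurable fun ω => affineBack A c (fun j => ξ j ω) u m k :=
  (h.measurable_past_back u m k).mono (info_le h.measurable_input _) le_rfl

theorem measurable_stat (h : AffineChain P ξ A c ρ) (k : ℤ) :
    Measurable fun ω => affineStat A c (fun j => ξ j ω) k :=
  (h.measurable_past_stat k).mono (info_le h.measurable_input _) le_rfl

theorem eLpNorm_back_sub_back_le (h : AffineChain P ξ A c ρ) (u v : E) (m : ℕ) (k : ℤ) :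
    eLpNorm (fun ω => affineBack A c (fun j => ξ j ω) u m k -
      affineBack A c (fun j => ξ j ω) v m k) 2 P ≤ ρ ^ m * ‖u - v‖ₑ := by
  induction m generalizing k with
  | zero => simp [affineBack, eLpNorm_const (u - v) two_ne_zero (IsProbabilityMeasure.ne_zero P)]
  | succ m ih =>
    simp only [affineBack, add_sub_add_right_eq_sub, ← map_sub]
    refine (h.eLpNorm_slope_apply_le (show k - 1 < k by omega)
      ((h.measurable_past_back u m (k - 1)).sub (h.measurable_past_back v m (k - 1)))).trans ?_
    rw [pow_succ', mul_assoc]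
    gcongr
    exact ih _

/-- The extra map of the longer composition is the innermost one. Both sides are thus the same `m`
maps, applied to a one-step image of `u` and to `u`; `C` is the `L²` size of one step from `u`. -/
theorem eLpNorm_back_succ_sub_le (h : AffineChain P ξ A c ρ) (u : E) : ∃ C : ℝ≥0∞, C ≠ ∞ ∧
    ∀ m k, eLpNorm (fun ω => affineBack A c (fun j => ξ j ω) u (m + 1) k -
      affineBack A c (fun j => ξ j ω) u m k) 2 P ≤ ρ ^ m * C := by
  refine ⟨eLpNorm (fun ω => A (ξ 1 ω) u + c (ξ 1 ω) - u) 2 P, ?_, fun m => ?_⟩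
  · exact (((h.memLp_back u 1 1).sub (memLp_const u))).2.ne
  induction m with
  | zero =>
    intro k
    simp only [affineBack, pow_zero, one_mul]
    exact (h.identDistrib_comp (Φ := fun x => A x u + c x - u)
      (((h.measurable_slope u).add h.measurable_intercept).sub_const u) k).eLpNorm_eq 2 |>.le
  | succ m ih =>
    intro k
    have hs : ∀ ω, affineBack A c (fun j => ξ j ω) u (m + 1 + 1) k -
        affineBack A c (fun j => ξ j ω) u (m + 1) k = A (ξ k ω)
          (affineBack A c (fun j => ξ j ω) u (m + 1) (k - 1) -
            affineBack A c (fun j => ξ j ω) u m (k - 1)) := fun ω => by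
      rw [map_sub]
      exact add_sub_add_right_eq_sub _ _ _
    simp_rw [hs]
    refine (h.eLpNorm_slope_apply_le (show k - 1 < k by omega)
      ((h.measurable_past_back u _ (k - 1)).sub (h.measurable_past_back u m (k - 1)))).trans ?_
    rw [pow_succ', mul_assoc]
    gcongr
    exact ih _

/-! ### The stationary solution -/

theorem tsum_rate_mul_ne_top (h : AffineChain P ξ A c ρ) {C : ℝ≥0∞} (hC : C ≠ ∞) :
    ∑' m : ℕ, ρ ^ m * C ≠ ∞ := by
  rw [ENNReal.tsum_mul_right, ENNReal.tsum_geometric]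
  refine ENNReal.mul_ne_top (ENNReal.inv_ne_top.2 ?_) hC
  exact (tsub_pos_of_lt h.rate_lt_one).ne'

theorem ae_exists_tendsto_back (h : AffineChain P ξ A c ρ) (u : E) (k : ℤ) :
    ∀ᵐ ω ∂P, ∃ l, Tendsto (fun m => affineBack A c (fun j => ξ j ω) u m k) atTop (𝓝 l) := by
  obtain ⟨C, hC, hb⟩ := h.eLpNorm_back_succ_sub_le u
  have hm : ∀ m, Measurable fun ω => affineBack A c (fun j => ξ j ω) u (m + 1) k -
      affineBack A c (fun j => ξ j ω) u m k := fun m =>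
    (h.measurable_back u (m + 1) k).sub (h.measurable_back u m k)
  filter_upwards [ae_tsum_enorm_ne_top (fun m => (hm m).aestronglyMeasurable)
    (ne_top_of_le_ne_top (h.tsum_rate_mul_ne_top hC) (ENNReal.tsum_le_tsum fun m => hb m k))]
    with ω hω
  refine cauchySeq_tendsto_of_complete
    (cauchySeq_of_edist_le_of_tsum_ne_top _ (fun m => ?_) hω)
  rw [edist_comm, edist_eq_enorm_sub]

/-- The composition started at `0` converges. The one started at `u` differs from it by a sequence
with summable `L²` norms, which tends to zero almost surely. -/
theorem ae_tendsto_back (h : AffineChain P ξ A c ρ) (u : E) (k : ℤ) :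
    ∀ᵐ ω ∂P, Tendsto (fun m => affineBack A c (fun j => ξ j ω) u m k) atTop
      (𝓝 (affineStat A c (fun j => ξ j ω) k)) := by
  have hm : ∀ m, Measurable fun ω => affineBack A c (fun j => ξ j ω) u m k -
      affineBack A c (fun j => ξ j ω) 0 m k := fun m =>
    (h.measurable_back u m k).sub (h.measurable_back 0 m k)
  filter_upwards [h.ae_exists_tendsto_back 0 k, ae_tsum_enorm_ne_top
    (fun m => (hm m).aestronglyMeasurable)
    (ne_top_of_le_ne_top (h.tsum_rate_mul_ne_top (C := ‖u - 0‖ₑ) enorm_ne_top)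
      (ENNReal.tsum_le_tsum fun m => h.eLpNorm_back_sub_back_le u 0 m k))] with ω h1 h2
  have h3 := tendsto_nhds_limUnder h1
  have h4 := ENNReal.tendsto_atTop_zero_of_tsum_ne_top h2
  rw [← tendsto_zero_iff_enorm_tendsto_zero] at h4
  simpa [affineStat] using h3.add h4

theorem stat_succ (h : AffineChain P ξ A c ρ) (k : ℤ) :
    ∀ᵐ ω ∂P, affineStat A c (fun j => ξ j ω) (k + 1) =
      A (ξ (k + 1) ω) (affineStat A c (fun j => ξ j ω) k) + c (ξ (k + 1) ω) := by
  filter_upwards [h.ae_tendsto_back 0 k, h.ae_tendsto_back 0 (k + 1)] with ω h1 h2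
  refine tendsto_nhds_unique ((tendsto_add_atTop_iff_nat 1).2 h2) ?_
  have := (((A (ξ (k + 1) ω)).continuous.tendsto _).comp h1).add_const (c (ξ (k + 1) ω))
  simpa [affineBack] using this

theorem memLp_stat (h : AffineChain P ξ A c ρ) (k : ℤ) :
    MemLp (fun ω => affineStat A c (fun j => ξ j ω) k) 2 P := by
  obtain ⟨C, hC, hb⟩ := h.eLpNorm_back_succ_sub_le 0
  refine ⟨(h.measurable_stat k).aestronglyMeasurable, ?_⟩
  have hle : ∀ m, eLpNorm (fun ω => affineBack A c (fun j => ξ j ω) 0 m k) 2 P ≤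
      ∑ j ∈ Finset.range m, ρ ^ j * C := by
    intro m
    induction m with
    | zero => simp [affineBack]
    | succ m ih =>
      rw [Finset.sum_range_succ]
      refine le_trans ?_ (add_le_add ih (hb m k))
      refine le_trans (le_of_eq ?_) (eLpNorm_add_le (h.memLp_back 0 m k).1
        ((h.memLp_back 0 (m + 1) k).sub (h.memLp_back 0 m k)).1 (by norm_num))
      congr 1
      ext ω
      simp
  -- Fatou's lemma along the backward iterates, whose `L²` norms are bounded by telescoping against
  -- the geometric series.
  refine (Lp.eLpNorm_lim_le_liminf_eLpNorm (fun m => (h.memLp_back 0 m k).1) _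
    (h.ae_tendsto_back 0 k)).trans_lt ?_
  refine lt_of_le_of_lt ?_ (h.tsum_rate_mul_ne_top hC).lt_top
  refine liminf_le_of_le (by isBoundedDefault) fun b hb' => ?_
  obtain ⟨m, hm⟩ := hb'.exists
  exact hm.trans ((hle m).trans (ENNReal.sum_le_tsum _))

theorem affineBack_shift (A : X → E →L[ℝ] E) (c : X → E) (y : ℤ → X) (u : E) (m : ℕ) (k l : ℤ) :
    affineBack A c (fun j => y (k + j)) u m l = affineBack A c y u m (k + l) := by
  induction m generalizing l with
  | zero => rfl
  | succ m ih => simp only [affineBack, ih, add_sub_assoc]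

/-- The solution at time `k` is one fixed measurable functional of the inputs shifted by `k`, and an
i.i.d. sequence has a shift-invariant law. -/
theorem identDistrib_stat (h : AffineChain P ξ A c ρ) (k : ℤ) :
    IdentDistrib (fun ω => affineStat A c (fun j => ξ j ω) k)
      (fun ω => affineStat A c (fun j => ξ j ω) 0) P P := by
  have hs : ∀ ω, affineStat A c (fun j => ξ j ω) k =
      affineStat A c (fun j => ξ (k + j) ω) 0 := fun ω => by
    simp only [affineStat]
    congr 1
    ext m
    rw [affineBack_shift A c (fun j => ξ j ω), add_zero]
  simp_rw [hs]
  have h1 : IdentDistrib (fun ω (j : ℤ) => ξ (k + j) ω) (fun ω (j : ℤ) => ξ j ω) P P :=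
    IdentDistrib.pi (fun j => (h.identDistrib (k + j)).trans (h.identDistrib j).symm)
      (h.indep.precomp (add_right_injective k)) h.indep
  exact h1.comp (h.measurable_affineStat (y := fun j (z : ℤ → X) => z j) 0
    fun j _ => measurable_pi_apply j)

theorem identDistrib_fwd (h : AffineChain P ξ A c ρ) {F : Type*} [MeasurableSpace F]
    {G : (ℕ → X) → F} (hG : Measurable G) (k l : ℤ) :
    IdentDistrib (fun ω => G fun j => ξ (k + j + 1) ω) (fun ω => G fun j => ξ (l + j + 1) ω)
      P P := by
  have hi : ∀ k : ℤ, Function.Injective fun j : ℕ => k + j + 1 := fun k a b hab => by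
    simpa using hab
  exact (IdentDistrib.pi (fun j : ℕ =>
    (h.identDistrib (k + j + 1)).trans (h.identDistrib (l + j + 1)).symm)
      (h.indep.precomp (hi k)) (h.indep.precomp (hi l))).comp hG

theorem memLp_fwd (h : AffineChain P ξ A c ρ) (u : E) (n : ℕ) (k : ℤ) :
    MemLp (fun ω => affineFwd A c (fun j => ξ (k + j + 1) ω) u n) 2 P := by
  induction n with
  | zero => exact memLp_const u
  | succ n ih =>
    exact (h.memLp_slope (lt_add_one (k + n)) ((h.measurable_info_fwd u n k).mono
      (info_mono Set.Ioc_subset_Iic_self) le_rfl) ih).add (h.memLp_intercept' _)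

theorem measurable_past_fwd (h : AffineChain P ξ A c ρ) (u : E) (n : ℕ) (k : ℤ) :
    Measurable[info ξ (Set.Iic (k + n))] fun ω =>
      affineFwd A c (fun j => ξ (k + j + 1) ω) u n :=
  (h.measurable_info_fwd u n k).mono (info_mono Set.Ioc_subset_Iic_self) le_rfl

/-- Coupling: from time `k` on both processes are driven by the same inputs, so their difference
only undergoes the contracting linear parts. -/
theorem eLpNorm_stat_sub_fwd_le (h : AffineChain P ξ A c ρ) (u : E) (n : ℕ) (k : ℤ) :
    eLpNorm (fun ω => affineStat A c (fun j => ξ j ω) (k + n) -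
      affineFwd A c (fun j => ξ (k + j + 1) ω) u n) 2 P ≤
      ρ ^ n * eLpNorm (fun ω => affineStat A c (fun j => ξ j ω) 0 - u) 2 P := by
  induction n with
  | zero =>
    simp only [affineFwd, Nat.cast_zero, add_zero, pow_zero, one_mul]
    exact ((h.identDistrib_stat k).comp (measurable_id.sub_const u)).eLpNorm_eq 2 |>.le
  | succ n ih =>
    have hs : (fun ω => affineStat A c (fun j => ξ j ω) (k + (n + 1 : ℕ)) -
        affineFwd A c (fun j => ξ (k + j + 1) ω) u (n + 1)) =ᵐ[P] fun ω => A (ξ (k + n + 1) ω)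
          (affineStat A c (fun j => ξ j ω) (k + n) -
            affineFwd A c (fun j => ξ (k + j + 1) ω) u n) := by
      filter_upwards [h.stat_succ (k + n)] with ω hω
      rw [Nat.cast_succ, ← add_assoc, hω, map_sub]
      exact add_sub_add_right_eq_sub _ _ _
    rw [eLpNorm_congr_ae hs]
    refine (h.eLpNorm_slope_apply_le (lt_add_one (k + n))
      ((h.measurable_past_stat _).sub (h.measurable_past_fwd u n k))).trans ?_
    rw [pow_succ', mul_assoc]
    gcongr
    exact ih

end AffineChain

namespace AffineChain

variable {Ω X E : Type*} [mΩ : MeasurableSpace Ω] {P : Measure Ω} [IsProbabilityMeasure P]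
  [mX : MeasurableSpace X] [NormedAddCommGroup E] [InnerProductSpace ℝ E] [FiniteDimensional ℝ E]
  [SecondCountableTopology E] [CompleteSpace E] [MeasurableSpace E] [BorelSpace E]
  {ξ : ℤ → Ω → X} {A : X → E →L[ℝ] E} {c : X → E} {ρ : ℝ≥0∞}

/-! ### The mean operator -/

theorem rate_ne_top (h : AffineChain P ξ A c ρ) : ρ ≠ ∞ :=
  (h.rate_lt_one.trans ENNReal.one_lt_top).ne

theorem memLp_slope_const (h : AffineChain P ξ A c ρ) (j : ℤ) (v : E) :
    MemLp (fun ω => A (ξ j ω) v) 2 P :=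
  h.memLp_slope (sub_one_lt j) measurable_const (memLp_const v)

theorem integrable_slope_const (h : AffineChain P ξ A c ρ) (j : ℤ) (v : E) :
    Integrable (fun ω => A (ξ j ω) v) P :=
  (h.memLp_slope_const j v).integrable (by norm_num)

/-- The mean `E[A]` of the random linear part. -/
noncomputable def meanOp (h : AffineChain P ξ A c ρ) : E →L[ℝ] E :=
  LinearMap.toContinuousLinearMap
    { toFun := fun v => ∫ ω, A (ξ 1 ω) v ∂P
      map_add' := fun u v => by
        simp only [map_add]
        exact integral_add (h.integrable_slope_const 1 u) (h.integrable_slope_const 1 v)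
      map_smul' := fun a v => by
        simp only [map_smul, RingHom.id_apply]
        exact integral_smul a _ }

theorem meanOp_apply (h : AffineChain P ξ A c ρ) (v : E) :
    h.meanOp v = ∫ ω, A (ξ 1 ω) v ∂P := rfl

theorem integral_slope (h : AffineChain P ξ A c ρ) (j : ℤ) (v : E) :
    ∫ ω, A (ξ j ω) v ∂P = h.meanOp v :=
  (h.identDistrib_comp (h.measurable_slope v) j).integral_eq

theorem integral_intercept (h : AffineChain P ξ A c ρ) (j : ℤ) :
    ∫ ω, c (ξ j ω) ∂P = 0 :=
  (h.identDistrib_comp h.measurable_intercept j).integral_eq.trans h.mean_intercept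

theorem norm_meanOp_apply_le (h : AffineChain P ξ A c ρ) (v : E) :
    ‖h.meanOp v‖ ≤ ρ.toReal * ‖v‖ := by
  rw [meanOp_apply]
  refine (norm_integral_le_integral_norm _).trans
    ((integral_abs_le_toReal_eLpNorm (h.memLp_slope_const 1 v)).trans ?_)
  have := ENNReal.toReal_mono (ENNReal.mul_ne_top h.rate_ne_top enorm_ne_top) (h.contract v)
  simpa using this

/-- The norm of a mean is at most the `L¹` norm, hence at most the `L²` norm, so `E[A]` inherits the
rate `ρ`. -/
theorem norm_meanOp_lt_one (h : AffineChain P ξ A c ρ) : ‖h.meanOp‖ < 1 := by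
  refine (ContinuousLinearMap.opNorm_le_bound _ ENNReal.toReal_nonneg
    h.norm_meanOp_apply_le).trans_lt ?_
  rw [← ENNReal.toReal_one]
  exact ENNReal.toReal_strict_mono ENNReal.one_ne_top h.rate_lt_one

theorem enorm_meanOp_apply_le (h : AffineChain P ξ A c ρ) (v : E) :
    ‖h.meanOp v‖ₑ ≤ ρ * ‖v‖ₑ := by
  rw [← ENNReal.toReal_le_toReal enorm_ne_top (ENNReal.mul_ne_top h.rate_ne_top enorm_ne_top)]
  simpa using h.norm_meanOp_apply_le v

/-- The resolvent `(1 - E[A])⁻¹`. -/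
noncomputable def resolvent (h : AffineChain P ξ A c ρ) : E →L[ℝ] E := ∑' n : ℕ, h.meanOp ^ n

theorem resolvent_mul (h : AffineChain P ξ A c ρ) : h.resolvent * (1 - h.meanOp) = 1 :=
  geom_series_mul_neg _ h.norm_meanOp_lt_one

theorem mul_resolvent (h : AffineChain P ξ A c ρ) : (1 - h.meanOp) * h.resolvent = 1 :=
  mul_neg_geom_series _ h.norm_meanOp_lt_one

theorem hasSum_resolvent (h : AffineChain P ξ A c ρ) :
    HasSum (fun n : ℕ => h.meanOp ^ n) h.resolvent :=
  (summable_geometric_of_norm_lt_one h.norm_meanOp_lt_one).hasSum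

/-- Taking means in the recursion gives `μ = E[A] μ`, as the intercept is centered and the new input
is independent of the past. Invertibility of `1 - E[A]` forces `μ = 0`. The equation is tested
against every `w` because the freezing lemma is scalar. -/
theorem integral_stat (h : AffineChain P ξ A c ρ) (k : ℤ) :
    ∫ ω, affineStat A c (fun j => ξ j ω) k ∂P = 0 := by
  rw [(h.identDistrib_stat k).integral_eq]
  set μ := ∫ ω, affineStat A c (fun j => ξ j ω) 0 ∂P with hμ
  have key : ∀ w : E, ⟪w, μ - h.meanOp μ⟫ = 0 := by
    intro w
    have hZ := (h.memLp_stat 0).integrable (q := 2) (by norm_num)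
    have hA : Integrable (fun ω => A (ξ (0 + 1) ω) (affineStat A c (fun j => ξ j ω) 0)) P :=
      (h.memLp_slope (lt_add_one 0) (h.measurable_past_stat 0) (h.memLp_stat 0)).integrable
        (by norm_num)
    have hc := (h.memLp_intercept' (0 + 1)).integrable (by norm_num)
    have h1 : μ = ∫ ω, A (ξ (0 + 1) ω) (affineStat A c (fun j => ξ j ω) 0) ∂P := by
      rw [hμ, ← (h.identDistrib_stat (0 + 1)).integral_eq, integral_congr_ae (h.stat_succ 0),
        integral_add hA hc, h.integral_intercept, add_zero]
    have h2 := integral_comp_eq_zero_of_indepFun (h.measurable_input (0 + 1))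
      (h.measurable_stat 0)
      (indepFun_input_of_past h.measurable_input h.indep (lt_add_one 0)
        (h.measurable_past_stat 0))
      (Φ := fun z => ⟪w, A z.1 z.2 - h.meanOp z.2⟫)
      (measurable_const.inner (h.measurable_slope_uncurry.sub
        (h.meanOp.continuous.measurable.comp measurable_snd)))
      (fun v => by
        rw [integral_inner (f := fun ω => A (ξ (0 + 1) ω) v - h.meanOp v) ((h.integrable_slope_const _ v).sub (integrable_const _)),
          integral_sub (h.integrable_slope_const _ v) (integrable_const _), h.integral_slope]
        simp)
    rw [integral_inner (f := fun ω => A (ξ (0 + 1) ω) (affineStat A c (fun j => ξ j ω) 0) -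
      h.meanOp (affineStat A c (fun j => ξ j ω) 0)) (hA.sub (h.meanOp.integrable_comp hZ)),
      integral_sub hA (h.meanOp.integrable_comp hZ), ← h1,
      ContinuousLinearMap.integral_comp_comm _ hZ] at h2
    exact h2
  have h3 : (1 - h.meanOp) μ = 0 := by
    simpa using ext_inner_left ℝ fun w => (key w).trans (inner_zero_right w).symm
  have h4 := congrArg (fun T : E →L[ℝ] E => T μ) h.resolvent_mul
  simpa [h3] using h4.symm

/-! ### Martingale increments -/

/-- The increment `⟪w, (A x - E[A]) v + c x⟫`, centered for every `v`. -/
noncomputable def incr (h : AffineChain P ξ A c ρ) (w : E) (x : X) (v : E) : ℝ :=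
  ⟪w, A x v - h.meanOp v + c x⟫

theorem measurable_incr (h : AffineChain P ξ A c ρ) (w : E) :
    Measurable fun z : X × E => h.incr w z.1 z.2 :=
  measurable_const.inner ((h.measurable_slope_uncurry.sub
    (h.meanOp.continuous.measurable.comp measurable_snd)).add
      (h.measurable_intercept.comp measurable_fst))

theorem integral_incr (h : AffineChain P ξ A c ρ) (w : E) (j : ℤ) (v : E) :
    ∫ ω, h.incr w (ξ j ω) v ∂P = 0 := by
  have h1 := h.integrable_slope_const j v
  have h2 := (h.memLp_intercept' j).integrable (by norm_num)
  have h3 : Integrable (fun ω => A (ξ j ω) v - h.meanOp v) P := h1.sub (integrable_const _)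
  unfold incr
  rw [integral_inner (f := fun ω => A (ξ j ω) v - h.meanOp v + c (ξ j ω)) (h3.add h2),
    integral_add h3 h2, integral_sub h1 (integrable_const _), h.integral_slope,
    h.integral_intercept]
  simp

theorem memLp_noise (h : AffineChain P ξ A c ρ) {k j : ℤ} (hj : k < j) {V : Ω → E}
    (hV : Measurable[info ξ (Set.Iic k)] V) (hV2 : MemLp V 2 P) :
    MemLp (fun ω => A (ξ j ω) (V ω) - h.meanOp (V ω) + c (ξ j ω)) 2 P :=
  ((h.memLp_slope hj hV hV2).sub (h.meanOp.comp_memLp' hV2)).add (h.memLp_intercept' j)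

theorem memLp_incr (h : AffineChain P ξ A c ρ) (w : E) {k j : ℤ} (hj : k < j) {V : Ω → E}
    (hV : Measurable[info ξ (Set.Iic k)] V) (hV2 : MemLp V 2 P) :
    MemLp (fun ω => h.incr w (ξ j ω) (V ω)) 2 P :=
  (innerSL ℝ w).comp_memLp' (h.memLp_noise hj hV hV2)

theorem measurable_info_incr (h : AffineChain P ξ A c ρ) (w : E) {T : Set ℤ} {j : ℤ} (hj : j ∈ T)
    {V : Ω → E} (hV : Measurable[info ξ T] V) :
    Measurable[info ξ T] fun ω => h.incr w (ξ j ω) (V ω) :=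
  (h.measurable_incr w).comp (Measurable.prodMk (measurable_info hj) hV)

/-- The martingale difference property: with the past frozen, the increment has mean zero. -/
theorem integral_incr_mul (h : AffineChain P ξ A c ρ) (w : E) {k j : ℤ} (hj : k < j) {V : Ω → E}
    (hV : Measurable[info ξ (Set.Iic k)] V) {G : Ω → ℝ}
    (hG : Measurable[info ξ (Set.Iic k)] G) :
    ∫ ω, G ω * h.incr w (ξ j ω) (V ω) ∂P = 0 := by
  have hVG : Measurable[info ξ (Set.Iic k)] fun ω => (V ω, G ω) := Measurable.prodMk hV hG
  refine integral_comp_eq_zero_of_indepFun (h.measurable_input j)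
    (hVG.mono (info_le h.measurable_input _) le_rfl)
    (indepFun_input_of_past h.measurable_input h.indep hj hVG)
    (Φ := fun z => z.2.2 * h.incr w z.1 z.2.1)
    ((measurable_snd.comp measurable_snd).mul ((h.measurable_incr w).comp
      (measurable_fst.prodMk (measurable_fst.comp measurable_snd)))) fun z => ?_
  simp only [integral_const_mul, h.integral_incr, mul_zero]

/-- The intercept cancels and the rest is linear in `V - V'`; `A` and `E[A]` contribute one `ρ`
each. -/
theorem eLpNorm_incr_sub_incr_le (h : AffineChain P ξ A c ρ) (w : E) {k j : ℤ} (hj : k < j)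
    {V V' : Ω → E} (hV : Measurable[info ξ (Set.Iic k)] V)
    (hV' : Measurable[info ξ (Set.Iic k)] V') :
    eLpNorm (fun ω => h.incr w (ξ j ω) (V ω) - h.incr w (ξ j ω) (V' ω)) 2 P ≤
      ‖w‖ₑ * (ρ + ρ) * eLpNorm (fun ω => V ω - V' ω) 2 P := by
  have hs : ∀ ω, h.incr w (ξ j ω) (V ω) - h.incr w (ξ j ω) (V' ω) =
      ⟪w, A (ξ j ω) (V ω - V' ω) - h.meanOp (V ω - V' ω)⟫ := fun ω => by
    simp only [incr, ← inner_sub_right, map_sub]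
    congr 1
    abel
  simp_rw [hs]
  refine eLpNorm_comp_le_of_indepFun (h.measurable_input j)
    ((hV.sub hV').mono (info_le h.measurable_input _) le_rfl)
    (indepFun_input_of_past h.measurable_input h.indep hj (hV.sub hV'))
    (Φ := fun z => ⟪w, A z.1 z.2 - h.meanOp z.2⟫) (Ψ := id)
    (measurable_const.inner (h.measurable_slope_uncurry.sub
        (h.meanOp.continuous.measurable.comp measurable_snd)))
    (ENNReal.mul_ne_top enorm_ne_top (ENNReal.add_ne_top.2 ⟨h.rate_ne_top, h.rate_ne_top⟩))
    fun v => ?_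
  have h1 : eLpNorm (fun ω => ⟪w, A (ξ j ω) v - h.meanOp v⟫) 2 P ≤
      ‖w‖ₑ * eLpNorm (fun ω => A (ξ j ω) v - h.meanOp v) 2 P := by
    exact eLpNorm_le_nnreal_smul_eLpNorm_of_ae_le_mul (c := ‖w‖₊)
      (ae_of_all _ fun _ => nnnorm_inner_le_nnnorm _ _) 2
  refine h1.trans ?_
  rw [mul_assoc]
  refine mul_le_mul_right ?_ _
  refine (eLpNorm_sub_le (h.memLp_slope_const j v).1 aestronglyMeasurable_const
    (by norm_num)).trans ?_
  rw [add_mul]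
  gcongr
  · rw [(h.identDistrib_comp (h.measurable_slope v) j).eLpNorm_eq]
    exact h.contract v
  · rw [eLpNorm_const _ two_ne_zero (IsProbabilityMeasure.ne_zero P)]
    simpa using h.enorm_meanOp_apply_le v

end AffineChain

theorem _root_.MeasureTheory.MemLp.integrable_fun_mul {Ω : Type*} [MeasurableSpace Ω]
    {P : Measure Ω} {f g : Ω → ℝ} (hf : MemLp f 2 P) (hg : MemLp g 2 P) :
    Integrable (fun ω => f ω * g ω) P :=
  hf.integrable_mul hg

namespace AffineChain

variable {Ω X E : Type*} [mΩ : MeasurableSpace Ω] {P : Measure Ω} [IsProbabilityMeasure P]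
  [mX : MeasurableSpace X] [NormedAddCommGroup E] [InnerProductSpace ℝ E] [FiniteDimensional ℝ E]
  [SecondCountableTopology E] [CompleteSpace E] [MeasurableSpace E] [BorelSpace E]
  {ξ : ℤ → Ω → X} {A : X → E →L[ℝ] E} {c : X → E} {ρ : ℝ≥0∞}

/-! ### Covariances of the stationary solution -/

/-- The adjoint of the mean operator. -/
noncomputable def adjMean (h : AffineChain P ξ A c ρ) : E →L[ℝ] E := star h.meanOp

/-- The adjoint of the resolvent. -/
noncomputable def adjRes (h : AffineChain P ξ A c ρ) : E →L[ℝ] E := star h.resolvent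

theorem inner_adjMean (h : AffineChain P ξ A c ρ) (s v : E) :
    ⟪h.adjMean s, v⟫ = ⟪s, h.meanOp v⟫ :=
  ContinuousLinearMap.adjoint_inner_left h.meanOp v s

theorem adjRes_sub (h : AffineChain P ξ A c ρ) (s : E) :
    h.adjRes s - h.adjMean (h.adjRes s) = s := by
  have := congrArg (fun T : E →L[ℝ] E => star T s) h.resolvent_mul
  simpa [adjMean, adjRes] using this

theorem adjRes_adjMean (h : AffineChain P ξ A c ρ) (s : E) :
    h.adjRes (h.adjMean s) = h.adjMean (h.adjRes s) := by
  have h1 := congrArg (fun T : E →L[ℝ] E => star T s) h.mul_resolvent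
  have h2 : h.adjRes s - h.adjRes (h.adjMean s) = s := by simpa [adjMean, adjRes] using h1
  have h3 := h.adjRes_sub s
  exact sub_right_injective (h2.trans h3.symm)

theorem hasSum_adjMean_pow (h : AffineChain P ξ A c ρ) (s : E) :
    HasSum (fun n : ℕ => (h.adjMean ^ n) s) (h.adjRes s) := by
  have h1 := (h.hasSum_resolvent.map (starAddEquiv : (E →L[ℝ] E) ≃+ (E →L[ℝ] E))
    continuous_star)
  have h2 : HasSum (fun n : ℕ => h.adjMean ^ n) h.adjRes := by
    convert h1 using 1
    · ext1 n
      simp [adjMean]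
    · rfl
  exact h2.mapL (ContinuousLinearMap.apply ℝ E s)

theorem memLp_inner_stat (h : AffineChain P ξ A c ρ) (s : E) (k : ℤ) :
    MemLp (fun ω => ⟪s, affineStat A c (fun j => ξ j ω) k⟫) 2 P :=
  (innerSL ℝ s).comp_memLp' (h.memLp_stat k)

theorem memLp_incr_stat (h : AffineChain P ξ A c ρ) (w : E) (k : ℤ) :
    MemLp (fun ω => h.incr w (ξ (k + 1) ω) (affineStat A c (fun j => ξ j ω) k)) 2 P :=
  h.memLp_incr w (lt_add_one k) (h.measurable_past_stat k) (h.memLp_stat k)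

theorem measurable_past_inner_stat (h : AffineChain P ξ A c ρ) (s : E) (k : ℤ) :
    Measurable[info ξ (Set.Iic k)] fun ω => ⟪s, affineStat A c (fun j => ξ j ω) k⟫ :=
  (innerSL ℝ s).continuous.measurable.comp (h.measurable_past_stat k)

/-- The scalar form of `Z_{k+1} = E[A] Z_k + ζ_{k+1}`, with the mean operator moved onto the test
vector. -/
theorem inner_stat_succ (h : AffineChain P ξ A c ρ) (s : E) (k : ℤ) :
    ∀ᵐ ω ∂P, ⟪s, affineStat A c (fun j => ξ j ω) (k + 1)⟫ =
      ⟪h.adjMean s, affineStat A c (fun j => ξ j ω) k⟫ +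
        h.incr s (ξ (k + 1) ω) (affineStat A c (fun j => ξ j ω) k) := by
  filter_upwards [h.stat_succ k] with ω hω
  rw [hω, inner_adjMean, incr, ← inner_add_right]
  congr 1
  abel

/-- The second moments `E[⟪s, Z⟫ ⟪t, Z⟫]` of the stationary solution. -/
noncomputable def secondMoment (_h : AffineChain P ξ A c ρ) (s t : E) : ℝ :=
  ∫ ω, ⟪s, affineStat A c (fun j => ξ j ω) 0⟫ * ⟪t, affineStat A c (fun j => ξ j ω) 0⟫ ∂P

theorem secondMoment_comm (h : AffineChain P ξ A c ρ) (s t : E) :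
    h.secondMoment s t = h.secondMoment t s := by
  simp only [secondMoment, mul_comm]

theorem integrable_inner_mul_inner_stat (h : AffineChain P ξ A c ρ) (s t : E) (j k : ℤ) :
    Integrable (fun ω => ⟪s, affineStat A c (fun j => ξ j ω) j⟫ *
      ⟪t, affineStat A c (fun j => ξ j ω) k⟫) P :=
  (h.memLp_inner_stat s j).integrable_fun_mul (h.memLp_inner_stat t k)

/-- The Riesz vector is `E[⟪s, Z⟫ Z]`. It supplies linearity and continuity in `t`, so that series
can be summed inside the form. -/
theorem exists_secondMoment_eq_inner (h : AffineChain P ξ A c ρ) (s : E) :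
    ∃ g : E, ∀ t, h.secondMoment s t = ⟪g, t⟫ := by
  have hi : Integrable (fun ω => ⟪s, affineStat A c (fun j => ξ j ω) 0⟫ •
      affineStat A c (fun j => ξ j ω) 0) P :=
    memLp_one_iff_integrable.1 ((h.memLp_stat 0).smul (h.memLp_inner_stat s 0))
  refine ⟨∫ ω, ⟪s, affineStat A c (fun j => ξ j ω) 0⟫ • affineStat A c (fun j => ξ j ω) 0 ∂P,
    fun t => ?_⟩
  rw [real_inner_comm, ← integral_inner hi]
  simp only [secondMoment, inner_smul_right]

theorem secondMoment_sub_left (h : AffineChain P ξ A c ρ) (s s' t : E) :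
    h.secondMoment (s - s') t = h.secondMoment s t - h.secondMoment s' t := by
  obtain ⟨g, hg⟩ := h.exists_secondMoment_eq_inner t
  simp only [h.secondMoment_comm _ t, hg, inner_sub_right]

theorem integral_inner_stat_mul (h : AffineChain P ξ A c ρ) (s t : E) (k : ℤ) :
    ∫ ω, ⟪s, affineStat A c (fun j => ξ j ω) k⟫ * ⟪t, affineStat A c (fun j => ξ j ω) k⟫ ∂P =
      h.secondMoment s t :=
  ((h.identDistrib_stat k).comp (u := fun z => ⟪s, z⟫ * ⟪t, z⟫)
    ((innerSL ℝ s).continuous.measurable.mul (innerSL ℝ t).continuous.measurable)).integral_eq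

/-- Each step back in time moves one factor of the mean operator onto `t`; the increment left over
is orthogonal to the past. -/
theorem integral_inner_stat_mul_add (h : AffineChain P ξ A c ρ) (s t : E) (k : ℤ) (n : ℕ) :
    ∫ ω, ⟪s, affineStat A c (fun j => ξ j ω) k⟫ *
      ⟪t, affineStat A c (fun j => ξ j ω) (k + n)⟫ ∂P = h.secondMoment s ((h.adjMean ^ n) t) := by
  induction n generalizing t with
  | zero => simpa using h.integral_inner_stat_mul s t k
  | succ n ih =>
    have hs : (fun ω => ⟪s, affineStat A c (fun j => ξ j ω) k⟫ *
        ⟪t, affineStat A c (fun j => ξ j ω) (k + (n + 1 : ℕ))⟫) =ᵐ[P]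
        fun ω => ⟪s, affineStat A c (fun j => ξ j ω) k⟫ *
          ⟪h.adjMean t, affineStat A c (fun j => ξ j ω) (k + n)⟫ +
          ⟪s, affineStat A c (fun j => ξ j ω) k⟫ *
          h.incr t (ξ (k + n + 1) ω) (affineStat A c (fun j => ξ j ω) (k + n)) := by
      filter_upwards [h.inner_stat_succ t (k + n)] with ω hω
      rw [Nat.cast_succ, ← add_assoc, hω, mul_add]
    rw [integral_congr_ae hs, integral_add (h.integrable_inner_mul_inner_stat _ _ _ _)
      ((h.memLp_inner_stat s k).integrable_fun_mul (h.memLp_incr_stat t (k + n))), ih,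
      h.integral_incr_mul t (lt_add_one (k + n)) (h.measurable_past_stat _)
        ((h.measurable_past_inner_stat s k).mono
          (info_mono (Set.Iic_subset_Iic.2 (by omega))) le_rfl), add_zero, pow_succ]
    rfl

/-- The covariance `E[⟪s, ζ⟫ ⟪t, ζ⟫]` of the stationary martingale increments. -/
noncomputable def incrCov (h : AffineChain P ξ A c ρ) (s t : E) : ℝ :=
  ∫ ω, h.incr s (ξ (0 + 1) ω) (affineStat A c (fun j => ξ j ω) 0) *
    h.incr t (ξ (0 + 1) ω) (affineStat A c (fun j => ξ j ω) 0) ∂P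

/-- Expand the second moment of `Z_1` by the recursion. The cross terms vanish by orthogonality, and
stationarity brings the second moment back to time `0`. -/
theorem incrCov_eq (h : AffineChain P ξ A c ρ) (s t : E) :
    h.incrCov s t = h.secondMoment s t - h.secondMoment (h.adjMean s) (h.adjMean t) := by
  have i1 := h.integrable_inner_mul_inner_stat (h.adjMean s) (h.adjMean t) 0 0
  have i2 := (h.memLp_inner_stat (h.adjMean s) 0).integrable_fun_mul (h.memLp_incr_stat t 0)
  have i3 := (h.memLp_inner_stat (h.adjMean t) 0).integrable_fun_mul (h.memLp_incr_stat s 0)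
  have i4 := (h.memLp_incr_stat s 0).integrable_fun_mul (h.memLp_incr_stat t 0)
  have hs : (fun ω => ⟪s, affineStat A c (fun j => ξ j ω) (0 + 1)⟫ *
      ⟪t, affineStat A c (fun j => ξ j ω) (0 + 1)⟫) =ᵐ[P]
      ((fun ω => ⟪h.adjMean s, affineStat A c (fun j => ξ j ω) 0⟫ *
        ⟪h.adjMean t, affineStat A c (fun j => ξ j ω) 0⟫) +
      fun ω => ⟪h.adjMean s, affineStat A c (fun j => ξ j ω) 0⟫ *
        h.incr t (ξ (0 + 1) ω) (affineStat A c (fun j => ξ j ω) 0)) +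
      ((fun ω => ⟪h.adjMean t, affineStat A c (fun j => ξ j ω) 0⟫ *
        h.incr s (ξ (0 + 1) ω) (affineStat A c (fun j => ξ j ω) 0)) +
      fun ω => h.incr s (ξ (0 + 1) ω) (affineStat A c (fun j => ξ j ω) 0) *
        h.incr t (ξ (0 + 1) ω) (affineStat A c (fun j => ξ j ω) 0)) := by
    filter_upwards [h.inner_stat_succ s 0, h.inner_stat_succ t 0] with ω h1 h2
    rw [h1, h2]
    simp only [Pi.add_apply]
    ring
  rw [← h.integral_inner_stat_mul s t (0 + 1), integral_congr_ae hs,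
    integral_add' (i1.add i2) (i3.add i4), integral_add' i1 i2, integral_add' i3 i4,
    h.integral_incr_mul t (lt_add_one 0) (h.measurable_past_stat 0)
      (h.measurable_past_inner_stat _ 0),
    h.integral_incr_mul s (lt_add_one 0) (h.measurable_past_stat 0)
      (h.measurable_past_inner_stat _ 0), secondMoment, incrCov]
  ring

/-- With `G` the second moment form, `M` the mean operator and `R = (1 - Mᵀ)⁻¹`, nonnegative lags
sum to `G(s, R t)` and negative lags to `G(t, Mᵀ R s)`. Substituting `s = R s - Mᵀ R s` and likewise
for `t`, the total becomes `G(R s, R t) - G(Mᵀ R s, Mᵀ R t)`. -/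
theorem hasSum_integral_inner_stat (h : AffineChain P ξ A c ρ) (s t : E) :
    HasSum (fun k : ℤ => ∫ ω, ⟪s, affineStat A c (fun j => ξ j ω) 0⟫ *
      ⟪t, affineStat A c (fun j => ξ j ω) k⟫ ∂P) (h.incrCov (h.adjRes s) (h.adjRes t)) := by
  have h1 : HasSum (fun n : ℕ => h.secondMoment s ((h.adjMean ^ n) t))
      (h.secondMoment s (h.adjRes t)) := by
    obtain ⟨g, hg⟩ := h.exists_secondMoment_eq_inner s
    simp only [hg]
    exact (h.hasSum_adjMean_pow t).mapL (innerSL ℝ g)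
  have h2 : HasSum (fun n : ℕ => h.secondMoment t ((h.adjMean ^ (n + 1)) s))
      (h.secondMoment t (h.adjMean (h.adjRes s))) := by
    obtain ⟨g, hg⟩ := h.exists_secondMoment_eq_inner t
    simp only [hg, ← h.adjRes_adjMean]
    exact (h.hasSum_adjMean_pow (h.adjMean s)).mapL (innerSL ℝ g)
  have h3 : h.incrCov (h.adjRes s) (h.adjRes t) =
      h.secondMoment s (h.adjRes t) + h.secondMoment t (h.adjMean (h.adjRes s)) := by
    have hl : ∀ s u, h.secondMoment s u = h.secondMoment (h.adjRes s) u -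
        h.secondMoment (h.adjMean (h.adjRes s)) u := fun s u => by
      rw [← h.secondMoment_sub_left, h.adjRes_sub]
    rw [hl s, hl t, h.incrCov_eq, h.secondMoment_comm (h.adjMean (h.adjRes s)) (h.adjRes t),
      h.secondMoment_comm (h.adjMean (h.adjRes s)) (h.adjMean (h.adjRes t))]
    ring
  rw [h3]
  refine HasSum.of_nat_of_neg_add_one ?_ ?_
  · convert h1 using 2 with n
    rw [← h.integral_inner_stat_mul_add s t 0 n, zero_add]
  · convert h2 using 2 with n
    -- For a negative lag the roles are exchanged: the earlier time is `-(n + 1)` and time `0` lies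
    -- `n + 1` steps later.
    rw [← h.integral_inner_stat_mul_add t s (-(n + 1 : ℤ)) (n + 1)]
    refine integral_congr_ae (ae_of_all _ fun ω => ?_)
    simp [mul_comm]

end AffineChain

theorem sum_range_mul_div_mod {M : Type*} [AddCommMonoid M] (f : ℕ → ℕ → M) {L : ℕ} (hL : 0 < L)
    (N : ℕ) :
    ∑ k ∈ Finset.range (N * L), f (k / L) (k % L) =
      ∑ j ∈ Finset.range N, ∑ i ∈ Finset.range L, f j i := by
  induction N with
  | zero => simp
  | succ N ih =>
    rw [Nat.succ_mul, Finset.sum_range_add, ih, Finset.sum_range_succ]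
    congr 1
    refine Finset.sum_congr rfl fun i hi => ?_
    have hi' := Finset.mem_range.1 hi
    rw [mul_comm N L, Nat.mul_add_div hL, Nat.mul_add_mod, Nat.div_eq_of_lt hi',
      Nat.mod_eq_of_lt hi', add_zero]

namespace AffineChain

variable {Ω X E : Type*} [mΩ : MeasurableSpace Ω] {P : Measure Ω} [IsProbabilityMeasure P]
  [mX : MeasurableSpace X] [NormedAddCommGroup E] [InnerProductSpace ℝ E] [FiniteDimensional ℝ E]
  [SecondCountableTopology E] [CompleteSpace E] [MeasurableSpace E] [BorelSpace E]
  {ξ : ℤ → Ω → X} {A : X → E →L[ℝ] E} {c : X → E} {ρ : ℝ≥0∞}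

/-! ### Partial sums and their martingale approximation -/

/-- The partial sums of the stationary martingale increments. -/
noncomputable def martSum (h : AffineChain P ξ A c ρ) (w : E) (n : ℕ) (ω : Ω) : ℝ :=
  ∑ k ∈ Finset.range n, h.incr w (ξ ((k : ℤ) + 1) ω) (affineStat A c (fun j => ξ j ω) k)

/-- The increments summed over a block of length `L`, with the iteration restarted at `0`. -/
noncomputable def blockSum (h : AffineChain P ξ A c ρ) (w : E) (L : ℕ) (y : ℕ → X) : ℝ :=
  ∑ i ∈ Finset.range L, h.incr w (y i) (affineFwd A c y 0 i)

theorem memLp_martSum (h : AffineChain P ξ A c ρ) (w : E) (n : ℕ) :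
    MemLp (h.martSum w n) 2 P :=
  memLp_finsetSum _ fun k _ => h.memLp_incr_stat w k

/-- Gordin's decomposition. Writing `t = R t - Mᵀ R t`, with `R` the adjoint resolvent and `Mᵀ` the
adjoint mean, makes the sum telescope apart from the martingale increments in direction `R t`. -/
theorem inner_stat_sum (h : AffineChain P ξ A c ρ) (t : E) (n : ℕ) :
    ∀ᵐ ω ∂P, ∑ k ∈ Finset.range n, ⟪t, affineStat A c (fun j => ξ j ω) ((k : ℤ) + 1)⟫ =
      h.martSum (h.adjRes t) n ω +
        (⟪h.adjMean (h.adjRes t), affineStat A c (fun j => ξ j ω) 0⟫ -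
          ⟪h.adjMean (h.adjRes t), affineStat A c (fun j => ξ j ω) n⟫) := by
  have hall : ∀ᵐ ω ∂P, ∀ k : ℤ, ⟪h.adjRes t, affineStat A c (fun j => ξ j ω) (k + 1)⟫ =
      ⟪h.adjMean (h.adjRes t), affineStat A c (fun j => ξ j ω) k⟫ +
        h.incr (h.adjRes t) (ξ (k + 1) ω) (affineStat A c (fun j => ξ j ω) k) :=
    ae_all_iff.2 fun k => h.inner_stat_succ (h.adjRes t) k
  filter_upwards [hall] with ω hω
  induction n with
  | zero => simp [martSum]
  | succ n ih =>
    have h1 : ∀ z : E, ⟪t, z⟫ = ⟪h.adjRes t, z⟫ - ⟪h.adjMean (h.adjRes t), z⟫ := fun z => by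
      rw [← inner_sub_left, h.adjRes_sub]
    rw [Finset.sum_range_succ, ih, h1, hω n, martSum, martSum, Finset.sum_range_succ]
    push_cast
    ring

theorem eLpNorm_inner_le (f : Ω → E) (t : E) :
    eLpNorm (fun ω => ⟪t, f ω⟫) 2 P ≤ ‖t‖ₑ * eLpNorm f 2 P :=
  eLpNorm_le_nnreal_smul_eLpNorm_of_ae_le_mul (c := ‖t‖₊)
      (ae_of_all _ fun _ => nnnorm_inner_le_nnnorm _ _) 2

/-- The partial sums of the forward iterates started at `u`. -/
noncomputable def fwdSum (_h : AffineChain P ξ A c ρ) (t u : E) (n : ℕ) (ω : Ω) : ℝ :=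
  ∑ k ∈ Finset.range n, ⟪t, affineFwd A c (fun j => ξ (0 + j + 1) ω) u (k + 1)⟫

theorem memLp_fwdSum (h : AffineChain P ξ A c ρ) (t u : E) (n : ℕ) :
    MemLp (h.fwdSum t u n) 2 P :=
  memLp_finsetSum _ fun k _ => (innerSL ℝ t).comp_memLp' (h.memLp_fwd u (k + 1) 0)

/-- The error consists of two boundary terms, bounded by stationarity, and the influence of the
initial value, which is geometrically summable. It is bounded in `n`, hence negligible after
division by `√n`. -/
theorem exists_integral_fwdSum_sub_martSum_le (h : AffineChain P ξ A c ρ) (t u : E) :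
    ∃ C : ℝ, ∀ n, ∫ ω, |h.fwdSum t u n ω - h.martSum (h.adjRes t) n ω| ∂P ≤ C := by
  set B := h.adjMean (h.adjRes t)
  set M := eLpNorm (fun ω => affineStat A c (fun j => ξ j ω) 0) 2 P with hM
  set D := eLpNorm (fun ω => affineStat A c (fun j => ξ j ω) 0 - u) 2 P with hD
  have hMt : M ≠ ∞ := (h.memLp_stat 0).2.ne
  have hDt : D ≠ ∞ := ((h.memLp_stat 0).sub (memLp_const u)).2.ne
  set C : ℝ≥0∞ := ‖B‖ₑ * M + ‖B‖ₑ * M + ‖t‖ₑ * ∑' k : ℕ, ρ ^ k * D with hC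
  have hCt : C ≠ ∞ := ENNReal.add_ne_top.2 ⟨ENNReal.add_ne_top.2
    ⟨ENNReal.mul_ne_top enorm_ne_top hMt, ENNReal.mul_ne_top enorm_ne_top hMt⟩,
    ENNReal.mul_ne_top enorm_ne_top (h.tsum_rate_mul_ne_top hDt)⟩
  refine ⟨C.toReal, fun n => ?_⟩
  refine (integral_abs_le_toReal_eLpNorm ((h.memLp_fwdSum t u n).sub
    (h.memLp_martSum (h.adjRes t) n))).trans (ENNReal.toReal_mono hCt ?_)
  have hd : ∀ k : ℕ, MemLp (fun ω => ⟪t, affineStat A c (fun j => ξ j ω) (0 + (k + 1 : ℕ)) -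
      affineFwd A c (fun j => ξ (0 + j + 1) ω) u (k + 1)⟫) 2 P := fun k =>
    (innerSL ℝ t).comp_memLp' ((h.memLp_stat _).sub (h.memLp_fwd u (k + 1) 0))
  have hs : (h.fwdSum t u n - h.martSum (h.adjRes t) n) =ᵐ[P]
      ((fun ω => ⟪B, affineStat A c (fun j => ξ j ω) 0⟫) -
        fun ω => ⟪B, affineStat A c (fun j => ξ j ω) n⟫) -
      ∑ k ∈ Finset.range n, fun ω => ⟪t, affineStat A c (fun j => ξ j ω) (0 + (k + 1 : ℕ)) -
        affineFwd A c (fun j => ξ (0 + j + 1) ω) u (k + 1)⟫ := by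
    filter_upwards [h.inner_stat_sum t n] with ω hω
    simp only [Pi.sub_apply, Finset.sum_apply, inner_sub_right, Finset.sum_sub_distrib, fwdSum]
    simp only [zero_add, Nat.cast_add, Nat.cast_one]
    rw [hω]
    ring
  rw [eLpNorm_congr_ae hs]
  refine (eLpNorm_sub_le ((h.memLp_inner_stat B 0).sub (h.memLp_inner_stat B n)).1
    (memLp_finsetSum' _ fun k _ => hd k).1 (by norm_num)).trans (add_le_add ?_ ?_)
  · refine (eLpNorm_sub_le (h.memLp_inner_stat B 0).1 (h.memLp_inner_stat B n).1
      (by norm_num)).trans (add_le_add (eLpNorm_inner_le _ _) ?_)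
    refine (eLpNorm_inner_le _ _).trans (le_of_eq ?_)
    rw [(h.identDistrib_stat n).eLpNorm_eq]
  · refine (eLpNorm_sum_le (fun k _ => (hd k).1) (by norm_num)).trans ?_
    rw [← ENNReal.tsum_mul_left]
    refine le_trans (Finset.sum_le_sum fun k _ => ?_) (ENNReal.sum_le_tsum (Finset.range n))
    refine (eLpNorm_inner_le _ _).trans ?_
    gcongr
    refine (h.eLpNorm_stat_sub_fwd_le u (k + 1) 0).trans ?_
    rw [← hD]
    gcongr ?_ * _
    exact pow_le_pow_of_le_one zero_le h.rate_lt_one.le (Nat.le_succ k)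

theorem measurable_past_martSum (h : AffineChain P ξ A c ρ) (w : E) (m n : ℕ) :
    Measurable[info ξ (Set.Iic ((m + n : ℕ) : ℤ))] fun ω => ∑ k ∈ Finset.range n,
      h.incr w (ξ (((m + k : ℕ) : ℤ) + 1) ω) (affineStat A c (fun j => ξ j ω) (m + k : ℕ)) := by
  refine Finset.measurable_fun_sum _ fun k hk => ?_
  have := Finset.mem_range.1 hk
  refine h.measurable_info_incr w (Set.mem_Iic.2 (by omega)) ?_
  exact (h.measurable_past_stat _).mono (info_mono (Set.Iic_subset_Iic.2 (by omega))) le_rfl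

theorem integral_incr_stat_sq (h : AffineChain P ξ A c ρ) (w : E) (k : ℤ) :
    ∫ ω, h.incr w (ξ (k + 1) ω) (affineStat A c (fun j => ξ j ω) k) ^ 2 ∂P = h.incrCov w w := by
  have hid : IdentDistrib (fun ω => (ξ (k + 1) ω, affineStat A c (fun j => ξ j ω) k))
      (fun ω => (ξ (0 + 1) ω, affineStat A c (fun j => ξ j ω) 0)) P P :=
    ((h.identDistrib (k + 1)).trans (h.identDistrib (0 + 1)).symm).prodMk (h.identDistrib_stat k)
      (indepFun_input_of_past h.measurable_input h.indep (lt_add_one k)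
        (h.measurable_past_stat k))
      (indepFun_input_of_past h.measurable_input h.indep (lt_add_one 0)
        (h.measurable_past_stat 0))
  rw [incrCov]
  simp only [← sq]
  exact (hid.comp ((h.measurable_incr w).pow_const 2)).integral_eq

theorem integral_martSum_sub_sq (h : AffineChain P ξ A c ρ) (w : E) (m n : ℕ) :
    ∫ ω, (h.martSum w (m + n) ω - h.martSum w m ω) ^ 2 ∂P = n * h.incrCov w w := by
  have hs : ∀ ω, h.martSum w (m + n) ω - h.martSum w m ω = ∑ k ∈ Finset.range n,
      h.incr w (ξ (((m + k : ℕ) : ℤ) + 1) ω) (affineStat A c (fun j => ξ j ω) (m + k : ℕ)) :=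
    fun ω => by
      rw [martSum, martSum, Finset.sum_range_add, add_sub_cancel_left]
  simp_rw [hs]
  rw [integral_sq_sum_range (d := fun k ω => h.incr w (ξ (((m + k : ℕ) : ℤ) + 1) ω)
    (affineStat A c (fun j => ξ j ω) (m + k : ℕ))) (fun k => h.memLp_incr_stat w _)
    (fun k => h.integral_incr_mul w (lt_add_one _) (h.measurable_past_stat _)
      (h.measurable_past_martSum w m k))]
  simp_rw [h.integral_incr_stat_sq]
  simp

/-! ### Restarted blocks -/

theorem measurable_blockSum (h : AffineChain P ξ A c ρ) (w : E) (L : ℕ) {Ω' : Type*}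
    [MeasurableSpace Ω'] {y : ℕ → Ω' → X} (hy : ∀ j < L, Measurable (y j)) :
    Measurable fun ω => h.blockSum w L fun j => y j ω := by
  refine Finset.measurable_fun_sum _ fun i hi => ?_
  have := Finset.mem_range.1 hi
  exact (h.measurable_incr w).comp ((hy i this).prodMk
    (h.measurable_affineFwd 0 i fun j hj => hy j (hj.trans this)))

theorem measurable_info_blockSum (h : AffineChain P ξ A c ρ) (w : E) (L : ℕ) (k : ℤ) :
    Measurable[info ξ (Set.Ioc k (k + L))] fun ω => h.blockSum w L fun j => ξ (k + j + 1) ω :=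
  @measurable_blockSum _ _ _ _ _ _ _ _ _ _ _ _ _ _ _ _ _ _ h w L _
    (info ξ (Set.Ioc k (k + L)))
    (fun (j : ℕ) => ξ (k + j + 1)) fun _ hj => measurable_info (by constructor <;> omega)

theorem memLp_incr_fwd (h : AffineChain P ξ A c ρ) (w : E) (k : ℤ) (i : ℕ) :
    MemLp (fun ω => h.incr w (ξ (k + i + 1) ω)
      (affineFwd A c (fun j => ξ (k + j + 1) ω) 0 i)) 2 P :=
  h.memLp_incr w (lt_add_one _) (h.measurable_past_fwd 0 i k) (h.memLp_fwd 0 i k)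

theorem memLp_blockSum (h : AffineChain P ξ A c ρ) (w : E) (L : ℕ) (k : ℤ) :
    MemLp (fun ω => h.blockSum w L fun j => ξ (k + j + 1) ω) 2 P :=
  memLp_finsetSum _ fun i _ => h.memLp_incr_fwd w k i

theorem integral_blockSum (h : AffineChain P ξ A c ρ) (w : E) (L : ℕ) (k : ℤ) :
    ∫ ω, h.blockSum w L (fun j => ξ (k + j + 1) ω) ∂P = 0 := by
  simp only [blockSum]
  rw [integral_finsetSum _ fun i _ => (h.memLp_incr_fwd w k i).integrable (by norm_num)]
  refine Finset.sum_eq_zero fun i _ => ?_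
  simpa using h.integral_incr_mul w (lt_add_one (k + i)) (h.measurable_past_fwd 0 i k)
    (G := fun _ => 1) measurable_const

theorem integral_blockSum_sq (h : AffineChain P ξ A c ρ) (w : E) (L : ℕ) (k : ℤ) :
    ∫ ω, h.blockSum w L (fun j => ξ (k + j + 1) ω) ^ 2 ∂P = ∑ i ∈ Finset.range L,
      ∫ ω, h.incr w (ξ (k + i + 1) ω) (affineFwd A c (fun j => ξ (k + j + 1) ω) 0 i) ^ 2 ∂P :=
  integral_sq_sum_range (fun i => h.memLp_incr_fwd w k i) (fun n =>
    h.integral_incr_mul w (lt_add_one _) (h.measurable_past_fwd 0 n k)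
      ((h.measurable_info_blockSum w n k).mono (info_mono Set.Ioc_subset_Iic_self) le_rfl)) L

theorem identDistrib_blockSum (h : AffineChain P ξ A c ρ) (w : E) (L : ℕ) (k l : ℤ) :
    IdentDistrib (fun ω => h.blockSum w L fun j => ξ (k + j + 1) ω)
      (fun ω => h.blockSum w L fun j => ξ (l + j + 1) ω) P P :=
  h.identDistrib_fwd (G := h.blockSum w L)
    (h.measurable_blockSum w L (y := fun j (z : ℕ → X) => z j) fun j _ => measurable_pi_apply j)
    k l

/-- Restarting is what creates independence: block `n` reads only the inputs `n L + 1, …, n L + L`.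
-/
theorem iIndepFun_blockSum (h : AffineChain P ξ A c ρ) (w : E) (L : ℕ) :
    iIndepFun (fun (n : ℕ) ω => h.blockSum w L fun j => ξ (((n * L : ℕ) : ℤ) + j + 1) ω) P := by
  refine iIndepFun_of_indep_past (𝓖 := fun n => info ξ (Set.Iic ((n * L : ℕ) : ℤ)))
    (fun m n hmn => info_mono (Set.Iic_subset_Iic.2
      (by exact_mod_cast Nat.mul_le_mul_right L hmn))) (fun n => ?_) fun n => ?_
  · refine (h.measurable_info_blockSum w L _).mono (info_mono fun x hx => ?_) le_rfl
    have := hx.2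
    simp only [Set.mem_Iic, Nat.succ_mul]
    push_cast at *
    exact this
  · refine indep_of_indep_of_le_right (indep_info h.measurable_input h.indep ?_)
      (h.measurable_info_blockSum w L ((n * L : ℕ) : ℤ)).comap_le
    exact Set.disjoint_left.2 fun x hx hx' => not_lt.2 hx hx'.1

theorem eLpNorm_incr_stat_sub_incr_fwd_le (h : AffineChain P ξ A c ρ) (w : E) (k : ℤ) (i : ℕ) :
    eLpNorm (fun ω => h.incr w (ξ (k + i + 1) ω) (affineStat A c (fun j => ξ j ω) (k + i)) -
      h.incr w (ξ (k + i + 1) ω) (affineFwd A c (fun j => ξ (k + j + 1) ω) 0 i)) 2 P ≤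
      ρ ^ i * (‖w‖ₑ * (ρ + ρ) * eLpNorm (fun ω => affineStat A c (fun j => ξ j ω) 0) 2 P) := by
  refine (h.eLpNorm_incr_sub_incr_le w (lt_add_one (k + i)) (h.measurable_past_stat _)
    (h.measurable_past_fwd 0 i k)).trans ?_
  rw [mul_left_comm]
  gcongr
  simpa using h.eLpNorm_stat_sub_fwd_le 0 i k

/-- The restarted increment approaches the stationary one in `L²` at rate `ρ ^ i`, so its `L²` norm
converges, by the triangle inequality in both directions. -/
theorem tendsto_integral_incr_fwd_sq (h : AffineChain P ξ A c ρ) (w : E) :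
    Tendsto (fun i : ℕ => ∫ ω, h.incr w (ξ (0 + i + 1) ω)
      (affineFwd A c (fun j => ξ (0 + j + 1) ω) 0 i) ^ 2 ∂P) atTop (𝓝 (h.incrCov w w)) := by
  set D := ‖w‖ₑ * (ρ + ρ) * eLpNorm (fun ω => affineStat A c (fun j => ξ j ω) 0) 2 P
  have hD : D ≠ ∞ := ENNReal.mul_ne_top (ENNReal.mul_ne_top enorm_ne_top
    (ENNReal.add_ne_top.2 ⟨h.rate_ne_top, h.rate_ne_top⟩)) (h.memLp_stat 0).2.ne
  have hS : ∀ i : ℕ, MemLp (fun ω => h.incr w (ξ (0 + i + 1) ω)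
      (affineStat A c (fun j => ξ j ω) (0 + i))) 2 P := fun i => h.memLp_incr_stat w _
  have hF := h.memLp_incr_fwd w 0
  have h1 : ∀ i : ℕ, (lpNorm (fun ω => h.incr w (ξ (0 + i + 1) ω)
      (affineStat A c (fun j => ξ j ω) (0 + i))) 2 P) ^ 2 = h.incrCov w w := fun i => by
    rw [← toReal_eLpNorm (hS i).1, ← integral_sq_eq_toReal_eLpNorm (hS i).1,
      h.integral_incr_stat_sq]
  have h2 : ∀ i : ℕ, ∫ ω, h.incr w (ξ (0 + i + 1) ω)
      (affineFwd A c (fun j => ξ (0 + j + 1) ω) 0 i) ^ 2 ∂P = (lpNorm (fun ω =>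
        h.incr w (ξ (0 + i + 1) ω) (affineFwd A c (fun j => ξ (0 + j + 1) ω) 0 i)) 2 P) ^ 2 :=
    fun i => by rw [← toReal_eLpNorm (hF i).1, integral_sq_eq_toReal_eLpNorm (hF i).1]
  have h3 : ∀ i : ℕ, |lpNorm (fun ω => h.incr w (ξ (0 + i + 1) ω)
      (affineFwd A c (fun j => ξ (0 + j + 1) ω) 0 i)) 2 P - √(h.incrCov w w)| ≤
      ρ.toReal ^ i * D.toReal := fun i => by
    rw [← h1 i, Real.sqrt_sq lpNorm_nonneg]
    have h4 : lpNorm ((fun ω => h.incr w (ξ (0 + i + 1) ω)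
        (affineStat A c (fun j => ξ j ω) (0 + i))) - fun ω => h.incr w (ξ (0 + i + 1) ω)
        (affineFwd A c (fun j => ξ (0 + j + 1) ω) 0 i)) 2 P ≤ ρ.toReal ^ i * D.toReal := by
      rw [← toReal_eLpNorm ((hS i).sub (hF i)).1, ← ENNReal.toReal_pow, ← ENNReal.toReal_mul]
      exact ENNReal.toReal_mono (ENNReal.mul_ne_top (by finiteness [h.rate_ne_top]) hD)
        (h.eLpNorm_incr_stat_sub_incr_fwd_le w 0 i)
    have h5 := lpNorm_le_lpNorm_add_lpNorm_sub' (p := 2) (f := fun ω =>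
      h.incr w (ξ (0 + i + 1) ω) (affineStat A c (fun j => ξ j ω) (0 + i))) (hF i) (by norm_num)
    have h6 := lpNorm_le_lpNorm_add_lpNorm_sub (p := 2) (g := fun ω =>
      h.incr w (ξ (0 + i + 1) ω) (affineStat A c (fun j => ξ j ω) (0 + i))) (f := fun ω =>
        h.incr w (ξ (0 + i + 1) ω) (affineFwd A c (fun j => ξ (0 + j + 1) ω) 0 i)) (hS i)
        (by norm_num)
    rw [abs_le]
    constructor <;> linarith
  simp_rw [h2]
  have hr : ρ.toReal < 1 := by
    rw [← ENNReal.toReal_one]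
    exact ENNReal.toReal_strict_mono ENNReal.one_ne_top h.rate_lt_one
  have h7 : Tendsto (fun i : ℕ => ρ.toReal ^ i * D.toReal) atTop (𝓝 0) := by
    simpa using (tendsto_pow_atTop_nhds_zero_of_lt_one ENNReal.toReal_nonneg hr).mul_const
      D.toReal
  have h8 := (tendsto_iff_norm_sub_tendsto_zero (b := √(h.incrCov w w))).2
    (squeeze_zero (fun i => norm_nonneg _) h3 h7)
  have h9 := h8.pow 2
  rwa [Real.sq_sqrt] at h9
  rw [← h1 0]
  positivity

end AffineChain

/-! ### The restart error and its orthogonality -/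

namespace AffineChain

variable {Ω X E : Type*} [mΩ : MeasurableSpace Ω] {P : Measure Ω} [IsProbabilityMeasure P]
  [mX : MeasurableSpace X] [NormedAddCommGroup E] [InnerProductSpace ℝ E] [FiniteDimensional ℝ E]
  [SecondCountableTopology E] [CompleteSpace E] [MeasurableSpace E] [BorelSpace E]
  {ξ : ℤ → Ω → X} {A : X → E →L[ℝ] E} {c : X → E} {ρ : ℝ≥0∞}

/-- The difference of the stationary and the restarted increment in position `i` of block `j`. -/
noncomputable def blockErr (h : AffineChain P ξ A c ρ) (w : E) (L j i : ℕ) (ω : Ω) : ℝ :=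
  h.incr w (ξ ((j * L : ℕ) + i + 1) ω) (affineStat A c (fun j => ξ j ω) ((j * L : ℕ) + i)) -
    h.incr w (ξ ((j * L : ℕ) + i + 1) ω)
      (affineFwd A c (fun l => ξ ((j * L : ℕ) + l + 1) ω) 0 i)

theorem memLp_blockErr (h : AffineChain P ξ A c ρ) (w : E) (L j i : ℕ) :
    MemLp (h.blockErr w L j i) 2 P :=
  (h.memLp_incr_stat w _).sub (h.memLp_incr_fwd w _ i)

theorem measurable_info_blockErr (h : AffineChain P ξ A c ρ) (w : E) (L j i : ℕ) :
    Measurable[info ξ (Set.Iic (((j * L : ℕ) : ℤ) + i + 1))] (h.blockErr w L j i) := by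
  have hle : info ξ (Set.Iic (((j * L : ℕ) : ℤ) + i)) ≤
      info ξ (Set.Iic (((j * L : ℕ) : ℤ) + i + 1)) :=
    info_mono (Set.Iic_subset_Iic.2 (by omega))
  exact (h.measurable_info_incr w Set.self_mem_Iic ((h.measurable_past_stat _).mono hle le_rfl)).sub
    (h.measurable_info_incr w Set.self_mem_Iic ((h.measurable_past_fwd 0 i _).mono hle le_rfl))

/-- The stationary and the restarted increments use the same new input, so their difference is still
a martingale difference. -/
theorem integral_mul_blockErr (h : AffineChain P ξ A c ρ) (w : E) (L j i : ℕ) {G : Ω → ℝ}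
    (hG : Measurable[info ξ (Set.Iic (((j * L : ℕ) : ℤ) + i))] G) (hG2 : MemLp G 2 P) :
    ∫ ω, G ω * h.blockErr w L j i ω ∂P = 0 := by
  simp only [blockErr, mul_sub]
  rw [integral_sub (hG2.integrable_fun_mul (h.memLp_incr_stat w _))
    (hG2.integrable_fun_mul (h.memLp_incr_fwd w _ i)),
    h.integral_incr_mul w (lt_add_one _) (h.measurable_past_stat _) hG,
    h.integral_incr_mul w (lt_add_one _) (h.measurable_past_fwd 0 i _) hG, sub_zero]

theorem martSum_sub_sum_blockSum (h : AffineChain P ξ A c ρ) (w : E) {L : ℕ} (hL : 0 < L) (N : ℕ)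
    (ω : Ω) :
    h.martSum w (N * L) ω -
      ∑ j ∈ Finset.range N, h.blockSum w L (fun l => ξ ((j * L : ℕ) + l + 1) ω) =
      ∑ k ∈ Finset.range (N * L), h.blockErr w L (k / L) (k % L) ω := by
  have h1 : h.martSum w (N * L) ω = ∑ j ∈ Finset.range N, ∑ i ∈ Finset.range L,
      h.incr w (ξ ((j * L : ℕ) + i + 1) ω)
        (affineStat A c (fun j => ξ j ω) ((j * L : ℕ) + i)) := by
    rw [← sum_range_mul_div_mod (fun j i => h.incr w (ξ ((j * L : ℕ) + i + 1) ω)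
        (affineStat A c (fun j => ξ j ω) ((j * L : ℕ) + i))) hL N]
    refine Finset.sum_congr rfl fun k _ => ?_
    have hk : (k : ℤ) = ((k / L * L : ℕ) : ℤ) + (k % L : ℕ) := by
      exact_mod_cast (Nat.div_add_mod' k L).symm
    rw [← hk]
  rw [h1, sum_range_mul_div_mod (fun j i => h.blockErr w L j i ω) hL, ← Finset.sum_sub_distrib]
  refine Finset.sum_congr rfl fun j _ => ?_
  rw [blockSum, ← Finset.sum_sub_distrib]
  rfl

/-- The decisive point is that `C` does not depend on `L`. By Pythagoras, a block contributes the
sum over `i < L` of terms of order `ρ ^ (2 i)`, which the full geometric series bounds. -/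
theorem exists_integral_martSum_sub_blockSum_sq_le (h : AffineChain P ξ A c ρ) (w : E) :
    ∃ C : ℝ, 0 ≤ C ∧ ∀ L : ℕ, 0 < L → ∀ N : ℕ,
      ∫ ω, (h.martSum w (N * L) ω -
        ∑ j ∈ Finset.range N, h.blockSum w L (fun l => ξ ((j * L : ℕ) + l + 1) ω)) ^ 2 ∂P
        ≤ N * C := by
  set D := ‖w‖ₑ * (ρ + ρ) * eLpNorm (fun ω => affineStat A c (fun j => ξ j ω) 0) 2 P with hD'
  have hD : D ≠ ∞ := ENNReal.mul_ne_top (ENNReal.mul_ne_top enorm_ne_top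
    (ENNReal.add_ne_top.2 ⟨h.rate_ne_top, h.rate_ne_top⟩)) (h.memLp_stat 0).2.ne
  set r := ρ.toReal
  have hr0 : 0 ≤ r := ENNReal.toReal_nonneg
  have hr : r < 1 := by
    rw [← ENNReal.toReal_one]
    exact ENNReal.toReal_strict_mono ENNReal.one_ne_top h.rate_lt_one
  have hr2 : r ^ 2 < 1 := pow_lt_one₀ hr0 hr two_ne_zero
  have hbound : ∀ L j i : ℕ, ∫ ω, h.blockErr w L j i ω ^ 2 ∂P ≤
      (r ^ 2) ^ i * D.toReal ^ 2 := fun L j i => by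
    have := integral_sq_le_of_eLpNorm_le (h.memLp_blockErr w L j i).1
      (C := r ^ i * D.toReal) (by positivity) (by
        refine (h.eLpNorm_incr_stat_sub_incr_fwd_le w ((j * L : ℕ) : ℤ) i).trans (le_of_eq ?_)
        rw [ENNReal.ofReal_mul (by positivity), ENNReal.ofReal_pow hr0,
          ENNReal.ofReal_toReal h.rate_ne_top, ENNReal.ofReal_toReal hD])
    rwa [mul_pow, ← pow_mul, mul_comm i 2, pow_mul] at this
  refine ⟨(1 - r ^ 2)⁻¹ * D.toReal ^ 2, ?_, fun L hL N => ?_⟩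
  · have : 0 < 1 - r ^ 2 := by linarith
    positivity
  simp_rw [h.martSum_sub_sum_blockSum w hL N]
  have hdiv : ∀ k : ℕ, (k : ℤ) = ((k / L * L : ℕ) : ℤ) + (k % L : ℕ) := fun k => by
    exact_mod_cast (Nat.div_add_mod' k L).symm
  -- The errors are listed in order of time `k = j L + i`, so that each one is orthogonal to all the
  -- earlier ones, including those of previous blocks.
  rw [integral_sq_sum_range (fun k => h.memLp_blockErr w L (k / L) (k % L)) (fun n => ?_)]
  · rw [sum_range_mul_div_mod (fun j i => ∫ ω, h.blockErr w L j i ω ^ 2 ∂P) hL]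
    refine (Finset.sum_le_sum fun j _ => Finset.sum_le_sum fun i _ => hbound L j i).trans ?_
    rw [Finset.sum_const, Finset.card_range, nsmul_eq_mul, ← Finset.sum_mul]
    gcongr
    rw [← tsum_geometric_of_lt_one (by positivity) hr2]
    exact (summable_geometric_of_lt_one (by positivity) hr2).sum_le_tsum _
      fun _ _ => by positivity
  · refine h.integral_mul_blockErr w L (n / L) (n % L) ?_
      (memLp_finsetSum _ fun k _ => h.memLp_blockErr w L (k / L) (k % L))
    rw [← hdiv n]
    refine Finset.measurable_fun_sum _ fun k hk => ?_
    have := Finset.mem_range.1 hk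
    refine (h.measurable_info_blockErr w L (k / L) (k % L)).mono (info_mono ?_) le_rfl
    rw [← hdiv k]
    exact Set.Iic_subset_Iic.2 (by omega)

/-! ### The central limit theorem -/

theorem tendsto_charFun_blockSum (h : AffineChain P ξ A c ρ) (w : E) (L : ℕ) :
    Tendsto (fun N : ℕ => ∫ ω, Complex.exp (((√L)⁻¹ * ((√N)⁻¹ * ∑ j ∈ Finset.range N,
        h.blockSum w L (fun l => ξ ((j * L : ℕ) + l + 1) ω)) : ℝ) * Complex.I) ∂P) atTop
      (𝓝 (Complex.exp ((-((L : ℝ)⁻¹ * ∑ i ∈ Finset.range L, ∫ ω, h.incr w (ξ (0 + i + 1) ω)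
        (affineFwd A c (fun j => ξ (0 + j + 1) ω) 0 i) ^ 2 ∂P) / 2 : ℝ)))) := by
  have h1 := tendsto_integral_exp_I_inv_sqrt_mul_sum
    (Y := fun (n : ℕ) ω => h.blockSum w L fun j => ξ (((n * L : ℕ) : ℤ) + j + 1) ω)
    (h.memLp_blockSum w L _) (h.integral_blockSum w L _) (h.iIndepFun_blockSum w L)
    -- The normalization by the block length enters as the Fourier argument.
    (fun i => h.identDistrib_blockSum w L _ _) (√L)⁻¹
  rw [inv_pow, Real.sq_sqrt (Nat.cast_nonneg L), h.integral_blockSum_sq] at h1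
  simpa only [Nat.zero_mul, Nat.cast_zero] using h1

/-- The four terms are: passage to the martingale, the incomplete last block, the restart error, and
the change of normalization from `√n` to `√(N L)` with `N = n / L`. For fixed `L` only the restart
error survives as `n → ∞`. -/
theorem integral_abs_fwdSum_sub_blockSum_le (h : AffineChain P ξ A c ρ) (t u : E) :
    ∃ C₁ C₂ : ℝ, 0 ≤ C₂ ∧ ∀ L : ℕ, 0 < L → ∃ K : ℝ, ∀ n : ℕ, L ≤ n →
      ∫ ω, |(√n)⁻¹ * h.fwdSum t u n ω - (√L)⁻¹ * ((√(n / L : ℕ))⁻¹ *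
        ∑ j ∈ Finset.range (n / L),
          h.blockSum (h.adjRes t) L (fun l => ξ ((j * L : ℕ) + l + 1) ω))| ∂P ≤
        (√n)⁻¹ * C₁ + (√n)⁻¹ * √(L * h.incrCov (h.adjRes t) (h.adjRes t)) + √(C₂ / L) +
          K * (n : ℝ)⁻¹ := by
  set w := h.adjRes t with hw
  set V := h.incrCov w w with hV
  have hV0 : 0 ≤ V := by
    rw [hV, ← h.integral_incr_stat_sq w 0]
    exact integral_nonneg fun ω => sq_nonneg _
  obtain ⟨C₁, hC₁⟩ := h.exists_integral_fwdSum_sub_martSum_le t u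
  obtain ⟨C₂, hC₂0, hC₂⟩ := h.exists_integral_martSum_sub_blockSum_sq_le w
  -- In `K` the summand `√V * L` pays for the change of normalization; the other summand is slack.
  refine ⟨C₁, C₂, hC₂0, fun L hL => ⟨(√(C₂ / L) + √V) * L, fun n hn => ?_⟩⟩
  set N := n / L with hN
  have hLr : (0 : ℝ) < L := by exact_mod_cast hL
  have hN0 : 0 < N := Nat.div_pos hn hL
  have hNr : (0 : ℝ) < N := by exact_mod_cast hN0
  have hn0 : (0 : ℝ) < n := by exact_mod_cast hL.trans_le hn
  have hNL : N * L ≤ n := Nat.div_mul_le_self n L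
  have hNLr : (N : ℝ) * L ≤ n := by exact_mod_cast hNL
  have hmod : n < N * L + L := by
    have := Nat.lt_div_mul_add (a := n) hL
    exact this
  have hmodr : (n : ℝ) ≤ N * L + L := by exact_mod_cast hmod.le
  set F := h.fwdSum t u n
  set S : Ω → ℝ := fun ω => ∑ j ∈ Finset.range N,
    h.blockSum w L (fun l => ξ ((j * L : ℕ) + l + 1) ω) with hS
  have hF2 : MemLp F 2 P := h.memLp_fwdSum t u n
  have hS2 : MemLp S 2 P := memLp_finsetSum _ fun j _ => h.memLp_blockSum w L _
  have hT2 := h.memLp_martSum w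
  have e1 : ∫ ω, |F ω - h.martSum w n ω| ∂P ≤ C₁ := hC₁ n
  have e2 : ∫ ω, |h.martSum w n ω - h.martSum w (N * L) ω| ∂P ≤ √(L * V) := by
    refine (integral_abs_le_sqrt_integral_sq ((hT2 n).sub (hT2 (N * L)))).trans
      (Real.sqrt_le_sqrt ?_)
    obtain ⟨m, hm⟩ := Nat.exists_eq_add_of_le hNL
    have hm' : (m : ℝ) ≤ L := by
      have : m ≤ L := by omega
      exact_mod_cast this
    simp only [Pi.sub_apply]
    rw [hm, h.integral_martSum_sub_sq]
    gcongr
  have e3 : ∫ ω, |h.martSum w (N * L) ω - S ω| ∂P ≤ √(N * C₂) :=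
    (integral_abs_le_sqrt_integral_sq ((hT2 (N * L)).sub hS2)).trans
      (Real.sqrt_le_sqrt (hC₂ L hL N))
  have e4 : ∫ ω, |h.martSum w (N * L) ω| ∂P ≤ √(N * L * V) := by
    refine (integral_abs_le_sqrt_integral_sq (hT2 (N * L))).trans (Real.sqrt_le_sqrt ?_)
    have := h.integral_martSum_sub_sq w 0 (N * L)
    simp only [martSum, Finset.range_zero, Finset.sum_empty, sub_zero, zero_add] at this
    simp only [martSum]
    rw [this]
    push_cast
    exact le_rfl
  have i1 : Integrable (fun ω => |F ω - h.martSum w n ω|) P :=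
    ((hF2.sub (hT2 n)).integrable (by norm_num)).abs
  have i2 : Integrable (fun ω => |h.martSum w n ω - h.martSum w (N * L) ω|) P :=
    (((hT2 n).sub (hT2 (N * L))).integrable (by norm_num)).abs
  have i3 : Integrable (fun ω => |h.martSum w (N * L) ω - S ω|) P :=
    (((hT2 (N * L)).sub hS2).integrable (by norm_num)).abs
  have i4 : Integrable (fun ω => |h.martSum w (N * L) ω|) P :=
    ((hT2 (N * L)).integrable (by norm_num)).abs
  set a := (√n)⁻¹ with ha
  set b := (√L)⁻¹ * (√N)⁻¹ with hb
  have ha0 : 0 ≤ a := by positivity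
  have hbn : √(N * L) * b = 1 := by
    rw [hb, Real.sqrt_mul (Nat.cast_nonneg N)]
    field_simp
  have hab : a ≤ b := by
    rw [ha, hb, ← mul_inv, ← Real.sqrt_mul (Nat.cast_nonneg L), mul_comm (L : ℝ)]
    exact inv_anti₀ (by positivity) (Real.sqrt_le_sqrt hNLr)
  -- The left side is `1 - √(N L / n)`. Since `x ≤ √x` on `[0, 1]`, it is at most `1 - N L / n`, and
  -- fewer than `L` terms are missing from the last block.
  have hbn' : √(N * L) * (b - a) ≤ L * (n : ℝ)⁻¹ := by
    rw [mul_sub, hbn]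
    have hx0 : 0 ≤ (N : ℝ) * L / n := by positivity
    have hx1 : (N : ℝ) * L / n ≤ 1 := (div_le_one hn0).2 hNLr
    have h1 : √(N * L) * a = √(N * L / n) := by
      rw [ha, Real.sqrt_div (by positivity), div_eq_mul_inv]
    have h2 : (N : ℝ) * L / n ≤ √(N * L / n) :=
      Real.le_sqrt_of_sq_le (by nlinarith)
    have h3 : 1 - (N : ℝ) * L / n ≤ L * (n : ℝ)⁻¹ := by
      rw [sub_le_iff_le_add, ← div_eq_mul_inv, ← add_div, le_div_iff₀ hn0]
      linarith
    rw [h1]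
    linarith
  have hsq : √(N * C₂) = √(N * L) * √(C₂ / L) := by
    rw [← Real.sqrt_mul (by positivity)]
    congr 1
    field_simp
  have hpt : ∀ ω, |a * F ω - (√L)⁻¹ * ((√N)⁻¹ * S ω)| ≤ a * |F ω - h.martSum w n ω| +
      a * |h.martSum w n ω - h.martSum w (N * L) ω| + b * |h.martSum w (N * L) ω - S ω| +
      (b - a) * |h.martSum w (N * L) ω| := fun ω => by
    have : a * F ω - (√L)⁻¹ * ((√N)⁻¹ * S ω) = a * (F ω - h.martSum w n ω) +
      a * (h.martSum w n ω - h.martSum w (N * L) ω) + b * (h.martSum w (N * L) ω - S ω) +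
      -((b - a) * h.martSum w (N * L) ω) := by rw [hb]; ring
    rw [this]
    refine (abs_add_le _ _).trans (add_le_add ((abs_add_le _ _).trans
      (add_le_add ((abs_add_le _ _).trans (add_le_add ?_ ?_)) ?_)) ?_)
    · rw [abs_mul, abs_of_nonneg ha0]
    · rw [abs_mul, abs_of_nonneg ha0]
    · rw [abs_mul, abs_of_nonneg (ha0.trans hab)]
    · rw [abs_neg, abs_mul, abs_of_nonneg (sub_nonneg.2 hab)]
  have hb1 : b * √(N * C₂) = √(C₂ / L) := by
    rw [hsq, ← mul_assoc, mul_comm b, hbn, one_mul]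
  calc _ ≤ ∫ ω, (a * |F ω - h.martSum w n ω| +
      a * |h.martSum w n ω - h.martSum w (N * L) ω| + b * |h.martSum w (N * L) ω - S ω| +
      (b - a) * |h.martSum w (N * L) ω|) ∂P :=
        integral_mono (((hF2.const_mul a).sub ((hS2.const_mul _).const_mul _)).integrable
          (by norm_num)).abs ((((i1.const_mul a).add (i2.const_mul a)).add (i3.const_mul b)).add
            (i4.const_mul (b - a))) hpt
    _ = a * ∫ ω, |F ω - h.martSum w n ω| ∂P +
        a * ∫ ω, |h.martSum w n ω - h.martSum w (N * L) ω| ∂P +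
        b * ∫ ω, |h.martSum w (N * L) ω - S ω| ∂P +
        (b - a) * ∫ ω, |h.martSum w (N * L) ω| ∂P := by
      rw [integral_add (f := fun ω => a * |F ω - h.martSum w n ω| +
          a * |h.martSum w n ω - h.martSum w (N * L) ω| + b * |h.martSum w (N * L) ω - S ω|)
        (((i1.const_mul a).add (i2.const_mul a)).add (i3.const_mul b)) (i4.const_mul (b - a)),
        integral_add (f := fun ω => a * |F ω - h.martSum w n ω| +
          a * |h.martSum w n ω - h.martSum w (N * L) ω|) ((i1.const_mul a).add (i2.const_mul a))
        (i3.const_mul b), integral_add (i1.const_mul a) (i2.const_mul a)]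
      simp only [integral_const_mul]
    _ ≤ a * C₁ + a * √(L * V) + b * √(N * C₂) + (b - a) * √(N * L * V) := by
      have := sub_nonneg.2 hab
      have := ha0.trans hab
      gcongr
    _ ≤ _ := by
      rw [hb1]
      have h1 : (b - a) * √(N * L * V) ≤ √V * (L * (n : ℝ)⁻¹) := by
        rw [Real.sqrt_mul (by positivity), ← mul_assoc, mul_comm (b - a), mul_comm _ √V]
        exact mul_le_mul_of_nonneg_left hbn' (Real.sqrt_nonneg _)
      have h2 : 0 ≤ √(C₂ / L) * L * (n : ℝ)⁻¹ := by positivity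
      linarith

theorem tendsto_charFun_fwdSum (h : AffineChain P ξ A c ρ) (t u : E) :
    Tendsto (fun n : ℕ => ∫ ω, Complex.exp (((√n)⁻¹ * h.fwdSum t u n ω : ℝ) * Complex.I) ∂P) atTop
      (𝓝 (Complex.exp ((-h.incrCov (h.adjRes t) (h.adjRes t) / 2 : ℝ)))) := by
  obtain ⟨C₁, C₂, hC₂, hC⟩ := h.integral_abs_fwdSum_sub_blockSum_le t u
  have hdiv : ∀ L : ℕ, 0 < L → Tendsto (fun n : ℕ => n / L) atTop atTop := fun L hL =>
    Nat.tendsto_div_const_atTop hL.ne'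
  -- The summand `L⁻¹` of `κ` absorbs all the terms that vanish as `n → ∞` with `L` fixed.
  refine tendsto_of_tendsto_approx (κ := fun L : ℕ => √(C₂ / L) + (L : ℝ)⁻¹) (y := fun L n =>
    ∫ ω, Complex.exp (((√L)⁻¹ * ((√(n / L : ℕ))⁻¹ * ∑ j ∈ Finset.range (n / L),
      h.blockSum (h.adjRes t) L (fun l => ξ ((j * L : ℕ) + l + 1) ω)) : ℝ) * Complex.I) ∂P)
    (z := fun L => Complex.exp ((-((L : ℝ)⁻¹ * ∑ i ∈ Finset.range L, ∫ ω,
      h.incr (h.adjRes t) (ξ (0 + i + 1) ω)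
        (affineFwd A c (fun j => ξ (0 + j + 1) ω) 0 i) ^ 2 ∂P) / 2 : ℝ))) ?_ ?_ ?_ ?_
  · filter_upwards [eventually_gt_atTop 0] with L hL
    obtain ⟨K, hK⟩ := hC L hL
    have hinv : Tendsto (fun n : ℕ => (n : ℝ)⁻¹) atTop (𝓝 0) :=
      tendsto_inv_atTop_zero.comp tendsto_natCast_atTop_atTop
    have hsq : Tendsto (fun n : ℕ => (√(n : ℝ))⁻¹) atTop (𝓝 0) :=
      tendsto_inv_atTop_zero.comp (Real.tendsto_sqrt_atTop.comp tendsto_natCast_atTop_atTop)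
    have hlim : Tendsto (fun n : ℕ => (√(n : ℝ))⁻¹ * C₁ +
        (√n)⁻¹ * √(L * h.incrCov (h.adjRes t) (h.adjRes t)) + K * (n : ℝ)⁻¹) atTop (𝓝 0) := by
      simpa using ((hsq.mul_const C₁).add (hsq.mul_const _)).add (hinv.const_mul K)
    have hLpos : (0 : ℝ) < (L : ℝ)⁻¹ := by positivity
    filter_upwards [eventually_ge_atTop L, hlim.eventually_lt_const hLpos] with n hn hn2
    rw [dist_eq_norm]
    have hF2 := (h.memLp_fwdSum t u n).const_mul (√n)⁻¹
    have hS2 : MemLp (fun ω => (√L)⁻¹ * ((√(n / L : ℕ))⁻¹ * ∑ j ∈ Finset.range (n / L),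
        h.blockSum (h.adjRes t) L (fun l => ξ ((j * L : ℕ) + l + 1) ω))) 2 P :=
      ((memLp_finsetSum _ fun j _ => h.memLp_blockSum _ L _).const_mul _).const_mul _
    refine (norm_integral_exp_I_sub_le hF2.1 hS2.1
      ((hF2.sub hS2).integrable (by norm_num))).trans ((hK n hn).trans ?_)
    linarith
  · filter_upwards [eventually_gt_atTop 0] with L hL
    exact (h.tendsto_charFun_blockSum (h.adjRes t) L).comp (hdiv L hL)
  -- The block variance divided by `L` is a Cesàro mean of the second moments of the restarted
  -- increments.
  · have h1 := ((h.tendsto_integral_incr_fwd_sq (h.adjRes t)).cesaro.neg.div_const 2)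
    exact ((Complex.continuous_exp.comp Complex.continuous_ofReal).tendsto _).comp h1
  · have hinv : Tendsto (fun n : ℕ => (n : ℝ)⁻¹) atTop (𝓝 0) :=
      tendsto_inv_atTop_zero.comp tendsto_natCast_atTop_atTop
    have := ((hinv.const_mul C₂).sqrt).add hinv
    simpa [div_eq_mul_inv] using this

end AffineChain

/-! ### The long-run covariance matrix and the Gaussian limit -/

namespace AffineChain

variable {Ω X ι : Type*} [mΩ : MeasurableSpace Ω] {P : Measure Ω} [IsProbabilityMeasure P]
  [mX : MeasurableSpace X] [Fintype ι] [DecidableEq ι]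
  {ξ : ℤ → Ω → X} {A : X → EuclideanSpace ℝ ι →L[ℝ] EuclideanSpace ℝ ι}
  {c : X → EuclideanSpace ℝ ι} {ρ : ℝ≥0∞}

/-- The long-run covariance matrix of the stationary solution. -/
noncomputable def longRunCov (h : AffineChain P ξ A c ρ) : Matrix ι ι ℝ :=
  Matrix.of fun a b => h.incrCov (h.adjRes (EuclideanSpace.single a 1))
    (h.adjRes (EuclideanSpace.single b 1))

/-- Increments are linear in the direction, so the quadratic form of the matrix is the limiting
variance found in direction `t`. This matches the Gaussian exponent and yields positivity. -/
theorem dotProduct_longRunCov (h : AffineChain P ξ A c ρ) (t : ι → ℝ) :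
    t ⬝ᵥ h.longRunCov *ᵥ t =
      h.incrCov (h.adjRes (WithLp.toLp 2 t)) (h.adjRes (WithLp.toLp 2 t)) := by
  have ht : (WithLp.toLp 2 t : EuclideanSpace ℝ ι) = ∑ a, t a • EuclideanSpace.single a (1 : ℝ) := by
    ext a
    simp [Pi.single_apply]
  have hl : ∀ ω, h.incr (h.adjRes (WithLp.toLp 2 t)) (ξ (0 + 1) ω)
      (affineStat A c (fun j => ξ j ω) 0) = ∑ a, t a * h.incr (h.adjRes (EuclideanSpace.single a 1))
        (ξ (0 + 1) ω) (affineStat A c (fun j => ξ j ω) 0) := fun ω => by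
    simp only [ht, map_sum, map_smul, incr, sum_inner, inner_smul_left]
    rfl
  have hm := fun a => h.memLp_incr_stat (h.adjRes (EuclideanSpace.single a 1)) 0
  rw [incrCov]
  simp only [hl, Finset.sum_mul_sum]
  rw [integral_finsetSum _ fun a _ => integrable_finsetSum _ fun b _ =>
    ((hm a).const_mul (t a)).integrable_fun_mul ((hm b).const_mul (t b))]
  simp only [dotProduct, Matrix.mulVec, Finset.mul_sum]
  refine Finset.sum_congr rfl fun a _ => ?_
  rw [integral_finsetSum _ fun b _ =>
    ((hm a).const_mul (t a)).integrable_fun_mul ((hm b).const_mul (t b))]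
  refine Finset.sum_congr rfl fun b _ => ?_
  simp only [longRunCov, Matrix.of_apply, incrCov]
  rw [← integral_mul_const, ← integral_const_mul]
  refine integral_congr_ae (ae_of_all _ fun ω => ?_)
  ring

theorem posSemidef_longRunCov (h : AffineChain P ξ A c ρ) : h.longRunCov.PosSemidef := by
  refine Matrix.PosSemidef.of_dotProduct_mulVec_nonneg ?_ fun t => ?_
  · ext a b
    simp only [longRunCov, Matrix.conjTranspose_apply, Matrix.of_apply, incrCov, mul_comm,
      star_trivial]
  · rw [star_trivial, h.dotProduct_longRunCov, ← h.integral_incr_stat_sq _ 0]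
    exact integral_nonneg fun ω => sq_nonneg _

theorem hasSum_cov_stat (h : AffineChain P ξ A c ρ) (a b : ι) :
    HasSum (fun k : ℤ => cov[fun ω => affineStat A c (fun j => ξ j ω) 0 a,
      fun ω => affineStat A c (fun j => ξ j ω) k b; P]) (h.longRunCov a b) := by
  have hc : ∀ (a : ι) (z : EuclideanSpace ℝ ι), ⟪EuclideanSpace.single a (1 : ℝ), z⟫ = z a :=
    fun a z => by rw [EuclideanSpace.inner_single_left]; simp
  have hm := fun (a : ι) k => h.memLp_inner_stat (EuclideanSpace.single a 1) k
  simp only [hc] at hm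
  have h0 : ∀ (a : ι) k, ∫ ω, affineStat A c (fun j => ξ j ω) k a ∂P = 0 := fun a k => by
    simp_rw [← hc a]
    rw [integral_inner ((h.memLp_stat k).integrable (by norm_num)), h.integral_stat,
      inner_zero_right]
  have := h.hasSum_integral_inner_stat (EuclideanSpace.single a 1) (EuclideanSpace.single b 1)
  simp only [hc] at this
  have hk : ∀ k, cov[fun ω => affineStat A c (fun j => ξ j ω) 0 a,
      fun ω => affineStat A c (fun j => ξ j ω) k b; P] =
      ∫ ω, affineStat A c (fun j => ξ j ω) 0 a * affineStat A c (fun j => ξ j ω) k b ∂P :=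
    fun k => by
      rw [covariance_eq_sub (hm a 0) (hm b k), h0, h0]
      simp
  simp_rw [hk]
  exact this

/-- Lévy's continuity theorem: the characteristic function at `t` depends only on the scalar sums in
direction `t`. -/
theorem tendstoInDistribution_fwd (h : AffineChain P ξ A c ρ) (u : EuclideanSpace ℝ ι) :
    TendstoInDistribution (fun (n : ℕ) ω => √(n : ℝ) • ((n : ℝ)⁻¹ • ∑ k ∈ Finset.range n,
      affineFwd A c (fun j => ξ (0 + j + 1) ω) u (k + 1))) atTop id (fun _ => P)
      (multivariateGaussian 0 h.longRunCov) := by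
  have hmeas : ∀ n : ℕ, AEMeasurable (fun ω => √(n : ℝ) • ((n : ℝ)⁻¹ • ∑ k ∈ Finset.range n,
      affineFwd A c (fun j => ξ (0 + j + 1) ω) u (k + 1))) P := fun n => by
    have hs : AEMeasurable (fun ω => ∑ k ∈ Finset.range n,
        affineFwd A c (fun j => ξ (0 + j + 1) ω) u (k + 1)) P :=
      Finset.aemeasurable_fun_sum _ fun k _ => (h.memLp_fwd u (k + 1) 0).1.aemeasurable
    exact (hs.const_smul (n : ℝ)⁻¹).const_smul √(n : ℝ)
  refine ⟨hmeas, aemeasurable_id, ?_⟩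
  refine ProbabilityMeasure.tendsto_iff_tendsto_charFun.2 fun t => ?_
  simp only [ProbabilityMeasure.coe_mk, Measure.map_id]
  rw [charFun_multivariateGaussian h.posSemidef_longRunCov, h.dotProduct_longRunCov]
  convert h.tendsto_charFun_fwdSum t u using 1
  · ext n
    rw [charFun_apply, integral_map (hmeas n) (by fun_prop)]
    refine integral_congr_ae (ae_of_all _ fun ω => ?_)
    have hn : √(n : ℝ) * (n : ℝ)⁻¹ = (√n)⁻¹ := by
      rw [← div_eq_mul_inv, Real.sqrt_div_self]
    have hr : ⟪√(n : ℝ) • ((n : ℝ)⁻¹ • ∑ k ∈ Finset.range n,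
        affineFwd A c (fun j => ξ (0 + j + 1) ω) u (k + 1)), t⟫ = (√n)⁻¹ * h.fwdSum t u n ω := by
      rw [real_inner_comm, inner_smul_right, inner_smul_right, inner_sum, ← mul_assoc, hn, fwdSum]
    simp only [hr]
  · simp
    ring_nf

end AffineChain

/-! ### The masked covariates -/

section Masked

variable {d : ℕ}

/-- The masked covariate vector `D x`. -/
noncomputable def masked (m : Fin d → Bool) (x : Vec d) : Vec d :=
  Matrix.toEuclideanLin (dropMat m) x

theorem masked_apply (m : Fin d → Bool) (x : Vec d) (a : Fin d) :
    masked m x a = (if m a then 1 else 0) * x a := by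
  simp [masked, dropMat, Matrix.toLpLin_apply, Matrix.mulVec_diagonal]

theorem inner_vec (u v : Vec d) : ⟪u, v⟫ = ∑ a, u a * v a := by
  simp [PiLp.inner_apply, mul_comm]

theorem inner_masked (m : Fin d → Bool) (x u : Vec d) : ⟪x, masked m u⟫ = ⟪masked m x, u⟫ := by
  simp only [inner_vec, masked_apply]
  exact Finset.sum_congr rfl fun a _ => by ring

theorem step_eq (α : ℝ) (ξ : Sample d) (u : Vec d) :
    step α ξ u = u + (α * (ξ.y - ⟪masked ξ.mask ξ.x, u⟫)) • masked ξ.mask ξ.x := by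
  rw [← inner_masked]
  rfl

theorem toEuclideanLin_drop_gram_drop (m : Fin d → Bool) (x v : Vec d) :
    Matrix.toEuclideanLin (dropMat m * gram x * dropMat m) v =
      ⟪masked m x, v⟫ • masked m x := by
  have h1 : Matrix.toEuclideanLin (dropMat m * gram x * dropMat m) v =
      Matrix.toEuclideanLin (dropMat m) (Matrix.toEuclideanLin (gram x) (masked m v)) := by
    simp [masked, Matrix.toLpLin_apply, Matrix.mulVec_mulVec, Matrix.mul_assoc]
  have h2 : Matrix.toEuclideanLin (gram x) (masked m v) = ⟪x, masked m v⟫ • x := by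
    ext a
    simp only [Matrix.toLpLin_apply, gram, Matrix.mulVec, dotProduct, Matrix.of_apply,
      PiLp.smul_apply, smul_eq_mul, inner_vec, Finset.sum_mul]
    exact Finset.sum_congr rfl fun b _ => by ring
  rw [h1, h2, inner_masked, map_smul]
  rfl

theorem norm_masked_le (m : Fin d → Bool) (x : Vec d) : ‖masked m x‖ ≤ ‖x‖ := by
  rw [EuclideanSpace.norm_eq, EuclideanSpace.norm_eq]
  refine Real.sqrt_le_sqrt (Finset.sum_le_sum fun a _ => ?_)
  rw [masked_apply]
  split_ifs <;> simp [sq_nonneg]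

theorem abs_masked_apply_le (m : Fin d → Bool) (x : Vec d) (a : Fin d) :
    |masked m x a| ≤ |x a| := by
  rw [masked_apply]
  split_ifs <;> simp

/-- The linear part `u ↦ u - α ⟪z, u⟫ z` of a gradient step with masked covariates `z`. -/
noncomputable def slopeOp (α : ℝ) (z : Vec d) : Vec d →L[ℝ] Vec d :=
  ContinuousLinearMap.id ℝ (Vec d) - α • (innerSL ℝ z).smulRight z

theorem slopeOp_apply (α : ℝ) (z u : Vec d) : slopeOp α z u = u - (α * ⟪z, u⟫) • z := by
  simp [slopeOp, mul_smul]

theorem step_sub (α : ℝ) (ξ : Sample d) (u b : Vec d) :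
    step α ξ u - b = slopeOp α (masked ξ.mask ξ.x) (u - b) +
      (α * (ξ.y - ⟪masked ξ.mask ξ.x, b⟫)) • masked ξ.mask ξ.x := by
  rw [step_eq, slopeOp_apply, inner_sub_right]
  simp only [mul_sub, sub_smul]
  abel

theorem norm_slopeOp_sq (α : ℝ) (z u : Vec d) :
    ‖slopeOp α z u‖ ^ 2 = ‖u‖ ^ 2 - 2 * α * ⟪z, u⟫ ^ 2 + α ^ 2 * ‖⟪z, u⟫ • z‖ ^ 2 := by
  rw [slopeOp_apply, norm_sub_sq_real, inner_smul_right, real_inner_comm z u, mul_smul,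
    norm_smul α, mul_pow, Real.norm_eq_abs, sq_abs]
  ring

theorem measurable_masked_uncurry : Measurable fun w : (Fin d → Bool) × Vec d => masked w.1 w.2 := by
  have hz : (fun w : (Fin d → Bool) × Vec d => masked w.1 w.2) =
      fun w => WithLp.toLp 2 fun a => (if w.1 a then 1 else 0) * w.2 a := by
    ext w a
    exact masked_apply _ _ _
  rw [hz]
  refine (WithLp.measurable_toLp 2 (Fin d → ℝ)).comp (measurable_pi_lambda _ fun a => ?_)
  refine Measurable.mul ?_ (by fun_prop)
  exact (measurable_of_countable fun t : Bool => if t = true then (1 : ℝ) else 0).comp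
    ((measurable_pi_apply a).comp measurable_fst)

end Masked

namespace IsModel

variable {Ω : Type*} [MeasurableSpace Ω] {P : Measure Ω} [IsProbabilityMeasure P] {d : ℕ} {p : ℝ}
  {mask : ℤ → Ω → Fin d → Bool} {x : ℤ → Ω → Vec d} {noise : ℤ → Ω → ℝ}

/-! ### First and second moments of one sample -/

theorem integral_bit (h : IsModel P p mask x noise) (a : Fin d) :
    ∫ ω, (if mask 1 ω a then (1 : ℝ) else 0) ∂P = p := by
  have hs : MeasurableSet {ω | mask 1 ω a = true} :=
    ((measurable_pi_apply a).comp (h.measurable_mask 1)) (measurableSet_singleton true)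
  have : (fun ω => if mask 1 ω a then (1 : ℝ) else 0) =
      Set.indicator {ω | mask 1 ω a = true} 1 := by
    ext ω
    simp [Set.indicator_apply]
  rw [this, integral_indicator_one hs, measureReal_def, h.prob_mask 1 a,
    ENNReal.toReal_ofReal h.p_pos.le]

theorem integral_bit_mul_bit (h : IsModel P p mask x noise) (a b : Fin d) :
    ∫ ω, (if mask 1 ω a then (1 : ℝ) else 0) * (if mask 1 ω b then (1 : ℝ) else 0) ∂P =
      if a = b then p else p * p := by
  split_ifs with hab
  · subst hab
    rw [← h.integral_bit a]
    refine integral_congr_ae (ae_of_all _ fun ω => ?_)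
    simp
  · have hi := (h.indep_mask_entries 1).indepFun hab
    have hb := measurable_of_countable fun t : Bool => if t = true then (1 : ℝ) else 0
    have := hi.integral_fun_comp_mul_comp
      ((measurable_pi_apply a).comp (h.measurable_mask 1)).aemeasurable
      ((measurable_pi_apply b).comp (h.measurable_mask 1)).aemeasurable
      hb.aestronglyMeasurable hb.aestronglyMeasurable
    simp only [h.integral_bit] at this
    exact this

theorem memLp_x_apply (h : IsModel P p mask x noise) (a : Fin d) :
    MemLp (fun ω => x 1 ω a) 2 P :=
  h.memLp_x.eval_piLp a

theorem measurable_masked (h : IsModel P p mask x noise) (k : ℤ) :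
    Measurable fun ω => masked (mask k ω) (x k ω) :=
  Measurable.comp (g := fun w : (Fin d → Bool) × Vec d => masked w.1 w.2)
    (f := fun ω => (mask k ω, x k ω)) measurable_masked_uncurry
    ((h.measurable_mask k).prodMk (h.measurable_x k))

theorem memLp_masked (h : IsModel P p mask x noise) :
    MemLp (fun ω => masked (mask 1 ω) (x 1 ω)) 2 P :=
  h.memLp_x.mono (h.measurable_masked 1).aestronglyMeasurable
    (ae_of_all _ fun _ => norm_masked_le _ _)

theorem memLp_inner_masked (h : IsModel P p mask x noise) (v : Vec d) :
    MemLp (fun ω => ⟪masked (mask 1 ω) (x 1 ω), v⟫) 2 P := by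
  simp_rw [real_inner_comm v]
  exact (innerSL ℝ v).comp_memLp' h.memLp_masked

theorem meanGramP_apply (h : IsModel P p mask x noise) (βstar : Vec d) (a b : Fin d) :
    meanGramP P p (samples βstar mask x noise) a b =
      (if a = b then 1 else p) * ∫ ω, x 1 ω a * x 1 ω b ∂P := by
  have hi := (h.memLp_x_apply a).integrable_fun_mul (h.memLp_x_apply b)
  simp only [meanGramP, samples, rescale, gram, Matrix.of_apply, Matrix.add_apply,
    Matrix.smul_apply, smul_eq_mul]
  split_ifs with hab
  · subst hab
    simp only [Matrix.diagonal_apply_eq, one_mul, ← add_mul, add_sub_cancel]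
  · simp only [Matrix.diagonal_apply_ne _ hab, mul_zero, add_zero, integral_const_mul]

theorem integral_masked_mul_masked (h : IsModel P p mask x noise) (βstar : Vec d) (a b : Fin d) :
    ∫ ω, masked (mask 1 ω) (x 1 ω) a * masked (mask 1 ω) (x 1 ω) b ∂P =
      p * meanGramP P p (samples βstar mask x noise) a b := by
  have hb : Measurable fun m : Fin d → Bool =>
      (if m a then (1 : ℝ) else 0) * (if m b then (1 : ℝ) else 0) := measurable_of_countable _
  have hx : Measurable fun w : Vec d × ℝ => w.1 a * w.1 b := by fun_prop
  have := (h.indep_mask 1).integral_fun_comp_mul_comp (h.measurable_mask 1).aemeasurable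
    ((h.measurable_x 1).prodMk (h.measurable_noise 1)).aemeasurable
    hb.aestronglyMeasurable hx.aestronglyMeasurable
  simp only [h.integral_bit_mul_bit] at this
  simp only [masked_apply, h.meanGramP_apply]
  rw [show ∀ r s : ℝ, p * ((if a = b then 1 else p) * s) = (if a = b then p else p * p) * s by
    intro r s; split_ifs <;> ring, ← this]
  · refine integral_congr_ae (ae_of_all _ fun ω => ?_)
    dsimp only
    ring
  -- The rewriting identity does not involve `r`, so any value serves.
  · exact 0

/-- `E[⟪D x, v⟫²]`. -/
noncomputable def energy (_h : IsModel P p mask x noise) (v : Vec d) : ℝ :=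
  ∫ ω, ⟪masked (mask 1 ω) (x 1 ω), v⟫ ^ 2 ∂P

/-- Mask entries are `0` or `1`, so their products have mean `p` on the diagonal and `p²` off it.
This identifies the denominator of the rate condition with `E[⟪D x, v⟫²]`. -/
theorem inner_meanGramP (h : IsModel P p mask x noise) (βstar v : Vec d) :
    p * ⟪v, Matrix.toEuclideanLin (meanGramP P p (samples βstar mask x noise)) v⟫ =
      h.energy v := by
  have hm : ∀ a, MemLp (fun ω => masked (mask 1 ω) (x 1 ω) a) 2 P := h.memLp_masked.eval_piLp
  simp only [energy, inner_vec, sq, Finset.sum_mul_sum, Matrix.toLpLin_apply, Matrix.mulVec,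
    dotProduct]
  rw [integral_finsetSum _ fun a _ => integrable_finsetSum _ fun b _ =>
    ((hm a).mul_const (v a)).integrable_fun_mul ((hm b).mul_const (v b)), Finset.mul_sum]
  refine Finset.sum_congr rfl fun a _ => ?_
  rw [integral_finsetSum _ fun b _ =>
    ((hm a).mul_const (v a)).integrable_fun_mul ((hm b).mul_const (v b)), Finset.mul_sum,
    Finset.mul_sum]
  refine Finset.sum_congr rfl fun b _ => ?_
  have : ∀ ω, masked (mask 1 ω) (x 1 ω) a * v a * (masked (mask 1 ω) (x 1 ω) b * v b) =
      (v a * v b) * (masked (mask 1 ω) (x 1 ω) a * masked (mask 1 ω) (x 1 ω) b) := fun ω => by ring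
  simp_rw [this]
  rw [integral_const_mul, h.integral_masked_mul_masked βstar]
  ring

/-- Dropout regularizes: the energy is `p² E[⟪x, v⟫²]` plus `p (1 - p) ∑ v_a² E[x_a²]`. The second
part alone is coercive by the reduced form, even if `E[x xᵀ]` is singular. -/
theorem exists_energy_ge (h : IsModel P p mask x noise) :
    ∃ κ : ℝ, 0 < κ ∧ ∀ v, κ * ‖v‖ ^ 2 ≤ h.energy v := by
  obtain ⟨m, hm0, hm⟩ : ∃ m : ℝ, 0 < m ∧ ∀ a, m ≤ ∫ ω, x 1 ω a ^ 2 ∂P := by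
    rcases isEmpty_or_nonempty (Fin d) with hd | hd
    · exact ⟨1, one_pos, fun a => hd.elim a⟩
    · obtain ⟨a, ha⟩ := Finite.exists_min fun a => ∫ ω, x 1 ω a ^ 2 ∂P
      exact ⟨_, h.reduced_form a, ha⟩
  have hp := h.p_pos
  have hp1 := sub_pos.2 h.p_lt_one
  refine ⟨p * (1 - p) * m, by positivity, fun v => ?_⟩
  have hxv : MemLp (fun ω => ⟪x 1 ω, v⟫) 2 P := by
    simp_rw [real_inner_comm v]
    exact (innerSL ℝ v).comp_memLp' h.memLp_x
  have key : h.energy v = p * p * ∫ ω, ⟪x 1 ω, v⟫ ^ 2 ∂P +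
      p * (1 - p) * ∑ a, v a ^ 2 * ∫ ω, x 1 ω a ^ 2 ∂P := by
    have e1 : ∫ ω, ⟪x 1 ω, v⟫ ^ 2 ∂P =
        ∑ a, ∑ b, v a * v b * ∫ ω, x 1 ω a * x 1 ω b ∂P := by
      have hm := h.memLp_x_apply
      simp only [inner_vec, sq, Finset.sum_mul_sum]
      rw [integral_finsetSum _ fun a _ => integrable_finsetSum _ fun b _ =>
        ((hm a).mul_const (v a)).integrable_fun_mul ((hm b).mul_const (v b))]
      refine Finset.sum_congr rfl fun a _ => ?_
      rw [integral_finsetSum _ fun b _ =>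
        ((hm a).mul_const (v a)).integrable_fun_mul ((hm b).mul_const (v b))]
      refine Finset.sum_congr rfl fun b _ => ?_
      rw [← integral_const_mul]
      refine integral_congr_ae (ae_of_all _ fun ω => ?_)
      dsimp only
      ring
    rw [← h.inner_meanGramP 0 v, e1, Finset.mul_sum, Finset.mul_sum, ← Finset.sum_add_distrib]
    simp only [inner_vec, Matrix.toLpLin_apply, Matrix.mulVec, dotProduct, Finset.mul_sum]
    refine Finset.sum_congr rfl fun a _ => ?_
    have e2 : p * (1 - p) * (v a ^ 2 * ∫ ω, x 1 ω a ^ 2 ∂P) = ∑ b, if a = b then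
        p * (1 - p) * (v a * v b * ∫ ω, x 1 ω a * x 1 ω b ∂P) else 0 := by
      rw [Finset.sum_ite_eq]
      simp [sq]
    rw [e2, ← Finset.sum_add_distrib]
    refine Finset.sum_congr rfl fun b _ => ?_
    rw [h.meanGramP_apply]
    split_ifs <;> ring
  rw [key, EuclideanSpace.norm_sq_eq, mul_assoc (p * (1 - p)), Finset.mul_sum]
  have h1 : 0 ≤ p * p * ∫ ω, ⟪x 1 ω, v⟫ ^ 2 ∂P :=
    mul_nonneg (by positivity) (integral_nonneg fun ω => sq_nonneg _)
  have h2 : p * (1 - p) * ∑ a, m * ‖v a‖ ^ 2 ≤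
      p * (1 - p) * ∑ a, v a ^ 2 * ∫ ω, x 1 ω a ^ 2 ∂P := by
    refine mul_le_mul_of_nonneg_left (Finset.sum_le_sum fun a _ => ?_) (by positivity)
    rw [Real.norm_eq_abs, sq_abs, mul_comm]
    exact mul_le_mul_of_nonneg_left (hm a) (sq_nonneg _)
  linarith

/-! ### The normal equation and the minimizer of the risk -/

theorem integrable_inner_masked_smul (h : IsModel P p mask x noise) (v : Vec d) :
    Integrable (fun ω => ⟪masked (mask 1 ω) (x 1 ω), v⟫ • masked (mask 1 ω) (x 1 ω)) P :=
  memLp_one_iff_integrable.1 (h.memLp_masked.smul (h.memLp_inner_masked v))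

theorem memLp_response (h : IsModel P p mask x noise) (βstar : Vec d) :
    MemLp (fun ω => (samples βstar mask x noise ω 1).y) 2 P := by
  simp only [samples]
  refine MemLp.add ?_ h.memLp_noise
  simp_rw [real_inner_comm βstar]
  exact (innerSL ℝ βstar).comp_memLp' h.memLp_x

/-- The operator `E[z zᵀ]`, `z = D x`, is injective by coercivity of the energy, hence surjective in
finite dimension. -/
theorem exists_normal_equation (h : IsModel P p mask x noise) (βstar : Vec d) :
    ∃ b : Vec d, ∫ ω, ((samples βstar mask x noise ω 1).y - ⟪masked (mask 1 ω) (x 1 ω), b⟫) •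
      masked (mask 1 ω) (x 1 ω) ∂P = 0 := by
  let T : Vec d →ₗ[ℝ] Vec d :=
    { toFun := fun v => ∫ ω, ⟪masked (mask 1 ω) (x 1 ω), v⟫ • masked (mask 1 ω) (x 1 ω) ∂P
      map_add' := fun u v => by
        simp only [inner_add_right, add_smul]
        exact integral_add (h.integrable_inner_masked_smul u) (h.integrable_inner_masked_smul v)
      map_smul' := fun a v => by
        simp only [inner_smul_right, mul_smul, RingHom.id_apply]
        exact integral_smul a _ }
  have hT : ∀ v, ⟪v, T v⟫ = h.energy v := fun v => by
    change ⟪v, ∫ ω, ⟪masked (mask 1 ω) (x 1 ω), v⟫ • masked (mask 1 ω) (x 1 ω) ∂P⟫ = _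
    rw [← integral_inner (h.integrable_inner_masked_smul v)]
    simp only [inner_smul_right, energy, sq, real_inner_comm v]
  obtain ⟨κ, hκ, hen⟩ := h.exists_energy_ge
  have hinj : Function.Injective T := by
    refine (injective_iff_map_eq_zero T).2 fun v hv => ?_
    have h1 := hen v
    rw [← hT v, hv, inner_zero_right] at h1
    have h2 : ‖v‖ ^ 2 ≤ 0 := by
      by_contra hc
      have := mul_pos hκ (not_le.1 hc)
      linarith
    simpa using le_antisymm h2 (sq_nonneg _)
  obtain ⟨b, hb⟩ := LinearMap.injective_iff_surjective.1 hinj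
    (∫ ω, (samples βstar mask x noise ω 1).y • masked (mask 1 ω) (x 1 ω) ∂P)
  refine ⟨b, ?_⟩
  have hi : Integrable (fun ω =>
      (samples βstar mask x noise ω 1).y • masked (mask 1 ω) (x 1 ω)) P :=
    memLp_one_iff_integrable.1 (h.memLp_masked.smul (h.memLp_response βstar))
  simp only [sub_smul]
  rw [integral_sub hi (h.integrable_inner_masked_smul b), ← hb]
  exact sub_self _

/-- By the normal equation the cross term vanishes, so the excess risk at `β` is half the energy of
`β - b`, which is positive unless `β = b`. -/
theorem isL2Minimizer (h : IsModel P p mask x noise) {βstar b : Vec d}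
    (hb : ∫ ω, ((samples βstar mask x noise ω 1).y - ⟪masked (mask 1 ω) (x 1 ω), b⟫) •
      masked (mask 1 ω) (x 1 ω) ∂P = 0) :
    IsL2Minimizer P (samples βstar mask x noise) b := by
  intro β hβ
  set e : Ω → ℝ := fun ω => (samples βstar mask x noise ω 1).y - ⟪masked (mask 1 ω) (x 1 ω), b⟫
  have he : MemLp e 2 P := (h.memLp_response βstar).sub (h.memLp_inner_masked b)
  have hδ := h.memLp_inner_masked (β - b)
  have hrisk : ∀ v, risk P (samples βstar mask x noise) v = ∫ ω, (1 / 2) *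
      (e ω - ⟪masked (mask 1 ω) (x 1 ω), v - b⟫) ^ 2 ∂P := fun v => by
    refine integral_congr_ae (ae_of_all _ fun ω => ?_)
    have : ⟪(samples βstar mask x noise ω 1).x,
        Matrix.toEuclideanLin (dropMat (samples βstar mask x noise ω 1).mask) v⟫ =
        ⟪masked (mask 1 ω) (x 1 ω), v⟫ := inner_masked _ _ _
    simp only [this, inner_sub_right, e]
    ring
  have hcross : ∫ ω, e ω * ⟪masked (mask 1 ω) (x 1 ω), β - b⟫ ∂P = 0 := by
    have hi : Integrable (fun ω => e ω • masked (mask 1 ω) (x 1 ω)) P :=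
      memLp_one_iff_integrable.1 (h.memLp_masked.smul he)
    have := integral_inner (𝕜 := ℝ) hi (β - b)
    rw [hb, inner_zero_right] at this
    rw [← this]
    refine integral_congr_ae (ae_of_all _ fun ω => ?_)
    simp only [inner_smul_right, real_inner_comm (β - b)]
  have i1 : Integrable (fun ω => (1 / 2) * e ω ^ 2) P := he.integrable_sq.const_mul _
  have i2 : Integrable (fun ω => e ω * ⟪masked (mask 1 ω) (x 1 ω), β - b⟫) P :=
    he.integrable_fun_mul hδ
  have i3 : Integrable (fun ω => (1 / 2) * ⟪masked (mask 1 ω) (x 1 ω), β - b⟫ ^ 2) P :=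
    hδ.integrable_sq.const_mul _
  have hexp : risk P (samples βstar mask x noise) β =
      risk P (samples βstar mask x noise) b + (1 / 2) * h.energy (β - b) := by
    rw [hrisk, hrisk, energy, ← integral_const_mul]
    have hs : ∀ ω, (1 / 2) * (e ω - ⟪masked (mask 1 ω) (x 1 ω), β - b⟫) ^ 2 =
        (1 / 2) * e ω ^ 2 - e ω * ⟪masked (mask 1 ω) (x 1 ω), β - b⟫ +
          (1 / 2) * ⟪masked (mask 1 ω) (x 1 ω), β - b⟫ ^ 2 := fun ω => by ring
    simp only [hs, sub_self, inner_zero_right, sub_zero]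
    rw [integral_add (f := fun ω => (1 / 2) * e ω ^ 2 -
      e ω * ⟪masked (mask 1 ω) (x 1 ω), β - b⟫) (i1.sub i2) i3, integral_sub i1 i2, hcross]
    simp
  obtain ⟨κ, hκ, hen⟩ := h.exists_energy_ge
  have h1 := hen (β - b)
  have h2 : 0 < ‖β - b‖ := norm_pos_iff.2 (sub_ne_zero.2 hβ)
  have h3 : 0 < κ * ‖β - b‖ ^ 2 := by positivity
  linarith

end IsModel

namespace IsModel

variable {Ω : Type*} [MeasurableSpace Ω] {P : Measure Ω} [IsProbabilityMeasure P] {d : ℕ} {p : ℝ}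
  {mask : ℤ → Ω → Fin d → Bool} {x : ℤ → Ω → Vec d} {noise : ℤ → Ω → ℝ}

/-! ### Consequences of the learning-rate condition -/

theorem measurable_inner_masked_smul (h : IsModel P p mask x noise) (v : Vec d) :
    Measurable fun ω => ⟪masked (mask 1 ω) (x 1 ω), v⟫ • masked (mask 1 ω) (x 1 ω) :=
  Measurable.smul (f := fun ω => ⟪masked (mask 1 ω) (x 1 ω), v⟫)
    ((h.measurable_masked 1).inner measurable_const) (h.measurable_masked 1)

theorem energy_smul (h : IsModel P p mask x noise) (a : ℝ) (v : Vec d) :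
    h.energy (a • v) = a ^ 2 * h.energy v := by
  simp only [energy, inner_smul_right, mul_pow, integral_const_mul]

/-- Reduction to `q = 2`: `q - 1 ≥ 1`, the power with exponent `q - 2` is at least `1`, and `μ_q ≥
μ_2`. The constant `τ` is the left side of the rate condition. -/
theorem exists_memLp_and_le_of_norm_eq_one (h : IsModel P p mask x noise) {βstar : Vec d}
    {q α : ℝ} (hq : 2 ≤ q) (hα : RateCondition P p (samples βstar mask x noise) q α) :
    ∃ τ : ℝ, 0 ≤ τ ∧ τ < 1 ∧ ∀ v : Vec d, ‖v‖ = 1 →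
      MemLp (fun ω => ⟪masked (mask 1 ω) (x 1 ω), v⟫ • masked (mask 1 ω) (x 1 ω)) 2 P ∧
      α / 2 * ∫ ω, ‖⟪masked (mask 1 ω) (x 1 ω), v⟫ • masked (mask 1 ω) (x 1 ω)‖ ^ 2 ∂P ≤
        τ * h.energy v := by
  obtain ⟨hα0, hlt⟩ := hα
  set C := ENNReal.ofReal (α * (q - 1) / 2)
  set T := C * (⨆ v : {v : Vec d // ‖v‖ = 1},
      (1 + ENNReal.ofReal α * mu P (samples βstar mask x noise) q v.1) ^ (q - 2) *
        mu P (samples βstar mask x noise) q v.1 ^ 2 /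
        ENNReal.ofReal (p * ⟪v.1,
          Matrix.toEuclideanLin (meanGramP P p (samples βstar mask x noise)) v.1⟫)) with hT
  have hTtop : T ≠ ∞ := (hlt.trans ENNReal.one_lt_top).ne
  refine ⟨T.toReal, ENNReal.toReal_nonneg, ?_, fun v hv => ?_⟩
  · rw [← ENNReal.toReal_one]
    exact (ENNReal.toReal_lt_toReal hTtop ENNReal.one_ne_top).2 hlt
  set W := fun ω => ⟪masked (mask 1 ω) (x 1 ω), v⟫ • masked (mask 1 ω) (x 1 ω)
  have hW : AEStronglyMeasurable W P := (h.measurable_inner_masked_smul v).aestronglyMeasurable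
  have hE : 0 < h.energy v := by
    obtain ⟨κ, hκ, hen⟩ := h.exists_energy_ge
    have := hen v
    rw [hv] at this
    linarith
  have hmu : mu P (samples βstar mask x noise) q v = eLpNorm W (ENNReal.ofReal q) P := by
    simp only [mu, toEuclideanLin_drop_gram_drop]
    rfl
  have hmono : eLpNorm W 2 P ≤ mu P (samples βstar mask x noise) q v := by
    rw [hmu]
    refine eLpNorm_le_eLpNorm_of_exponent_le ?_ hW
    rw [show (2 : ℝ≥0∞) = ENNReal.ofReal 2 by simp]
    exact ENNReal.ofReal_le_ofReal hq
  have hC : ENNReal.ofReal (α / 2) ≤ C := ENNReal.ofReal_le_ofReal (by nlinarith)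
  have hbound : ENNReal.ofReal (α / 2) * (eLpNorm W 2 P ^ 2 / ENNReal.ofReal (h.energy v)) ≤ T := by
    rw [hT]
    refine mul_le_mul' hC (le_trans ?_ (le_iSup _ (⟨v, hv⟩ : {v : Vec d // ‖v‖ = 1})))
    dsimp only
    rw [h.inner_meanGramP]
    refine ENNReal.div_le_div_right ?_ _
    calc eLpNorm W 2 P ^ 2 ≤ 1 * mu P (samples βstar mask x noise) q v ^ 2 := by
          rw [one_mul]
          gcongr
      _ ≤ _ := by
          gcongr
          simpa using ENNReal.rpow_le_rpow (z := q - 2) (le_self_add (a := (1 : ℝ≥0∞))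
            (b := ENNReal.ofReal α * mu P (samples βstar mask x noise) q v)) (by linarith)
  have hE0 : ENNReal.ofReal (h.energy v) ≠ 0 := (ENNReal.ofReal_pos.2 hE).ne'
  have hbound' : ENNReal.ofReal (α / 2) * eLpNorm W 2 P ^ 2 ≤ T * ENNReal.ofReal (h.energy v) := by
    rw [← mul_div_assoc] at hbound
    exact (ENNReal.div_le_iff hE0 ENNReal.ofReal_ne_top).1 hbound
  -- Finiteness of the moment is read off the bound itself, whose right side is finite while `α / 2
  -- > 0`.
  have hWtop : eLpNorm W 2 P ≠ ∞ := by
    intro htop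
    rw [htop, ENNReal.top_pow two_ne_zero, ENNReal.mul_top (ENNReal.ofReal_pos.2 (by positivity)).ne']
      at hbound'
    exact ENNReal.mul_ne_top hTtop ENNReal.ofReal_ne_top (top_le_iff.1 hbound')
  refine ⟨⟨hW, hWtop.lt_top⟩, ?_⟩
  have hint : ∫ ω, ‖W ω‖ ^ 2 ∂P = (eLpNorm W 2 P ^ 2).toReal := by
    rw [integral_sq_eq_toReal_eLpNorm hW.norm, eLpNorm_norm, ENNReal.toReal_pow]
  have := ENNReal.toReal_mono (ENNReal.mul_ne_top hTtop ENNReal.ofReal_ne_top) hbound'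
  rw [ENNReal.toReal_mul, ENNReal.toReal_mul, ENNReal.toReal_ofReal (by positivity),
    ENNReal.toReal_ofReal hE.le] at this
  rw [hint]
  exact this

theorem exists_memLp_and_le (h : IsModel P p mask x noise) {βstar : Vec d}
    {q α : ℝ} (hq : 2 ≤ q) (hα : RateCondition P p (samples βstar mask x noise) q α) :
    ∃ τ : ℝ, 0 ≤ τ ∧ τ < 1 ∧ ∀ v : Vec d,
      MemLp (fun ω => ⟪masked (mask 1 ω) (x 1 ω), v⟫ • masked (mask 1 ω) (x 1 ω)) 2 P ∧
      α / 2 * ∫ ω, ‖⟪masked (mask 1 ω) (x 1 ω), v⟫ • masked (mask 1 ω) (x 1 ω)‖ ^ 2 ∂P ≤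
        τ * h.energy v := by
  obtain ⟨τ, h0, h1, hτ⟩ := h.exists_memLp_and_le_of_norm_eq_one hq hα
  refine ⟨τ, h0, h1, fun v => ?_⟩
  rcases eq_or_ne v 0 with rfl | hv
  · simp [energy]
  · obtain ⟨hm, hle⟩ := hτ (‖v‖⁻¹ • v) (norm_smul_inv_norm hv)
    have hvv : v = ‖v‖ • ‖v‖⁻¹ • v := by
      rw [smul_smul, mul_inv_cancel₀ (norm_ne_zero_iff.2 hv), one_smul]
    generalize ‖v‖⁻¹ • v = w at hm hle hvv
    generalize ‖v‖ = a at hvv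
    subst hvv
    simp only [inner_smul_right, mul_smul, h.energy_smul, norm_smul a, mul_pow,
      integral_const_mul, Real.norm_eq_abs, sq_abs]
    refine ⟨hm.const_smul a, ?_⟩
    have := mul_le_mul_of_nonneg_left hle (sq_nonneg a)
    linarith

theorem exists_integral_norm_slopeOp_le (h : IsModel P p mask x noise) {βstar : Vec d}
    {q α : ℝ} (hq : 2 ≤ q) (hα : RateCondition P p (samples βstar mask x noise) q α) :
    ∃ r : ℝ, 0 ≤ r ∧ r < 1 ∧ ∀ v : Vec d,
      Integrable (fun ω => ‖slopeOp α (masked (mask 1 ω) (x 1 ω)) v‖ ^ 2) P ∧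
      ∫ ω, ‖slopeOp α (masked (mask 1 ω) (x 1 ω)) v‖ ^ 2 ∂P ≤ r * ‖v‖ ^ 2 := by
  obtain ⟨τ, h0, h1, hτ⟩ := h.exists_memLp_and_le hq hα
  obtain ⟨κ, hκ, hen⟩ := h.exists_energy_ge
  have hα0 := hα.1
  have hτ1 := sub_pos.2 h1
  have hpos : 0 < 2 * α * (1 - τ) * κ := by positivity
  -- In the expansion of the squared norm, the quadratic term in `α` is at most `2 α τ` times the
  -- energy. What remains is `‖v‖² - 2 α (1 - τ) · energy`, and the energy is at least `κ ‖v‖²`. The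
  -- maximum with `0` only secures nonnegativity.
  refine ⟨max 0 (1 - 2 * α * (1 - τ) * κ), le_max_left _ _, max_lt one_pos (by linarith),
    fun v => ?_⟩
  obtain ⟨hm, hle⟩ := hτ v
  have i1 : Integrable (fun ω => 2 * α * ⟪masked (mask 1 ω) (x 1 ω), v⟫ ^ 2) P :=
    (h.memLp_inner_masked v).integrable_sq.const_mul _
  have i2 : Integrable (fun ω =>
      α ^ 2 * ‖⟪masked (mask 1 ω) (x 1 ω), v⟫ • masked (mask 1 ω) (x 1 ω)‖ ^ 2) P :=
    (hm.integrable_norm_pow two_ne_zero).const_mul _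
  have i0 : Integrable (fun ω => ‖v‖ ^ 2 - 2 * α * ⟪masked (mask 1 ω) (x 1 ω), v⟫ ^ 2) P :=
    (integrable_const _).sub i1
  simp only [norm_slopeOp_sq]
  refine ⟨i0.add i2, ?_⟩
  rw [integral_add i0 i2, integral_sub (integrable_const _) i1, integral_const_mul,
    integral_const_mul, integral_const, probReal_univ, one_smul]
  change ‖v‖ ^ 2 - 2 * α * h.energy v + _ ≤ _
  have e1 := mul_le_mul_of_nonneg_left hle (show 0 ≤ 2 * α by positivity)
  have e2 := mul_le_mul_of_nonneg_left (hen v) (show 0 ≤ 2 * α * (1 - τ) by positivity)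
  have e3 := mul_le_mul_of_nonneg_right (le_max_right 0 (1 - 2 * α * (1 - τ) * κ))
    (sq_nonneg ‖v‖)
  nlinarith

/-- The rate condition controls the masked products only. The mask is independent of `x` and retains
both coordinates with positive probability, so the unmasked products are square integrable too. -/
theorem memLp_x_mul_x (h : IsModel P p mask x noise) {βstar : Vec d}
    {q α : ℝ} (hq : 2 ≤ q) (hα : RateCondition P p (samples βstar mask x noise) q α)
    (a b : Fin d) : MemLp (fun ω => x 1 ω a * x 1 ω b) 2 P := by
  obtain ⟨τ, -, -, hτ⟩ := h.exists_memLp_and_le hq hα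
  have hm : MemLp (fun ω => (⟪masked (mask 1 ω) (x 1 ω), EuclideanSpace.single b (1 : ℝ)⟫ •
      masked (mask 1 ω) (x 1 ω)) a) 2 P := (hτ _).1.eval_piLp a
  have hx : Measurable fun w : Vec d × ℝ => (w.1 a * w.1 b) ^ 2 := by fun_prop
  have hb : Measurable fun m : Fin d → Bool =>
      (if m a then (1 : ℝ) else 0) * (if m b then (1 : ℝ) else 0) := measurable_of_countable _
  have hind : IndepFun (fun ω => (if mask 1 ω a then (1 : ℝ) else 0) *
      (if mask 1 ω b then (1 : ℝ) else 0)) (fun ω => (x 1 ω a * x 1 ω b) ^ 2) P :=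
    (h.indep_mask 1).comp hb hx
  have hxm : Measurable fun ω => x 1 ω a * x 1 ω b := by
    have := h.measurable_x 1
    fun_prop
  refine (memLp_two_iff_integrable_sq hxm.aestronglyMeasurable).2
    (hind.integrable_right_of_integrable_op (· * ·) 1 one_ne_zero
      (fun r t => by simp [enorm_mul]) ?_
      (hb.comp (h.measurable_mask 1)).aestronglyMeasurable
      (hxm.pow_const 2).aestronglyMeasurable fun hzero => ?_)
  · refine hm.integrable_sq.congr (ae_of_all _ fun ω => ?_)
    simp only [PiLp.smul_apply, smul_eq_mul, EuclideanSpace.inner_single_right, masked_apply]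
    split_ifs <;> simp [mul_comm]
  · have := h.integral_bit_mul_bit a b
    rw [integral_congr_ae hzero] at this
    have hp := h.p_pos
    have hpp : 0 < p * p := by positivity
    simp only [Pi.zero_apply, integral_zero] at this
    split_ifs at this <;> linarith

/-- The covariate part reduces to the products `x_c x_a`. The noise part is square integrable
because noise and covariates are independent with finite second moments. -/
theorem memLp_residual_smul (h : IsModel P p mask x noise) {βstar : Vec d}
    {q α : ℝ} (hq : 2 ≤ q) (hα : RateCondition P p (samples βstar mask x noise) q α)
    (b : Vec d) : MemLp (fun ω => ((samples βstar mask x noise ω 1).y -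
      ⟪masked (mask 1 ω) (x 1 ω), b⟫) • masked (mask 1 ω) (x 1 ω)) 2 P := by
  have hz : ∀ a, Measurable fun ω => masked (mask 1 ω) (x 1 ω) a := fun a => by
    have := h.measurable_masked 1
    fun_prop
  have hxm : ∀ a, Measurable fun ω => x 1 ω a := fun a => by
    have := h.measurable_x 1
    fun_prop
  have hx := h.memLp_x_mul_x hq hα
  refine MemLp.of_eval_piLp fun a => ?_
  have h1 : ∀ c, MemLp (fun ω => x 1 ω c * masked (mask 1 ω) (x 1 ω) a) 2 P := fun c =>
    (hx c a).mono ((hxm c).mul (hz a)).aestronglyMeasurable (ae_of_all _ fun ω => by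
      rw [norm_mul, norm_mul]
      exact mul_le_mul_of_nonneg_left (abs_masked_apply_le _ _ _) (norm_nonneg _))
  have h2 : ∀ c, MemLp (fun ω => masked (mask 1 ω) (x 1 ω) c * masked (mask 1 ω) (x 1 ω) a) 2 P :=
    fun c => (h1 c).mono ((hz c).mul (hz a)).aestronglyMeasurable (ae_of_all _ fun ω => by
      rw [norm_mul, norm_mul]
      exact mul_le_mul_of_nonneg_right (abs_masked_apply_le _ _ _) (norm_nonneg _))
  have h3 : MemLp (fun ω => noise 1 ω * masked (mask 1 ω) (x 1 ω) a) 2 P := by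
    have hn := h.measurable_noise 1
    have hsq : Integrable (fun ω => (noise 1 ω * x 1 ω a) ^ 2) P := by
      have hf : Measurable fun w : Vec d => w a ^ 2 := by fun_prop
      have hi := (h.indep_noise 1).symm.comp (measurable_id.pow_const 2) hf
      refine (hi.integrable_mul h.memLp_noise.integrable_sq
        (h.memLp_x_apply a).integrable_sq).congr (ae_of_all _ fun ω => ?_)
      simp [mul_pow]
    refine ((memLp_two_iff_integrable_sq (hn.mul (hxm a)).aestronglyMeasurable).2 hsq).mono
      (hn.mul (hz a)).aestronglyMeasurable (ae_of_all _ fun ω => ?_)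
    simp only [Pi.mul_apply, norm_mul]
    exact mul_le_mul_of_nonneg_left (abs_masked_apply_le _ _ _) (norm_nonneg _)
  have h4 : MemLp (fun ω => ∑ c, βstar c * (x 1 ω c * masked (mask 1 ω) (x 1 ω) a) +
      noise 1 ω * masked (mask 1 ω) (x 1 ω) a -
      ∑ c, b c * (masked (mask 1 ω) (x 1 ω) c * masked (mask 1 ω) (x 1 ω) a)) 2 P :=
    ((memLp_finsetSum _ fun c _ => (h1 c).const_mul (βstar c)).add h3).sub
      (memLp_finsetSum _ fun c _ => (h2 c).const_mul (b c))
  refine h4.congr_norm ?_ (ae_of_all _ fun ω => ?_)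
  · have := h.memLp_response βstar
    exact ((this.sub (h.memLp_inner_masked b)).aestronglyMeasurable).mul
      (hz a).aestronglyMeasurable
  · congr 1
    simp only [PiLp.smul_apply, smul_eq_mul, samples, inner_vec, sub_mul, add_mul, Finset.sum_mul]
    congr 1
    · congr 1
      exact Finset.sum_congr rfl fun c _ => by ring
    · exact Finset.sum_congr rfl fun c _ => by ring

end IsModel

/-! ### Stacked chains -/

section Stacked

variable {s d : ℕ}

/-- One dropout mask, covariate vector and noise variable. -/
abbrev Input (d : ℕ) : Type := (Fin d → Bool) × Vec d × ℝ

/-- The `i`-th of the `s` stacked vectors. -/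
noncomputable def slot (i : Fin s) (U : EuclideanSpace ℝ (Fin s × Fin d)) : Vec d :=
  WithLp.toLp 2 fun a => U (i, a)

theorem slot_stack (i : Fin s) (u : Fin s → Vec d) : slot i (stack u) = u i := rfl

theorem continuous_slot (i : Fin s) :
    Continuous (slot i : EuclideanSpace ℝ (Fin s × Fin d) → Vec d) := by
  unfold slot
  fun_prop

theorem norm_stack_sq (u : Fin s → Vec d) : ‖stack u‖ ^ 2 = ∑ i, ‖u i‖ ^ 2 := by
  simp only [EuclideanSpace.norm_sq_eq, Fintype.sum_prod_type]
  rfl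

theorem sum_norm_slot_sq (U : EuclideanSpace ℝ (Fin s × Fin d)) :
    ∑ i, ‖slot i U‖ ^ 2 = ‖U‖ ^ 2 :=
  (norm_stack_sq fun i => slot i U).symm

theorem measurable_stack {Ω : Type*} [MeasurableSpace Ω] {f : Fin s → Ω → Vec d}
    (hf : ∀ i, Measurable (f i)) : Measurable fun ω => stack fun i => f i ω := by
  refine (WithLp.measurable_toLp 2 (Fin s × Fin d → ℝ)).comp
    (measurable_pi_lambda _ fun ia => ?_)
  have := hf ia.1
  fun_prop

/-- The linear part of a step of the stacked chains. -/
noncomputable def stackedSlope (α : Fin s → ℝ) (w : Input d) :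
    EuclideanSpace ℝ (Fin s × Fin d) →L[ℝ] EuclideanSpace ℝ (Fin s × Fin d) :=
  LinearMap.toContinuousLinearMap
    { toFun := fun U => stack fun i => slopeOp (α i) (masked w.1 w.2.1) (slot i U)
      map_add' := fun U V => by
        have : ∀ i, slot i (U + V) = slot i U + slot i V := fun i => rfl
        simp only [this, map_add]
        rfl
      map_smul' := fun a U => by
        have : ∀ i, slot i (a • U) = a • slot i U := fun i => rfl
        simp only [this, map_smul]
        rfl }

theorem stackedSlope_apply (α : Fin s → ℝ) (w : Input d)
    (U : EuclideanSpace ℝ (Fin s × Fin d)) : stackedSlope α w U =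
      stack fun i => slopeOp (α i) (masked w.1 w.2.1) (slot i U) := rfl

/-- `v ↦ (α₁ v, …, α_s v)`. -/
noncomputable def scaledStack (α : Fin s → ℝ) : Vec d →L[ℝ] EuclideanSpace ℝ (Fin s × Fin d) :=
  LinearMap.toContinuousLinearMap
    { toFun := fun v => stack fun i => α i • v
      map_add' := fun u v => by
        simp only [smul_add]
        rfl
      map_smul' := fun a v => by
        simp only [smul_comm _ a v]
        rfl }

/-- The intercept of a step of the stacked chains centered at `b`. -/
noncomputable def stackedIntercept (α : Fin s → ℝ) (βstar b : Vec d) (w : Input d) :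
    EuclideanSpace ℝ (Fin s × Fin d) :=
  scaledStack α ((⟪w.2.1, βstar⟫ + w.2.2 - ⟪masked w.1 w.2.1, b⟫) • masked w.1 w.2.1)

variable {Ω : Type*} (βstar : Vec d) (mask : ℤ → Ω → Fin d → Bool)
    (x : ℤ → Ω → Vec d) (noise : ℤ → Ω → ℝ)

theorem step_samples (α : Fin s → ℝ) (b : Vec d) (ω : Ω) (k : ℤ) (i : Fin s)
    (U : EuclideanSpace ℝ (Fin s × Fin d)) :
    step (α i) (samples βstar mask x noise ω k) (b + slot i U) =
      b + slot i (stackedSlope α (mask k ω, x k ω, noise k ω) U +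
        stackedIntercept α βstar b (mask k ω, x k ω, noise k ω)) := by
  have h := step_sub (α i) (samples βstar mask x noise ω k) (b + slot i U) b
  rw [add_sub_cancel_left, mul_smul] at h
  rw [← sub_eq_iff_eq_add', h]
  rfl

theorem backward_samples (α : Fin s → ℝ) (b u : Vec d) (ω : Ω) (i : Fin s) (m : ℕ) (k : ℤ) :
    backward (α i) (samples βstar mask x noise ω) u m k =
      b + slot i (affineBack (stackedSlope α) (stackedIntercept α βstar b)
        (fun j => (mask j ω, x j ω, noise j ω)) (stack fun _ => u - b) (m + 1) k) := by
  induction m generalizing k with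
  | zero =>
    rw [affineBack, affineBack, ← step_samples, slot_stack, add_sub_cancel]
    rfl
  | succ m ih =>
    rw [affineBack, ← step_samples, ← ih]
    rfl

theorem iter_samples (α : Fin s → ℝ) (b : Vec d) (β₀ : Fin s → Vec d) (ω : Ω) (i : Fin s)
    (n : ℕ) : iter (α i) (samples βstar mask x noise ω) (β₀ i) n =
      b + slot i (affineFwd (stackedSlope α) (stackedIntercept α βstar b)
        (fun j => (mask (0 + j + 1) ω, x (0 + j + 1) ω, noise (0 + j + 1) ω))
        (stack fun i => β₀ i - b) n) := by
  induction n with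
  | zero =>
    -- Time `0` carries no input; step `j` of the forward chain reads the input at time `j + 1`.
    rw [affineFwd, slot_stack, add_sub_cancel]
    rfl
  | succ n ih =>
    rw [affineFwd, ← step_samples, ← ih, zero_add]
    rfl

theorem stack_avg_sub (α : Fin s → ℝ) (b : Vec d) (β₀ : Fin s → Vec d) (ω : Ω) {n : ℕ}
    (hn : n ≠ 0) :
    (stack fun i => avg (α i) (samples βstar mask x noise ω) (β₀ i) n - b) =
      (n : ℝ)⁻¹ • ∑ k ∈ Finset.range n,
        affineFwd (stackedSlope α) (stackedIntercept α βstar b)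
          (fun j => (mask (0 + j + 1) ω, x (0 + j + 1) ω, noise (0 + j + 1) ω))
          (stack fun i => β₀ i - b) (k + 1) := by
  ext ⟨i, a⟩
  have hn' : (n : ℝ) ≠ 0 := Nat.cast_ne_zero.2 hn
  simp only [stack, avg, iter_samples βstar mask x noise α b, PiLp.sub_apply, PiLp.smul_apply,
    smul_eq_mul, WithLp.ofLp_sum, Finset.sum_apply, PiLp.add_apply, Finset.sum_add_distrib,
    Finset.sum_const, Nat.card_Icc, add_tsub_cancel_right, nsmul_eq_mul, mul_add]
  rw [inv_mul_cancel_left₀ hn', add_sub_cancel_left, Finset.sum_bij' (fun k _ => k - 1)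
    (fun k _ => k + 1)]
  all_goals simp +contextual [slot]
  all_goals grind

end Stacked

theorem IsLongRunCovariance.const_add {Ω ι : Type*} [MeasurableSpace Ω] {P : Measure Ω}
    [IsProbabilityMeasure P] [Fintype ι] {Z : ℤ → Ω → EuclideanSpace ℝ ι} {S : Matrix ι ι ℝ}
    (h : IsLongRunCovariance P Z S) (v : EuclideanSpace ℝ ι) :
    IsLongRunCovariance P (fun k ω => v + Z k ω) S := by
  have hi : ∀ k a, Integrable (fun ω => Z k ω a) P := fun k a =>
    ((h.1 k).eval_piLp a).integrable one_le_two
  refine ⟨fun k => (memLp_const v).add (h.1 k), fun a b => ?_⟩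
  convert h.2 a b using 2 with k
  simp only [PiLp.add_apply]
  rw [covariance_const_add_left (hi 0 a), covariance_const_add_right (hi k b)]

/-! ### The stacked regression chain is a contracting affine chain -/

namespace IsModel

variable {Ω : Type*} [MeasurableSpace Ω] {P : Measure Ω} [IsProbabilityMeasure P] {s d : ℕ}
  {p : ℝ} {mask : ℤ → Ω → Fin d → Bool} {x : ℤ → Ω → Vec d} {noise : ℤ → Ω → ℝ}

theorem identDistrib_mask_apply (h : IsModel P p mask x noise) (k : ℤ) (a : Fin d) :
    IdentDistrib (fun ω => mask k ω a) (fun ω => mask 1 ω a) P P := by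
  have hm : ∀ k, Measurable fun ω => mask k ω a := fun k =>
    (measurable_pi_apply a).comp (h.measurable_mask k)
  have htrue : ∀ k, P.map (fun ω => mask k ω a) {true} = ENNReal.ofReal p := fun k => by
    rw [Measure.map_apply (hm k) (measurableSet_singleton true)]
    exact h.prob_mask k a
  have hfalse : ∀ k, P.map (fun ω => mask k ω a) {false} = 1 - ENNReal.ofReal p := fun k => by
    have := Measure.isProbabilityMeasure_map (μ := P) (hm k).aemeasurable
    rw [← htrue k, ← prob_compl_eq_one_sub (measurableSet_singleton true)]
    congr 1
    ext t
    simp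
  refine ⟨(hm k).aemeasurable, (hm 1).aemeasurable, Measure.ext_of_singleton fun t => ?_⟩
  cases t
  · rw [hfalse, hfalse]
  · rw [htrue, htrue]

theorem identDistrib_input (h : IsModel P p mask x noise) (k : ℤ) :
    IdentDistrib (fun ω => (mask k ω, x k ω, noise k ω)) (fun ω => (mask 1 ω, x 1 ω, noise 1 ω))
      P P := by
  have h1 : IdentDistrib (mask k) (mask 1) P P :=
    IdentDistrib.pi (h.identDistrib_mask_apply k) (h.indep_mask_entries k)
      (h.indep_mask_entries 1)
  exact h1.prodMk ((h.identDistrib_x k).prodMk (h.identDistrib_noise k) (h.indep_noise k)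
    (h.indep_noise 1)) (h.indep_mask k) (h.indep_mask 1)

/-- The squared norm of a stack is the sum over its slots, each contracting in mean square. The
largest of the finitely many rates serves all of them, however the slots are correlated. -/
theorem exists_eLpNorm_stackedSlope_le (h : IsModel P p mask x noise) {βstar : Vec d} {q : ℝ}
    (hq : 2 ≤ q) {α : Fin s → ℝ}
    (hα : ∀ i, RateCondition P p (samples βstar mask x noise) q (α i)) :
    ∃ ρ : ℝ≥0∞, ρ < 1 ∧ ∀ U : EuclideanSpace ℝ (Fin s × Fin d),
      eLpNorm (fun ω => stackedSlope α (mask 1 ω, x 1 ω, noise 1 ω) U) 2 P ≤ ρ * ‖U‖ₑ := by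
  choose r hr0 hr1 hr using fun i => h.exists_integral_norm_slopeOp_le hq (hα i)
  obtain ⟨R, hR0, hR1, hR⟩ : ∃ R : ℝ, 0 ≤ R ∧ R < 1 ∧ ∀ i, r i ≤ R := by
    refine ⟨((Finset.univ.sup fun i => (r i).toNNReal : NNReal) : ℝ), NNReal.coe_nonneg _,
      ?_, fun i => ?_⟩
    · rw [← NNReal.coe_one, NNReal.coe_lt_coe, Finset.sup_lt_iff (zero_lt_one' NNReal)]
      exact fun i _ => Real.toNNReal_lt_one.2 (hr1 i)
    · exact Real.toNNReal_le_iff_le_coe.1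
        (Finset.le_sup (f := fun i => (r i).toNNReal) (Finset.mem_univ i))
  refine ⟨ENNReal.ofReal √R, ?_, fun U => ?_⟩
  · rw [← ENNReal.ofReal_one, ENNReal.ofReal_lt_ofReal_iff one_pos, Real.sqrt_lt' one_pos]
    simpa using hR1
  · have hsum : ∀ ω, ‖stackedSlope α (mask 1 ω, x 1 ω, noise 1 ω) U‖ ^ 2 =
        ∑ i, ‖slopeOp (α i) (masked (mask 1 ω) (x 1 ω)) (slot i U)‖ ^ 2 := fun ω => by
      rw [stackedSlope_apply, norm_stack_sq]
    have hint : Integrable (fun ω => ‖stackedSlope α (mask 1 ω, x 1 ω, noise 1 ω) U‖ ^ 2) P := by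
      simp only [hsum]
      exact integrable_finsetSum _ fun i _ => (hr i _).1
    have hle : ∫ ω, ‖stackedSlope α (mask 1 ω, x 1 ω, noise 1 ω) U‖ ^ 2 ∂P ≤ R * ‖U‖ ^ 2 := by
      simp only [hsum]
      rw [integral_finsetSum _ fun i _ => (hr i _).1, ← sum_norm_slot_sq, Finset.mul_sum]
      exact Finset.sum_le_sum fun i _ => (hr i _).2.trans
        (mul_le_mul_of_nonneg_right (hR i) (sq_nonneg _))
    have hsq : ENNReal.ofReal (R * ‖U‖ ^ 2) = (ENNReal.ofReal √R * ‖U‖ₑ) ^ 2 := by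
      rw [mul_pow, ← ENNReal.ofReal_pow (Real.sqrt_nonneg _), Real.sq_sqrt hR0, ← ofReal_norm,
        ← ENNReal.ofReal_pow (norm_nonneg _), ENNReal.ofReal_mul hR0]
    rw [eLpNorm_two_le_iff, ← hsq]
    refine le_trans (le_of_eq ?_) (ENNReal.ofReal_le_ofReal hle)
    rw [ofReal_integral_eq_lintegral_ofReal hint (ae_of_all _ fun ω => sq_nonneg _)]
    refine lintegral_congr fun ω => ?_
    rw [ENNReal.ofReal_pow (norm_nonneg _), ofReal_norm]

theorem exists_affineChain (h : IsModel P p mask x noise) {βstar b : Vec d} {q : ℝ}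
    (hq : 2 ≤ q) {α : Fin s → ℝ}
    (hα : ∀ i, RateCondition P p (samples βstar mask x noise) q (α i))
    (hb : ∫ ω, ((samples βstar mask x noise ω 1).y - ⟪masked (mask 1 ω) (x 1 ω), b⟫) •
      masked (mask 1 ω) (x 1 ω) ∂P = 0) :
    ∃ ρ, AffineChain P (fun k ω => (mask k ω, x k ω, noise k ω)) (stackedSlope α)
      (stackedIntercept α βstar b) ρ := by
  obtain ⟨ρ, hρ, hcontract⟩ := h.exists_eLpNorm_stackedSlope_le hq hα
  have hz : Measurable fun w : Input d => masked w.1 w.2.1 :=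
    Measurable.comp (g := fun w : (Fin d → Bool) × Vec d => masked w.1 w.2)
      (f := fun w : Input d => (w.1, w.2.1)) measurable_masked_uncurry (by fun_prop)
  refine ⟨ρ, fun k => (h.measurable_mask k).prodMk ((h.measurable_x k).prodMk
    (h.measurable_noise k)), h.indep, h.identDistrib_input, fun U => ?_, ?_, hρ, hcontract,
    ?_, ?_⟩
  · simp only [stackedSlope_apply, slopeOp_apply]
    exact measurable_stack fun i => by fun_prop
  · unfold stackedIntercept
    fun_prop
  -- The moment bound comes from the rate condition of some chain; for `s = 0` the stacked space is
  -- trivial.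
  · rcases isEmpty_or_nonempty (Fin s) with hs | ⟨⟨i⟩⟩
    · exact (memLp_const (0 : EuclideanSpace ℝ (Fin s × Fin d))).ae_eq
        (ae_of_all _ fun _ => Subsingleton.elim _ _)
    · exact (scaledStack α).comp_memLp' (h.memLp_residual_smul hq (hα i) b)
  · rcases isEmpty_or_nonempty (Fin s) with hs | ⟨⟨i⟩⟩
    · exact Subsingleton.elim _ _
    · have hi := (h.memLp_residual_smul hq (hα i) b).integrable one_le_two
      have := (scaledStack α).integral_comp_comm hi
      rw [hb, map_zero] at this
      exact this

end IsModel

end SGDDropout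

/-! ### The joint limit theorem for several learning rates -/

theorem mainTheorem12 {Ω : Type*} [MeasurableSpace Ω] (P : Measure Ω) [IsProbabilityMeasure P]
    {d s : ℕ} (p : ℝ) (βstar : SGDDropout.Vec d)
    (mask : ℤ → Ω → Fin d → Bool) (x : ℤ → Ω → SGDDropout.Vec d) (noise : ℤ → Ω → ℝ)
    (hmodel : SGDDropout.IsModel P p mask x noise)
    (q : ℝ) (hq : 2 ≤ q) (α : Fin s → ℝ)
    (hα : ∀ i, SGDDropout.RateCondition P p (SGDDropout.samples βstar mask x noise) q (α i)) :
    ∃ (b : SGDDropout.Vec d) (B : Fin s → ℤ → Ω → SGDDropout.Vec d)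
      (S : Matrix (Fin s × Fin d) (Fin s × Fin d) ℝ),
      SGDDropout.IsL2Minimizer P (SGDDropout.samples βstar mask x noise) b ∧
      (∀ i, SGDDropout.IsStationaryProcess P (SGDDropout.samples βstar mask x noise)
        (α i) (B i)) ∧
      SGDDropout.IsLongRunCovariance P
        (fun k ω => SGDDropout.stack fun i => B i k ω) S ∧
      S.PosSemidef ∧
      ∀ β₀ : Fin s → SGDDropout.Vec d,
        TendstoInDistribution
          (fun (n : ℕ) ω => √(n : ℝ) • SGDDropout.stack fun i =>
            SGDDropout.avg (α i) (SGDDropout.samples βstar mask x noise ω) (β₀ i) n - b)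
          atTop id (fun _ => P) (multivariateGaussian 0 S) := by
  obtain ⟨b, hb⟩ := hmodel.exists_normal_equation βstar
  obtain ⟨ρ, h⟩ := hmodel.exists_affineChain hq hα hb
  refine ⟨b, fun i k ω => b + SGDDropout.slot i (SGDDropout.affineStat
    (SGDDropout.stackedSlope α) (SGDDropout.stackedIntercept α βstar b)
    (fun j => (mask j ω, x j ω, noise j ω)) k), h.longRunCov, hmodel.isL2Minimizer hb,
    fun i k u => ?_, ?_, h.posSemidef_longRunCov, fun β₀ => ?_⟩
  · filter_upwards [h.ae_tendsto_back (SGDDropout.stack fun _ => u - b) k] with ω hω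
    simp only [SGDDropout.backward_samples βstar mask x noise α b u ω i]
    -- The index is shifted by one: `backward` at `m` composes `m + 1` maps, whereas `affineBack` at
    -- `m` composes `m`.
    exact (((SGDDropout.continuous_slot i).tendsto _).comp
      ((tendsto_add_atTop_iff_nat 1).2 hω)).const_add b
  · exact SGDDropout.IsLongRunCovariance.const_add ⟨h.memLp_stat, h.hasSum_cov_stat⟩
      (SGDDropout.stack fun _ => b)
  · refine (h.tendstoInDistribution_fwd (SGDDropout.stack fun i => β₀ i - b)).congr
      (fun n => ae_of_all _ fun ω => ?_) (ae_of_all _ fun _ => rfl)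
    -- For `n = 0` averaging does not commute with centering, but the factor `√0` makes both sides
    -- zero.
    rcases eq_or_ne n 0 with rfl | hn
    · simp
    · dsimp only
      rw [SGDDropout.stack_avg_sub βstar mask x noise α b β₀ ω hn]
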